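/- Let $\Sigma$ be a compact connected oriented smooth surface without boundary and let $\rho$ be a smooth Riemannian metric on $\Sigma$ of constant scalar curvature $-1$ (Gauss curvature $-\tfrac12$). Indices are raised and lowered, and norms are taken, with respect to $\rho$. Let $\mathcal K(\rho)$ be the space of TT-tensors on $(\Sigma,\rho)$, i.e. smooth symmetric $(0,2)$-tensor fields $\mathfrak z$ with $\rho^{ab}\mathfrak z_{ab}=0$ and $\nabla_\rho^b\mathfrak z_{ab}=0$, and put $\|\mathfrak z\|_\rho=\sup_\Sigma|\mathfrak z|$, where $|\mathfrak z|^2=\rho^{ac}\rho^{bd}\mathfrak z_{ab}\mathfrak z_{cd}$. For $\mathfrak z\in\mathcal K(\rho)$ consider smooth solutions $u:\Sigma\to\mathbb R$ of $$\Delta_\rho u-u+B=0,\qquad B=\left(1+2|\xi|^2\right)^{1/2},\qquad 2\xi_{ab}=2\mathfrak z_{ab}-\left(2u_{;ab}-\rho_{ab}\Delta_\rho u\right),$$ where $u_{;ab}$ is the Hessian of $u$ with respect to $\rho$. (1) There is a constant $C>0$, depending only on $(\Sigma,\rho)$ and independent of $\mathfrak z$, such that for every $\mathfrak z\in\mathcal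 K(\rho)$ and every smooth solution $u$ corresponding to $\mathfrak z$, $$B\le\exp\left[C\left(1+\|\mathfrak z\|_\rho\right)\right]\quad\text{on }\Sigma .$$ (2) There is a nondecreasing function $K:\mathbb R\to\mathbb R$, depending only on $(\Sigma,\rho)$, such that for every $\mathfrak z\in\mathcal K(\rho)$ and every smooth solution $u$ corresponding to $\mathfrak z$, $$|\nabla_\rho u|\le K(\|\mathfrak z\|_\rho)\quad\text{and}\quad|\nabla_\rho^2u|\le K(\|\mathfrak z\|_\rho)\quad\text{on }\Sigma .$$ -/

import Mathlib

open scoped Manifold ContDiff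

noncomputable section

namespace Moncrief

/-- The model plane. -/
abbrev Plane : Type := EuclideanSpace ℝ (Fin 2)

/-! ### Riemannian geometry in a coordinate domain

`G p` is the matrix `(ρ_ab)` of a metric at the coordinate point `p`; `(G p)⁻¹` is `(ρ^ab)`. -/

/-- The partial derivative `∂_i f` at `p`. -/
def pd (i : Fin 2) (f : Plane → ℝ) (p : Plane) : ℝ :=
  fderiv ℝ f p (EuclideanSpace.single i 1)

/-- The Christoffel symbol `Γ^k_{ij}` of the Levi-Civita connection of `G`. -/
def christoffel (G : Plane → Matrix (Fin 2) (Fin 2) ℝ) (k i j : Fin 2) (p : Plane) : ℝ :=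
  (1 / 2) * ∑ l, (G p)⁻¹ k l *
    (pd i (fun q => G q j l) p + pd j (fun q => G q i l) p - pd l (fun q => G q i j) p)

/-- The Ricci tensor
`R_{jk} = ∂_i Γ^i_{jk} - ∂_k Γ^i_{ij} + Γ^i_{im} Γ^m_{jk} - Γ^i_{km} Γ^m_{ij}`. -/
def ricci (G : Plane → Matrix (Fin 2) (Fin 2) ℝ) (j k : Fin 2) (p : Plane) : ℝ :=
  ∑ i, (pd i (christoffel G i j k) p - pd k (christoffel G i i j) p
    + ∑ m, (christoffel G i i m p * christoffel G m j k p
      - christoffel G i k m p * christoffel G m i j p))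

/-- The scalar curvature `ρ^{jk} R_{jk}` (twice the Gauss curvature). -/
def scalarCurv (G : Plane → Matrix (Fin 2) (Fin 2) ℝ) (p : Plane) : ℝ :=
  ∑ j, ∑ k, (G p)⁻¹ j k * ricci G j k p

/-- The Hessian `f_{;ab} = ∂_a ∂_b f - Γ^c_{ab} ∂_c f`. -/
def hess (G : Plane → Matrix (Fin 2) (Fin 2) ℝ) (f : Plane → ℝ) (p : Plane) :
    Matrix (Fin 2) (Fin 2) ℝ :=
  Matrix.of fun a b => pd a (pd b f) p - ∑ c, christoffel G c a b p * pd c f p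

/-- The trace `ρ^{ab} T_{ab}` of a (0,2)-tensor at `p`. -/
def traceAt (G : Plane → Matrix (Fin 2) (Fin 2) ℝ) (p : Plane)
    (T : Matrix (Fin 2) (Fin 2) ℝ) : ℝ :=
  ∑ a, ∑ b, (G p)⁻¹ a b * T a b

/-- The Laplacian `Δ_ρ f = ρ^{ab} f_{;ab}`. -/
def lap (G : Plane → Matrix (Fin 2) (Fin 2) ℝ) (f : Plane → ℝ) (p : Plane) : ℝ :=
  traceAt G p (hess G f p)

/-- The norm `(ρ^{ac} ρ^{bd} T_{ab} T_{cd})^{1/2}` of a (0,2)-tensor at `p`. -/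
def tensorNorm (G : Plane → Matrix (Fin 2) (Fin 2) ℝ) (p : Plane)
    (T : Matrix (Fin 2) (Fin 2) ℝ) : ℝ :=
  Real.sqrt (∑ a, ∑ b, ∑ c, ∑ d, (G p)⁻¹ a c * (G p)⁻¹ b d * T a b * T c d)

/-- The norm `(ρ^{ab} ∂_a f ∂_b f)^{1/2}` of the gradient of `f`. -/
def gradNorm (G : Plane → Matrix (Fin 2) (Fin 2) ℝ) (f : Plane → ℝ) (p : Plane) : ℝ :=
  Real.sqrt (∑ a, ∑ b, (G p)⁻¹ a b * pd a f p * pd b f p)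

/-- The covariant derivative `Z_{ab;c} = ∂_c Z_{ab} - Γ^m_{ca} Z_{mb} - Γ^m_{cb} Z_{am}`. -/
def covDeriv (G Z : Plane → Matrix (Fin 2) (Fin 2) ℝ) (a b c : Fin 2) (p : Plane) : ℝ :=
  pd c (fun q => Z q a b) p
    - ∑ m, (christoffel G m c a p * Z p m b + christoffel G m c b p * Z p a m)

/-- The divergence `ρ^{bc} Z_{ab;c}`. -/
def divergence (G Z : Plane → Matrix (Fin 2) (Fin 2) ℝ) (a : Fin 2) (p : Plane) : ℝ :=
  ∑ b, ∑ c, (G p)⁻¹ b c * covDeriv G Z a b c p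

/-- The tensor `ξ` given by `2 ξ_{ab} = 2 Z_{ab} - (2 f_{;ab} - ρ_{ab} Δ_ρ f)`. -/
def xi (G Z : Plane → Matrix (Fin 2) (Fin 2) ℝ) (f : Plane → ℝ) (p : Plane) :
    Matrix (Fin 2) (Fin 2) ℝ :=
  (1 / 2 : ℝ) • ((2 : ℝ) • Z p - ((2 : ℝ) • hess G f p - lap G f p • G p))

/-- The nonlinear term `B = (1 + 2 |ξ|²)^{1/2}`. -/
def nonlinearTerm (G Z : Plane → Matrix (Fin 2) (Fin 2) ℝ) (f : Plane → ℝ) (p : Plane) : ℝ :=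
  Real.sqrt (1 + 2 * tensorNorm G p (xi G Z f p) ^ 2)

/-! ### Surfaces

All the scalar quantities above are invariant under a change of coordinates, and the equations
among them are required in every smooth coordinate chart. -/

section Surface

variable {M : Type*} [TopologicalSpace M] [ChartedSpace Plane M]

/-- The smooth coordinate charts of `M`. -/
def charts (M : Type*) [TopologicalSpace M] [ChartedSpace Plane M] :
    Set (OpenPartialHomeomorph M Plane) :=
  IsManifold.maximalAtlas (𝓡 2) ∞ M

/-- `M` is orientable: it is covered by smooth charts whose transition maps have positive
Jacobian determinant. -/
def IsOrientable (M : Type*) [TopologicalSpace M] [ChartedSpace Plane M] : Prop :=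
  ∃ A : Set (OpenPartialHomeomorph M Plane), A ⊆ charts M ∧ (∀ x : M, ∃ e ∈ A, x ∈ e.source) ∧
    ∀ e ∈ A, ∀ e' ∈ A, ∀ x ∈ e.source ∩ e'.source,
      0 < (fderiv ℝ (e' ∘ e.symm) (e x)).det

/-- The coordinate vector field `∂_i` of the chart `e`, at the point with coordinates `p`. -/
def coordVec (e : OpenPartialHomeomorph M Plane) (p : Plane) (i : Fin 2) :
    TangentSpace (𝓡 2) (e.symm p) :=
  mfderiv (𝓡 2) (𝓡 2) e.symm p (EuclideanSpace.single i 1 : Plane)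

/-- The components `T_{ab} = T(∂_a, ∂_b)` in the chart `e` of a (0,2)-tensor field `T`. -/
def comps (T : (x : M) → TangentSpace (𝓡 2) x →L[ℝ] TangentSpace (𝓡 2) x →L[ℝ] ℝ)
    (e : OpenPartialHomeomorph M Plane) (p : Plane) : Matrix (Fin 2) (Fin 2) ℝ :=
  Matrix.of fun a b => T (e.symm p) (coordVec e p a) (coordVec e p b)

variable [IsManifold (𝓡 2) ∞ M]

/-- Smooth Riemannian metrics on the surface `M`. -/
abbrev SurfaceMetric (M : Type*) [TopologicalSpace M] [ChartedSpace Plane M]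
    [IsManifold (𝓡 2) ∞ M] : Type _ :=
  Bundle.ContMDiffRiemannianMetric (𝓡 2) ∞ Plane (fun x : M => TangentSpace (𝓡 2) x)

/-- `ρ` has constant scalar curvature `c`. -/
def HasScalarCurvature (ρ : SurfaceMetric M) (c : ℝ) : Prop :=
  ∀ e ∈ charts M, ∀ p ∈ e.target, scalarCurv (comps ρ.inner e) p = c

/-- `z` is a TT-tensor on `(M, ρ)`: a smooth symmetric (0,2)-tensor field that is trace free and
divergence free with respect to `ρ`. -/
structure IsTT (ρ : SurfaceMetric M)
    (z : (x : M) → TangentSpace (𝓡 2) x →L[ℝ] TangentSpace (𝓡 2) x →L[ℝ] ℝ) : Prop where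
  smooth : ContMDiff (𝓡 2) ((𝓡 2).prod 𝓘(ℝ, Plane →L[ℝ] Plane →L[ℝ] ℝ)) ∞
    (fun x => Bundle.TotalSpace.mk' (Plane →L[ℝ] Plane →L[ℝ] ℝ)
      (E := fun x : M => TangentSpace (𝓡 2) x →L[ℝ] TangentSpace (𝓡 2) x →L[ℝ] ℝ) x (z x))
  symm : ∀ (x : M) (v w : TangentSpace (𝓡 2) x), z x v w = z x w v
  traceFree : ∀ e ∈ charts M, ∀ p ∈ e.target, traceAt (comps ρ.inner e) p (comps z e p) = 0
  divFree : ∀ e ∈ charts M, ∀ p ∈ e.target, ∀ a,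
    divergence (comps ρ.inner e) (comps z e) a p = 0

/-- The supremum norm `‖z‖_ρ = sup_M |z|`; the pointwise norm does not depend on the chart in
which it is computed. -/
def supNorm (ρ : SurfaceMetric M)
    (z : (x : M) → TangentSpace (𝓡 2) x →L[ℝ] TangentSpace (𝓡 2) x →L[ℝ] ℝ) : ℝ :=
  ⨆ x : M, tensorNorm (comps ρ.inner (chartAt Plane x)) (chartAt Plane x x)
    (comps z (chartAt Plane x) (chartAt Plane x x))

/-- `u` is a smooth solution of `Δ_ρ u - u + (1 + 2 |ξ|²)^{1/2} = 0`, where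
`2 ξ_{ab} = 2 z_{ab} - (2 u_{;ab} - ρ_{ab} Δ_ρ u)`. -/
structure IsSolution (ρ : SurfaceMetric M)
    (z : (x : M) → TangentSpace (𝓡 2) x →L[ℝ] TangentSpace (𝓡 2) x →L[ℝ] ℝ) (u : M → ℝ) :
    Prop where
  smooth : ContMDiff (𝓡 2) 𝓘(ℝ) ∞ u
  eqn : ∀ e ∈ charts M, ∀ p ∈ e.target,
    lap (comps ρ.inner e) (u ∘ e.symm) p - u (e.symm p)
      + nonlinearTerm (comps ρ.inner e) (comps z e) (u ∘ e.symm) p = 0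

end Surface

end Moncrief

end

open scoped Manifold ContDiff

noncomputable section

namespace Moncrief

/-! ### Calculus of partial derivatives in the plane -/

section PartialDerivatives

variable {f g : Plane → ℝ} {p : Plane} {U : Set Plane} {i j : Fin 2}

theorem pd_congr (h : f =ᶠ[nhds p] g) (i : Fin 2) : pd i f p = pd i g p := by
  unfold pd; rw [h.fderiv_eq]

theorem pd_congr_on (hU : IsOpen U) (h : ∀ q ∈ U, f q = g q) (hp : p ∈ U) (i : Fin 2) :
    pd i f p = pd i g p :=
  pd_congr (Filter.eventuallyEq_of_mem (hU.mem_nhds hp) h) i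

theorem pd_add (hf : DifferentiableAt ℝ f p) (hg : DifferentiableAt ℝ g p) (i : Fin 2) :
    pd i (fun q => f q + g q) p = pd i f p + pd i g p := by
  unfold pd; rw [fderiv_fun_add hf hg]; simp

theorem pd_sub (hf : DifferentiableAt ℝ f p) (hg : DifferentiableAt ℝ g p) (i : Fin 2) :
    pd i (fun q => f q - g q) p = pd i f p - pd i g p := by
  unfold pd; rw [fderiv_fun_sub hf hg]; simp

theorem pd_mul (hf : DifferentiableAt ℝ f p) (hg : DifferentiableAt ℝ g p) (i : Fin 2) :
    pd i (fun q => f q * g q) p = pd i f p * g p + f p * pd i g p := by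
  unfold pd; rw [fderiv_fun_mul hf hg]; simp; ring

theorem pd_const (c : ℝ) (i : Fin 2) : pd i (fun _ => c) p = 0 := by
  unfold pd; simp

theorem pd_const_mul (hf : DifferentiableAt ℝ f p) (c : ℝ) (i : Fin 2) :
    pd i (fun q => c * f q) p = c * pd i f p := by
  rw [pd_mul (by fun_prop) hf, pd_const]; ring

theorem pd_neg (i : Fin 2) : pd i (fun q => - f q) p = - pd i f p := by
  unfold pd; rw [fderiv_fun_neg]; simp

theorem pd_comp {φ : ℝ → ℝ} {φ' : ℝ} (hφ : HasDerivAt φ φ' (f p))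
    (hf : DifferentiableAt ℝ f p) (i : Fin 2) :
    pd i (fun q => φ (f q)) p = φ' * pd i f p := by
  unfold pd
  have h : HasFDerivAt (fun q => φ (f q)) (φ' • fderiv ℝ f p) p :=
    hφ.comp_hasFDerivAt p hf.hasFDerivAt
  rw [h.fderiv]
  simp

theorem fderiv_eq_sum_pd (v : Plane) : fderiv ℝ f p v = v 0 * pd 0 f p + v 1 * pd 1 f p := by
  have hv : v = v 0 • EuclideanSpace.single (0 : Fin 2) (1 : ℝ)
      + v 1 • EuclideanSpace.single (1 : Fin 2) (1 : ℝ) := by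
    ext k; fin_cases k <;> simp
  unfold pd
  conv_lhs => rw [hv]
  rw [map_add, map_smul, map_smul]; simp

/-- The chain rule for partial derivatives. -/
theorem pd_comp_map {τ : Plane → Plane} (hf : DifferentiableAt ℝ f (τ p))
    (hτ : DifferentiableAt ℝ τ p) (i : Fin 2) :
    pd i (fun q => f (τ q)) p =
      pd 0 f (τ p) * pd i (fun q => τ q 0) p + pd 1 f (τ p) * pd i (fun q => τ q 1) p := by
  have h1 : pd i (fun q => f (τ q)) p
      = fderiv ℝ f (τ p) (fderiv ℝ τ p (EuclideanSpace.single i 1)) := by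
    unfold pd
    have : (fun q => f (τ q)) = f ∘ τ := rfl
    rw [this, fderiv_comp p hf hτ]; rfl
  have h2 : ∀ k : Fin 2, fderiv ℝ τ p (EuclideanSpace.single i 1) k
      = pd i (fun q => τ q k) p := by
    intro k
    unfold pd
    have h3 : HasFDerivAt (fun q => τ q k)
        ((EuclideanSpace.proj k : Plane →L[ℝ] ℝ).comp (fderiv ℝ τ p)) p :=
      (EuclideanSpace.proj k : Plane →L[ℝ] ℝ).hasFDerivAt.comp p hτ.hasFDerivAt
    rw [h3.fderiv]; simp
  rw [h1, fderiv_eq_sum_pd, h2, h2]; ring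

theorem diffAt_of_contDiffOn (hf : ContDiffOn ℝ ∞ f U) (hU : IsOpen U) (hp : p ∈ U) :
    DifferentiableAt ℝ f p :=
  (hf.contDiffAt (hU.mem_nhds hp)).differentiableAt (by simp)

theorem contDiffOn_pd (hf : ContDiffOn ℝ ∞ f U) (hU : IsOpen U) (i : Fin 2) :
    ContDiffOn ℝ ∞ (pd i f) U := by
  have h := hf.fderiv_of_isOpen (m := ∞) hU (by simp)
  exact h.clm_apply contDiffOn_const

theorem pd_comm (hf : ContDiffOn ℝ ∞ f U) (hU : IsOpen U) (hp : p ∈ U) (i j : Fin 2) :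
    pd i (pd j f) p = pd j (pd i f) p := by
  have hc := hf.contDiffAt (hU.mem_nhds hp)
  have hd : DifferentiableAt ℝ (fderiv ℝ f) p :=
    ((hf.fderiv_of_isOpen (m := ∞) hU (by simp)).contDiffAt (hU.mem_nhds hp)).differentiableAt
      (by simp)
  have hs : IsSymmSndFDerivAt ℝ f p := hc.isSymmSndFDerivAt (by simpa using WithTop.coe_le_coe.2 (le_top : (2 : ℕ∞) ≤ ⊤))
  have key : ∀ a b : Fin 2, pd a (pd b f) p
      = fderiv ℝ (fderiv ℝ f) p (EuclideanSpace.single a 1) (EuclideanSpace.single b 1) := by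
    intro a b
    have h3 : HasFDerivAt (fun q => fderiv ℝ f q (EuclideanSpace.single b 1))
        ((ContinuousLinearMap.apply ℝ ℝ (EuclideanSpace.single b 1 : Plane)).comp
          (fderiv ℝ (fderiv ℝ f) p)) p :=
      (ContinuousLinearMap.apply ℝ ℝ (EuclideanSpace.single b 1 : Plane)).hasFDerivAt.comp p
        hd.hasFDerivAt
    have : pd a (fun q => fderiv ℝ f q (EuclideanSpace.single b 1)) p
      = fderiv ℝ (fderiv ℝ f) p (EuclideanSpace.single a 1) (EuclideanSpace.single b 1) := by
      unfold pd; rw [h3.fderiv]; rfl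
    exact this
  rw [key, key]; exact hs _ _

theorem pd_eq_zero_of_isLocalMax (h : IsLocalMax f p) (i : Fin 2) : pd i f p = 0 := by
  unfold pd; rw [h.fderiv_eq_zero]; simp

/-- The derivative of a function along a differentiable curve. -/
theorem hasDerivAt_comp_curve {γ : ℝ → Plane} {γ' : Plane} {t : ℝ}
    (hf : DifferentiableAt ℝ f (γ t)) (hγ : HasDerivAt γ γ' t) :
    HasDerivAt (fun s => f (γ s)) (γ' 0 * pd 0 f (γ t) + γ' 1 * pd 1 f (γ t)) t := by
  rw [← fderiv_eq_sum_pd]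
  exact hf.hasFDerivAt.comp_hasDerivAt t hγ

/-- The second order necessary condition at a local maximum. -/
theorem sum_pd_pd_nonpos_of_isLocalMax (hf : ContDiffOn ℝ ∞ f U) (hU : IsOpen U) (hp : p ∈ U)
    (h : IsLocalMax f p) (v : Plane) :
    v 0 * v 0 * pd 0 (pd 0 f) p + 2 * (v 0 * v 1 * pd 0 (pd 1 f) p)
      + v 1 * v 1 * pd 1 (pd 1 f) p ≤ 0 := by
  set γ : ℝ → Plane := fun t => p + t • v with hγ
  have hγd : ∀ t, HasDerivAt γ v t := by
    intro t
    have h := ((hasDerivAt_id t).smul_const v).const_add p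
    rw [one_smul] at h
    exact h
  have hγc : Continuous γ := by fun_prop
  have hγ0 : γ 0 = p := by simp [hγ]
  have hV : ∀ᶠ t in nhds (0 : ℝ), γ t ∈ U :=
    hγc.continuousAt.eventually (by rw [hγ0]; exact hU.mem_nhds hp)
  have hd1 : ∀ t, γ t ∈ U → HasDerivAt (fun s => f (γ s))
      (v 0 * pd 0 f (γ t) + v 1 * pd 1 f (γ t)) t := fun t ht =>
    hasDerivAt_comp_curve (diffAt_of_contDiffOn hf hU ht) (hγd t)
  have hderiv : deriv (fun s => f (γ s)) =ᶠ[nhds 0]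
      fun t => v 0 * pd 0 f (γ t) + v 1 * pd 1 f (γ t) := by
    filter_upwards [hV] with t ht using (hd1 t ht).deriv
  have h0 : γ 0 ∈ U := by rw [hγ0]; exact hp
  have hdd : HasDerivAt (fun t => v 0 * pd 0 f (γ t) + v 1 * pd 1 f (γ t))
      (v 0 * (v 0 * pd 0 (pd 0 f) (γ 0) + v 1 * pd 1 (pd 0 f) (γ 0))
        + v 1 * (v 0 * pd 0 (pd 1 f) (γ 0) + v 1 * pd 1 (pd 1 f) (γ 0))) 0 :=
    ((hasDerivAt_comp_curve (diffAt_of_contDiffOn (contDiffOn_pd hf hU 0) hU h0) (hγd 0)).const_mul _).add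
      ((hasDerivAt_comp_curve (diffAt_of_contDiffOn (contDiffOn_pd hf hU 1) hU h0) (hγd 0)).const_mul _)
  have hdd' : deriv (deriv (fun s => f (γ s))) 0 =
      v 0 * v 0 * pd 0 (pd 0 f) p + 2 * (v 0 * v 1 * pd 0 (pd 1 f) p)
      + v 1 * v 1 * pd 1 (pd 1 f) p := by
    rw [hderiv.deriv_eq, hdd.deriv, hγ0, pd_comm hf hU hp 1 0]; ring
  rw [← hdd']
  by_contra hcon
  push Not at hcon
  have hmaxγ : IsLocalMax (fun s => f (γ s)) 0 := by
    have : Filter.Tendsto γ (nhds 0) (nhds p) := by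
      have := hγc.tendsto 0
      rwa [hγ0] at this
    have h2 := this.eventually h
    unfold IsLocalMax IsMaxFilter
    filter_upwards [h2] with t ht
    rw [hγ0]; exact ht
  have hmin := isLocalMin_of_deriv_deriv_pos hcon hmaxγ.deriv_eq_zero
    (hd1 0 h0).continuousAt
  have hconst : (fun s => f (γ s)) =ᶠ[nhds 0] fun _ => f (γ 0) := by
    filter_upwards [hmaxγ, hmin] with t h1 h2 using le_antisymm h1 h2
  have h3 : deriv (fun s => f (γ s)) =ᶠ[nhds 0] fun _ => 0 := by
    have := hconst.deriv
    filter_upwards [this] with t ht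
    rw [ht]; simp
  rw [h3.deriv_eq] at hcon
  simp at hcon

end PartialDerivatives

/-! ### The Levi-Civita connection of a metric in a coordinate domain -/

/-- `G` is a smooth Riemannian metric on the open set `U` of the plane. -/
structure IsMetricOn (U : Set Plane) (G : Plane → Matrix (Fin 2) (Fin 2) ℝ) : Prop where
  isOpen : IsOpen U
  smooth : ∀ a b, ContDiffOn ℝ ∞ (fun q => G q a b) U
  symm : ∀ q ∈ U, ∀ a b, G q a b = G q b a
  pos : ∀ q ∈ U, 0 < G q 0 0
  det_pos : ∀ q ∈ U, 0 < G q 0 0 * G q 1 1 - G q 0 1 * G q 0 1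

theorem inv_fin_two_apply (A : Matrix (Fin 2) (Fin 2) ℝ) :
    A⁻¹ 0 0 = A 1 1 / (A 0 0 * A 1 1 - A 0 1 * A 1 0) ∧
    A⁻¹ 0 1 = - A 0 1 / (A 0 0 * A 1 1 - A 0 1 * A 1 0) ∧
    A⁻¹ 1 0 = - A 1 0 / (A 0 0 * A 1 1 - A 0 1 * A 1 0) ∧
    A⁻¹ 1 1 = A 0 0 / (A 0 0 * A 1 1 - A 0 1 * A 1 0) := by
  rw [Matrix.inv_def, Matrix.adjugate_fin_two, Matrix.det_fin_two, Ring.inverse_eq_inv']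
  refine ⟨?_, ?_, ?_, ?_⟩ <;> simp <;> ring

section

variable {U : Set Plane} {G : Plane → Matrix (Fin 2) (Fin 2) ℝ} {p : Plane}

theorem IsMetricOn.diffAt (hG : IsMetricOn U G) (hp : p ∈ U) (a b : Fin 2) :
    DifferentiableAt ℝ (fun q => G q a b) p :=
  diffAt_of_contDiffOn (hG.smooth a b) hG.isOpen hp

theorem IsMetricOn.inv_apply (hG : IsMetricOn U G) (hp : p ∈ U) :
    (G p)⁻¹ 0 0 = G p 1 1 / (G p 0 0 * G p 1 1 - G p 0 1 * G p 0 1) ∧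
    (G p)⁻¹ 0 1 = - G p 0 1 / (G p 0 0 * G p 1 1 - G p 0 1 * G p 0 1) ∧
    (G p)⁻¹ 1 0 = - G p 0 1 / (G p 0 0 * G p 1 1 - G p 0 1 * G p 0 1) ∧
    (G p)⁻¹ 1 1 = G p 0 0 / (G p 0 0 * G p 1 1 - G p 0 1 * G p 0 1) := by
  have h := inv_fin_two_apply (G p)
  rw [hG.symm p hp 1 0] at h
  exact h

theorem IsMetricOn.exists_inv_det (hG : IsMetricOn U G) (hp : p ∈ U) :
    ∃ k : ℝ, 0 < k ∧ k * (G p 0 0 * G p 1 1 - G p 0 1 * G p 0 1) = 1 ∧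
      (G p)⁻¹ 0 0 = k * G p 1 1 ∧ (G p)⁻¹ 0 1 = - (k * G p 0 1) ∧
      (G p)⁻¹ 1 0 = - (k * G p 0 1) ∧ (G p)⁻¹ 1 1 = k * G p 0 0 := by
  have hd := hG.det_pos p hp
  obtain ⟨h1, h2, h3, h4⟩ := hG.inv_apply hp
  refine ⟨(G p 0 0 * G p 1 1 - G p 0 1 * G p 0 1)⁻¹, inv_pos.2 hd, inv_mul_cancel₀ hd.ne',
    ?_, ?_, ?_, ?_⟩
  · rw [h1]; ring
  · rw [h2]; ring
  · rw [h3]; ring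
  · rw [h4]; ring

theorem IsMetricOn.contDiffOn_inv (hG : IsMetricOn U G) (a b : Fin 2) :
    ContDiffOn ℝ ∞ (fun q => (G q)⁻¹ a b) U := by
  have hd : ContDiffOn ℝ ∞ (fun q => G q 0 0 * G q 1 1 - G q 0 1 * G q 0 1) U :=
    ((hG.smooth 0 0).mul (hG.smooth 1 1)).sub ((hG.smooth 0 1).mul (hG.smooth 0 1))
  have hne : ∀ q ∈ U, G q 0 0 * G q 1 1 - G q 0 1 * G q 0 1 ≠ 0 := fun q hq =>
    (hG.det_pos q hq).ne'
  fin_cases a <;> fin_cases b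
  · exact ((hG.smooth 1 1).div hd hne).congr fun q hq => (hG.inv_apply hq).1
  · exact ((hG.smooth 0 1).neg.div hd hne).congr fun q hq => (hG.inv_apply hq).2.1
  · exact ((hG.smooth 0 1).neg.div hd hne).congr fun q hq => (hG.inv_apply hq).2.2.1
  · exact ((hG.smooth 0 0).div hd hne).congr fun q hq => (hG.inv_apply hq).2.2.2

theorem IsMetricOn.contDiffOn_christoffel (hG : IsMetricOn U G) (k i j : Fin 2) :
    ContDiffOn ℝ ∞ (christoffel G k i j) U := by
  unfold christoffel
  simp only [Fin.sum_univ_two]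
  have h := fun a b c => contDiffOn_pd (hG.smooth a b) hG.isOpen c
  exact contDiffOn_const.mul
    (((hG.contDiffOn_inv k 0).mul (((h j 0 i).add (h i 0 j)).sub (h i j 0))).add
    ((hG.contDiffOn_inv k 1).mul (((h j 1 i).add (h i 1 j)).sub (h i j 1))))

theorem IsMetricOn.pd_symm (hG : IsMetricOn U G) (hp : p ∈ U) (k a b : Fin 2) :
    pd k (fun q => G q a b) p = pd k (fun q => G q b a) p :=
  pd_congr_on hG.isOpen (fun q hq => hG.symm q hq a b) hp k

theorem IsMetricOn.christoffel_symm (hG : IsMetricOn U G) (hp : p ∈ U) (k i j : Fin 2) :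
    christoffel G k i j p = christoffel G k j i p := by
  unfold christoffel
  simp only [Fin.sum_univ_two]
  rw [hG.pd_symm hp 0 i j, hG.pd_symm hp 1 i j]; ring

theorem IsMetricOn.christoffel_lower (hG : IsMetricOn U G) (hp : p ∈ U) (l i j : Fin 2) :
    G p l 0 * christoffel G 0 i j p + G p l 1 * christoffel G 1 i j p =
      (1 / 2) * (pd i (fun q => G q j l) p + pd j (fun q => G q i l) p
        - pd l (fun q => G q i j) p) := by
  unfold christoffel
  obtain ⟨k, -, hk, h1, h2, h3, h4⟩ := hG.exists_inv_det hp
  simp only [Fin.sum_univ_two, h1, h2, h3, h4]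
  fin_cases l <;> simp only [Fin.mk_one, Fin.zero_eta, hG.symm p hp 1 0]
  · linear_combination ((1 / 2) * (pd i (fun q => G q j 0) p + pd j (fun q => G q i 0) p
        - pd 0 (fun q => G q i j) p)) * hk
  · linear_combination ((1 / 2) * (pd i (fun q => G q j 1) p + pd j (fun q => G q i 1) p
        - pd 1 (fun q => G q i j) p)) * hk

/-- The Levi-Civita connection preserves the metric. -/
theorem IsMetricOn.pd_metric (hG : IsMetricOn U G) (hp : p ∈ U) (k i j : Fin 2) :
    pd k (fun q => G q i j) p =
      (G p j 0 * christoffel G 0 k i p + G p j 1 * christoffel G 1 k i p)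
      + (G p i 0 * christoffel G 0 k j p + G p i 1 * christoffel G 1 k j p) := by
  rw [hG.christoffel_lower hp, hG.christoffel_lower hp, hG.pd_symm hp i k j,
    hG.pd_symm hp k j i]
  ring

/-! ### The curvature tensor of a surface -/

/-- The curvature tensor `R^c_{i12}`. -/
def riem (G : Plane → Matrix (Fin 2) (Fin 2) ℝ) (c i : Fin 2) (p : Plane) : ℝ :=
  pd 0 (christoffel G c i 1) p - pd 1 (christoffel G c i 0) p
    + ∑ m, (christoffel G c 0 m p * christoffel G m i 1 p
      - christoffel G c 1 m p * christoffel G m i 0 p)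

theorem IsMetricOn.riem_antisymm (hG : IsMetricOn U G) (hp : p ∈ U) (i l : Fin 2) :
    (G p l 0 * riem G 0 i p + G p l 1 * riem G 1 i p)
      + (G p i 0 * riem G 0 l p + G p i 1 * riem G 1 l p) = 0 := by
  have hU := hG.isOpen
  have hdΓ := fun a b c => diffAt_of_contDiffOn (hG.contDiffOn_christoffel a b c) hU hp
  have hdG := fun a b => hG.diffAt hp a b
  have key : ∀ j k : Fin 2, pd j (pd k (fun q => G q i l)) p =
      ((pd j (fun q => G q l 0) p * christoffel G 0 k i p
          + G p l 0 * pd j (christoffel G 0 k i) p)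
        + (pd j (fun q => G q l 1) p * christoffel G 1 k i p
          + G p l 1 * pd j (christoffel G 1 k i) p))
      + ((pd j (fun q => G q i 0) p * christoffel G 0 k l p
          + G p i 0 * pd j (christoffel G 0 k l) p)
        + (pd j (fun q => G q i 1) p * christoffel G 1 k l p
          + G p i 1 * pd j (christoffel G 1 k l) p)) := by
    intro j k
    rw [pd_congr_on hU (fun q hq => hG.pd_metric hq k i l) hp j]
    rw [pd_add (by fun_prop) (by fun_prop), pd_add (by fun_prop) (by fun_prop),
      pd_add (by fun_prop) (by fun_prop), pd_mul (hdG _ _) (hdΓ _ _ _),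
      pd_mul (hdG _ _) (hdΓ _ _ _), pd_mul (hdG _ _) (hdΓ _ _ _), pd_mul (hdG _ _) (hdΓ _ _ _)]
  have hcomm := pd_comm (hG.smooth i l) hU hp 0 1
  rw [key, key] at hcomm
  have hs : ∀ j c a b, pd j (christoffel G c a b) p = pd j (christoffel G c b a) p :=
    fun j c a b => pd_congr_on hU (fun q hq => hG.christoffel_symm hq c a b) hp j
  simp only [hG.pd_metric hp] at hcomm
  unfold riem
  simp only [Fin.sum_univ_two]
  have hΓ := fun c a b => hG.christoffel_symm hp c a b
  rw [hs 0 0 1 i, hs 0 1 1 i, hs 0 0 1 l, hs 0 1 1 l, hs 1 0 0 i, hs 1 1 0 i, hs 1 0 0 l,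
    hs 1 1 0 l] at hcomm
  rw [hΓ 0 1 i, hΓ 1 1 i, hΓ 0 1 l, hΓ 1 1 l, hΓ 0 0 i, hΓ 1 0 i, hΓ 0 0 l, hΓ 1 0 l,
    hΓ 0 1 0, hΓ 1 1 0] at hcomm
  rw [hΓ 0 1 0, hΓ 1 1 0]
  have g := hG.symm p hp 1 0
  fin_cases i <;> fin_cases l <;>
    simp only [Fin.mk_one, Fin.zero_eta, g, hΓ 0 1 0, hΓ 1 1 0] at hcomm ⊢ <;>
    linear_combination hcomm

theorem IsMetricOn.riem_eq (hG : IsMetricOn U G) (hp : p ∈ U) (hR : scalarCurv G p = -1) :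
    riem G 0 0 p = - G p 0 1 / 2 ∧ riem G 1 0 p = G p 0 0 / 2 ∧
    riem G 0 1 p = - G p 1 1 / 2 ∧ riem G 1 1 p = G p 0 1 / 2 := by
  have hU := hG.isOpen
  have h00 := hG.riem_antisymm hp 0 0
  have h01 := hG.riem_antisymm hp 0 1
  have h11 := hG.riem_antisymm hp 1 1
  obtain ⟨k, hk0, hk, i1, i2, i3, i4⟩ := hG.exists_inv_det hp
  have hd2 := (hG.det_pos p hp).ne'
  have g := hG.symm p hp 1 0
  rw [g] at h01 h11
  have hΓ := fun c a b => hG.christoffel_symm hp c a b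
  have hs : ∀ j c a b, pd j (christoffel G c a b) p = pd j (christoffel G c b a) p :=
    fun j c a b => pd_congr_on hU (fun q hq => hG.christoffel_symm hq c a b) hp j
  have r00 : ricci G 0 0 p = - riem G 1 0 p := by
    unfold ricci riem
    simp only [Fin.sum_univ_two]
    rw [hs 0 1 1 0, hΓ 0 1 0, hΓ 1 1 0]; ring
  have r01 : ricci G 0 1 p = riem G 0 0 p := by
    unfold ricci riem
    simp only [Fin.sum_univ_two]
    rw [hs 1 1 1 0, hΓ 0 1 0, hΓ 1 1 0]; ring
  have r10 : ricci G 1 0 p = - riem G 1 1 p := by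
    unfold ricci riem
    simp only [Fin.sum_univ_two]
    rw [hs 1 1 1 0, hs 0 0 0 1, hs 0 0 1 0, hΓ 0 1 0, hΓ 1 1 0]; ring
  have r11 : ricci G 1 1 p = riem G 0 1 p := by
    unfold ricci riem
    simp only [Fin.sum_univ_two]
    rw [hs 1 0 0 1, hΓ 0 1 0, hΓ 1 1 0]; ring
  unfold scalarCurv at hR
  simp only [Fin.sum_univ_two, r00, r01, r10, r11, i1, i2, i3, i4] at hR
  set a := G p 0 0
  set b := G p 0 1
  set c := G p 1 1
  set R00 := riem G 0 0 p
  set R10 := riem G 1 0 p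
  set R01 := riem G 0 1 p
  set R11 := riem G 1 1 p
  have e1 : 2 * (a * R01 + b * R11) = - (a * c - b * b) := by
    linear_combination (a * c - b * b) * hR + h01
      - (a * R01 + b * R11 - c * R10 - b * R00) * hk
  have e2 : 2 * (c * R10 + b * R00) = a * c - b * b := by
    linear_combination h01 - (a * c - b * b) * hR
      + (a * R01 + b * R11 - c * R10 - b * R00) * hk
  refine ⟨?_, ?_, ?_, ?_⟩ <;> apply mul_left_cancel₀ hd2
  · linear_combination c / 2 * h00 - b / 2 * e2
  · linear_combination -b / 2 * h00 + a / 2 * e2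
  · linear_combination c / 2 * e1 - b / 2 * h11
  · linear_combination a / 2 * h11 - b / 2 * e1

end

/-! ### The Codazzi tensor attached to a solution -/

/-- The tensor `b_ab = z_ab - f_{;ab} + f ρ_ab / 2`. -/
def codazziTensor (G Z : Plane → Matrix (Fin 2) (Fin 2) ℝ) (f : Plane → ℝ) (p : Plane) :
    Matrix (Fin 2) (Fin 2) ℝ :=
  Matrix.of fun a b => Z p a b - hess G f p a b + 1 / 2 * (f p * G p a b)

section

variable {U : Set Plane} {G Z : Plane → Matrix (Fin 2) (Fin 2) ℝ} {f : Plane → ℝ} {p : Plane}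

theorem IsMetricOn.contDiffOn_hess (hG : IsMetricOn U G) (hf : ContDiffOn ℝ ∞ f U) (a b : Fin 2) :
    ContDiffOn ℝ ∞ (fun q => hess G f q a b) U := by
  unfold hess
  simp only [Fin.sum_univ_two, Matrix.of_apply]
  have h1 := contDiffOn_pd (contDiffOn_pd hf hG.isOpen b) hG.isOpen a
  exact h1.sub (((hG.contDiffOn_christoffel 0 a b).mul (contDiffOn_pd hf hG.isOpen 0)).add
    ((hG.contDiffOn_christoffel 1 a b).mul (contDiffOn_pd hf hG.isOpen 1)))

theorem IsMetricOn.hess_symm (hG : IsMetricOn U G) (hf : ContDiffOn ℝ ∞ f U) (hp : p ∈ U)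
    (a b : Fin 2) : hess G f p a b = hess G f p b a := by
  unfold hess
  simp only [Fin.sum_univ_two, Matrix.of_apply]
  rw [pd_comm hf hG.isOpen hp a b, hG.christoffel_symm hp 0 a b, hG.christoffel_symm hp 1 a b]

theorem IsMetricOn.contDiffOn_codazziTensor (hG : IsMetricOn U G) (hf : ContDiffOn ℝ ∞ f U)
    (hZ : ∀ a b, ContDiffOn ℝ ∞ (fun q => Z q a b) U) (a b : Fin 2) :
    ContDiffOn ℝ ∞ (fun q => codazziTensor G Z f q a b) U := by
  unfold codazziTensor
  simp only [Matrix.of_apply]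
  exact ((hZ a b).sub (hG.contDiffOn_hess hf a b)).add
    (contDiffOn_const.mul (hf.mul (hG.smooth a b)))

/-- The Ricci identity for the Hessian of a function. -/
theorem IsMetricOn.covDeriv_hess (hG : IsMetricOn U G) (hf : ContDiffOn ℝ ∞ f U) (hp : p ∈ U)
    (a : Fin 2) :
    covDeriv G (hess G f) a 0 1 p - covDeriv G (hess G f) a 1 0 p =
      pd 0 f p * riem G 0 a p + pd 1 f p * riem G 1 a p := by
  have hU := hG.isOpen
  have hdf := fun i => diffAt_of_contDiffOn (contDiffOn_pd hf hU i) hU hp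
  have hddf := fun i j =>
    diffAt_of_contDiffOn (contDiffOn_pd (contDiffOn_pd hf hU j) hU i) hU hp
  have hdΓ := fun a b c => diffAt_of_contDiffOn (hG.contDiffOn_christoffel a b c) hU hp
  have key : ∀ c a b : Fin 2, pd c (fun q => hess G f q a b) p =
      pd c (pd a (pd b f)) p
        - ((pd c (christoffel G 0 a b) p * pd 0 f p + christoffel G 0 a b p * pd c (pd 0 f) p)
        + (pd c (christoffel G 1 a b) p * pd 1 f p + christoffel G 1 a b p * pd c (pd 1 f) p)) := by
    intro c a b
    unfold hess
    simp only [Fin.sum_univ_two, Matrix.of_apply]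
    rw [pd_sub (hddf a b) (by fun_prop), pd_add (by fun_prop) (by fun_prop),
      pd_mul (hdΓ _ _ _) (hdf _), pd_mul (hdΓ _ _ _) (hdf _)]
  have hs : ∀ j c a b, pd j (christoffel G c a b) p = pd j (christoffel G c b a) p :=
    fun j c a b => pd_congr_on hU (fun q hq => hG.christoffel_symm hq c a b) hp j
  have hΓ := fun c a b => hG.christoffel_symm hp c a b
  have h3 : pd 1 (pd a (pd 0 f)) p = pd 0 (pd a (pd 1 f)) p := by
    have e1 : pd 1 (pd a (pd 0 f)) p = pd 1 (pd 0 (pd a f)) p :=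
      pd_congr_on hU (fun q hq => pd_comm hf hU hq a 0) hp 1
    have e2 : pd 0 (pd a (pd 1 f)) p = pd 0 (pd 1 (pd a f)) p :=
      pd_congr_on hU (fun q hq => pd_comm hf hU hq a 1) hp 0
    rw [e1, e2, pd_comm (contDiffOn_pd hf hU a) hU hp]
  unfold covDeriv
  rw [key, key, h3]
  unfold riem hess
  simp only [Fin.sum_univ_two, Matrix.of_apply]
  have h10 := pd_comm hf hU hp 1 0
  fin_cases a <;> simp only [Fin.mk_one, Fin.zero_eta, h10, hΓ 0 1 0, hΓ 1 1 0, hs 1 0 1 0,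
    hs 1 1 1 0] <;> ring

/-- A trace free and divergence free symmetric tensor on a surface is a Codazzi tensor. -/
theorem IsMetricOn.covDeriv_of_traceFree_of_divFree (hG : IsMetricOn U G)
    (hZ : ∀ a b, ContDiffOn ℝ ∞ (fun q => Z q a b) U)
    (hZs : ∀ q ∈ U, ∀ a b, Z q a b = Z q b a)
    (htr : ∀ q ∈ U, traceAt G q (Z q) = 0) (hdiv : ∀ q ∈ U, ∀ a, divergence G Z a q = 0)
    (hp : p ∈ U) (a : Fin 2) : covDeriv G Z a 0 1 p = covDeriv G Z a 1 0 p := by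
  have hU := hG.isOpen
  have hdZ := fun a b => diffAt_of_contDiffOn (hZ a b) hU hp
  have hdG := fun a b => hG.diffAt hp a b
  have hsZ : ∀ c, pd c (fun q => Z q 1 0) p = pd c (fun q => Z q 0 1) p :=
    fun c => pd_congr_on hU (fun q hq => hZs q hq 1 0) hp c
  have tr0 : ∀ q ∈ U, G q 1 1 * Z q 0 0 - 2 * (G q 0 1 * Z q 0 1) + G q 0 0 * Z q 1 1 = 0 := by
    intro q hq
    obtain ⟨k, hk0, hk, i1, i2, i3, i4⟩ := hG.exists_inv_det hq
    have h := htr q hq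
    unfold traceAt at h
    simp only [Fin.sum_univ_two, i1, i2, i3, i4, hZs q hq 1 0] at h
    have : k * (G q 1 1 * Z q 0 0 - 2 * (G q 0 1 * Z q 0 1) + G q 0 0 * Z q 1 1) = 0 := by
      linear_combination h
    exact (mul_eq_zero.1 this).resolve_left hk0.ne'
  have trc : ∀ c, G p 1 1 * covDeriv G Z 0 0 c p - 2 * (G p 0 1 * covDeriv G Z 0 1 c p)
      + G p 0 0 * covDeriv G Z 1 1 c p = 0 := by
    intro c
    have h := pd_congr_on hU tr0 hp c
    rw [pd_const, pd_add (by fun_prop) (by fun_prop), pd_sub (by fun_prop) (by fun_prop),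
      pd_const_mul (by fun_prop), pd_mul (hdG _ _) (hdZ _ _), pd_mul (hdG _ _) (hdZ _ _),
      pd_mul (hdG _ _) (hdZ _ _)] at h
    simp only [hG.pd_metric hp, hG.symm p hp 1 0] at h
    unfold covDeriv
    simp only [Fin.sum_univ_two, hZs p hp 1 0]
    linear_combination h - 2 * (christoffel G 0 c 0 p + christoffel G 1 c 1 p) * tr0 p hp
  have hc10 : ∀ c, covDeriv G Z 1 0 c p = covDeriv G Z 0 1 c p := by
    intro c
    unfold covDeriv
    simp only [Fin.sum_univ_two, hZs p hp 1 0, hsZ]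
    ring
  obtain ⟨k, hk0, hk, i1, i2, i3, i4⟩ := hG.exists_inv_det hp
  have d0 := hdiv p hp 0
  have d1 := hdiv p hp 1
  unfold divergence at d0 d1
  simp only [Fin.sum_univ_two, i1, i2, i3, i4, hc10] at d0 d1
  have t0 := trc 0
  have t1 := trc 1
  have kd : ∀ x : ℝ, k * x = 0 → x = 0 := fun x h => (mul_eq_zero.1 h).resolve_left hk0.ne'
  have e0 : G p 1 1 * covDeriv G Z 0 0 0 p - G p 0 1 * covDeriv G Z 0 0 1 p
      - G p 0 1 * covDeriv G Z 0 1 0 p + G p 0 0 * covDeriv G Z 0 1 1 p = 0 :=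
    kd _ (by linear_combination d0)
  have e1 : G p 1 1 * covDeriv G Z 0 1 0 p - G p 0 1 * covDeriv G Z 0 1 1 p
      - G p 0 1 * covDeriv G Z 1 1 0 p + G p 0 0 * covDeriv G Z 1 1 1 p = 0 :=
    kd _ (by linear_combination d1)
  set x := covDeriv G Z 0 0 1 p - covDeriv G Z 0 1 0 p
  set y := covDeriv G Z 0 1 1 p - covDeriv G Z 1 1 0 p
  have f0 : G p 0 1 * x - G p 0 0 * y = 0 := by simp only [x, y]; linear_combination t0 - e0
  have f1 : G p 1 1 * x - G p 0 1 * y = 0 := by simp only [x, y]; linear_combination t1 - e1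
  have hd := (hG.det_pos p hp).ne'
  have hx : x = 0 := by
    apply mul_left_cancel₀ hd; linear_combination G p 0 0 * f1 - G p 0 1 * f0
  have hy : y = 0 := by
    apply mul_left_cancel₀ hd; linear_combination G p 0 1 * f1 - G p 1 1 * f0
  fin_cases a
  · exact sub_eq_zero.1 hx
  · show covDeriv G Z 1 0 1 p = covDeriv G Z 1 1 0 p
    rw [hc10]; exact sub_eq_zero.1 hy

theorem IsMetricOn.covDeriv_codazziTensor (hG : IsMetricOn U G)
    (hR : ∀ q ∈ U, scalarCurv G q = -1) (hf : ContDiffOn ℝ ∞ f U)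
    (hZ : ∀ a b, ContDiffOn ℝ ∞ (fun q => Z q a b) U)
    (hZs : ∀ q ∈ U, ∀ a b, Z q a b = Z q b a)
    (htr : ∀ q ∈ U, traceAt G q (Z q) = 0) (hdiv : ∀ q ∈ U, ∀ a, divergence G Z a q = 0)
    (hp : p ∈ U) (a : Fin 2) :
    covDeriv G (codazziTensor G Z f) a 0 1 p = covDeriv G (codazziTensor G Z f) a 1 0 p := by
  have hU := hG.isOpen
  have hdZ := fun a b => diffAt_of_contDiffOn (hZ a b) hU hp
  have hdG := fun a b => hG.diffAt hp a b
  have hdh := fun a b => diffAt_of_contDiffOn (hG.contDiffOn_hess hf a b) hU hp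
  have hdf := diffAt_of_contDiffOn hf hU hp
  have key : ∀ a b c : Fin 2, covDeriv G (codazziTensor G Z f) a b c p =
      covDeriv G Z a b c p - covDeriv G (hess G f) a b c p + 1 / 2 * (pd c f p * G p a b) := by
    intro a b c
    unfold covDeriv codazziTensor
    simp only [Fin.sum_univ_two, Matrix.of_apply]
    rw [pd_add ((hdZ _ _).fun_sub (hdh _ _)) (by fun_prop), pd_sub (hdZ _ _) (hdh _ _),
      pd_const_mul (by fun_prop), pd_mul hdf (hdG _ _), hG.pd_metric hp, hG.symm p hp 0 b,
      hG.symm p hp 1 b]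
    ring
  rw [key, key]
  have h1 := hG.covDeriv_of_traceFree_of_divFree hZ hZs htr hdiv hp a
  have h2 := hG.covDeriv_hess hf hp a
  obtain ⟨r1, r2, r3, r4⟩ := hG.riem_eq hp (hR p hp)
  have g := hG.symm p hp 1 0
  fin_cases a
  · simp only [Fin.zero_eta] at h1 h2 ⊢
    rw [r1, r2] at h2
    linear_combination h1 - h2
  · simp only [Fin.mk_one] at h1 h2 ⊢
    rw [r3, r4] at h2
    rw [g]
    linear_combination h1 - h2

end

/-! ### Pairs of binary quadratic forms

`(a, b, c)` are the coefficients of a positive definite form, `(x, y, z)` those of another form, and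
`c x - 2 b y + a z` is the trace of the second form with respect to the first, multiplied by the
determinant of the first. -/

section Forms

variable {a b c x y z : ℝ}

theorem four_mul_det_le_trace_sq (ha : 0 < a) (hd : 0 < a * c - b * b) :
    4 * ((a * c - b * b) * (x * z - y * y)) ≤ (c * x - 2 * (b * y) + a * z) ^ 2 := by
  set d := a * c - b * b with hdd
  have h : a ^ 2 * ((c * x - 2 * (b * y) + a * z) ^ 2 - 4 * (d * (x * z - y * y)))
      = (d * x - (b * b * x - 2 * (a * b * y) + a * a * z)) ^ 2 + 4 * d * (a * y - b * x) ^ 2 := by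
    rw [hdd]; ring
  have h2 : 0 ≤ a ^ 2 * ((c * x - 2 * (b * y) + a * z) ^ 2 - 4 * (d * (x * z - y * y))) := by
    rw [h]; positivity
  have := nonneg_of_mul_nonneg_right h2 (by positivity)
  linarith

theorem coeff_nonneg_of_trace_of_det (ha : 0 < a) (hd : 0 < a * c - b * b)
    (hτ : 0 ≤ c * x - 2 * (b * y) + a * z) (hdet : 0 ≤ x * z - y * y) : 0 ≤ x := by
  by_contra hx
  push Not at hx
  have h1 : 0 ≤ x * (b * b * x - 2 * (a * b * y) + a * a * z) := by
    have : x * (b * b * x - 2 * (a * b * y) + a * a * z)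
        = a ^ 2 * (x * z - y * y) + (a * y - b * x) ^ 2 := by ring
    rw [this]; positivity
  have h2 : b * b * x - 2 * (a * b * y) + a * a * z ≤ 0 := by
    by_contra h; push Not at h; nlinarith [mul_neg_of_neg_of_pos hx h]
  have h3 : (a * c - b * b) * x + (b * b * x - 2 * (a * b * y) + a * a * z)
      = a * (c * x - 2 * (b * y) + a * z) := by ring
  have h4 := mul_neg_of_pos_of_neg hd hx
  have h5 := mul_nonneg ha.le hτ
  linarith

theorem form_nonneg_of_coeff (hx : 0 < x) (hdet : 0 ≤ x * z - y * y) (v w : ℝ) :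
    0 ≤ x * (v * v) + 2 * (y * (v * w)) + z * (w * w) := by
  have h : x * (x * (v * v) + 2 * (y * (v * w)) + z * (w * w))
      = (x * v + y * w) ^ 2 + (x * z - y * y) * w ^ 2 := by ring
  have h2 : 0 ≤ x * (x * (v * v) + 2 * (y * (v * w)) + z * (w * w)) := by rw [h]; positivity
  exact nonneg_of_mul_nonneg_right h2 hx

theorem form_nonneg_of_trace_of_det (ha : 0 < a) (hd : 0 < a * c - b * b)
    (hτ : 0 ≤ c * x - 2 * (b * y) + a * z) (hdet : 0 ≤ x * z - y * y) (v w : ℝ) :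
    0 ≤ x * (v * v) + 2 * (y * (v * w)) + z * (w * w) := by
  rcases (coeff_nonneg_of_trace_of_det ha hd hτ hdet).lt_or_eq with hx | hx
  · exact form_nonneg_of_coeff hx hdet v w
  · subst hx
    have hy : y = 0 := by nlinarith
    subst hy
    have hz : 0 ≤ z := by
      have : 0 ≤ a * z := by linarith
      exact nonneg_of_mul_nonneg_right this ha
    have : 0 ≤ z * (w * w) := mul_nonneg hz (mul_self_nonneg w)
    linarith

theorem det_nonneg_of_form (h : ∀ v w : ℝ, 0 ≤ x * (v * v) + 2 * (y * (v * w)) + z * (w * w)) :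
    0 ≤ x * z - y * y := by
  have hx : 0 ≤ x := by simpa using h 1 0
  rcases hx.lt_or_eq with hx | hx
  · have h1 := h (-y) x
    have h2 : x * (-y * -y) + 2 * (y * (-y * x)) + z * (x * x) = x * (x * z - y * y) := by ring
    rw [h2] at h1
    exact nonneg_of_mul_nonneg_right h1 hx
  · subst hx
    have h1 := h (-(z + 1) * y) 2
    have hz : 0 ≤ z := by simpa using h 0 1
    have hy : y = 0 := by
      by_contra hy
      have := h (-(z + 1) / (2 * y)) 1
      have e : 0 * (-(z + 1) / (2 * y) * (-(z + 1) / (2 * y))) + 2 * (y * (-(z + 1) / (2 * y) * 1))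
          + z * (1 * 1) = -1 := by field_simp; ring
      linarith
    simp [hy]

theorem trace_nonneg_of_form (ha : 0 < a) (hd : 0 < a * c - b * b)
    (h : ∀ v w : ℝ, 0 ≤ x * (v * v) + 2 * (y * (v * w)) + z * (w * w)) :
    0 ≤ c * x - 2 * (b * y) + a * z := by
  have hx : 0 ≤ x := by simpa using h 1 0
  have h1 := h (-b) a
  have h2 : a * (c * x - 2 * (b * y) + a * z) = (a * c - b * b) * x
      + (x * (-b * -b) + 2 * (y * (-b * a)) + z * (a * a)) := by ring
  have h3 : 0 ≤ a * (c * x - 2 * (b * y) + a * z) := by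
    rw [h2]; positivity
  exact nonneg_of_mul_nonneg_right h3 ha

/-- A form that dominates `κ` times a positive definite form has at least `κ²` times its
determinant. -/
theorem sq_mul_det_le_det {κ : ℝ} (ha : 0 < a) (hd : 0 < a * c - b * b) (hκ : 0 ≤ κ)
    (h : ∀ v w : ℝ, κ * (a * (v * v) + 2 * (b * (v * w)) + c * (w * w))
      ≤ x * (v * v) + 2 * (y * (v * w)) + z * (w * w)) :
    κ ^ 2 * (a * c - b * b) ≤ x * z - y * y := by
  have h' : ∀ v w : ℝ, 0 ≤ (x - κ * a) * (v * v) + 2 * ((y - κ * b) * (v * w))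
      + (z - κ * c) * (w * w) := fun v w => by linarith [h v w]
  have h1 := det_nonneg_of_form h'
  have h2 := mul_nonneg hκ (trace_nonneg_of_form ha hd h')
  nlinarith [h1, h2]

end Forms

/-! ### Norms of symmetric tensors -/

section

variable {U : Set Plane} {G Z : Plane → Matrix (Fin 2) (Fin 2) ℝ} {f : Plane → ℝ} {p : Plane}
  {T : Matrix (Fin 2) (Fin 2) ℝ}

theorem IsMetricOn.traceAt_mul_det (hG : IsMetricOn U G) (hp : p ∈ U) (hT : T 1 0 = T 0 1) :
    traceAt G p T * (G p 0 0 * G p 1 1 - G p 0 1 * G p 0 1)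
      = G p 1 1 * T 0 0 - 2 * (G p 0 1 * T 0 1) + G p 0 0 * T 1 1 := by
  obtain ⟨k, hk0, hk, i1, i2, i3, i4⟩ := hG.exists_inv_det hp
  unfold traceAt
  simp only [Fin.sum_univ_two, i1, i2, i3, i4, hT]
  linear_combination (G p 1 1 * T 0 0 - 2 * (G p 0 1 * T 0 1) + G p 0 0 * T 1 1) * hk

theorem IsMetricOn.four_det_le (hG : IsMetricOn U G) (hp : p ∈ U) (hT : T 1 0 = T 0 1) :
    4 * (T 0 0 * T 1 1 - T 0 1 * T 0 1)
      ≤ traceAt G p T ^ 2 * (G p 0 0 * G p 1 1 - G p 0 1 * G p 0 1) := by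
  have hd := hG.det_pos p hp
  have h := four_mul_det_le_trace_sq (x := T 0 0) (y := T 0 1) (z := T 1 1) (hG.pos p hp) hd
  rw [← hG.traceAt_mul_det hp hT] at h
  nlinarith [h]

theorem IsMetricOn.tensorNorm_sq (hG : IsMetricOn U G) (hp : p ∈ U) (hT : T 1 0 = T 0 1) :
    tensorNorm G p T ^ 2 * (G p 0 0 * G p 1 1 - G p 0 1 * G p 0 1)
      = traceAt G p T ^ 2 * (G p 0 0 * G p 1 1 - G p 0 1 * G p 0 1)
        - 2 * (T 0 0 * T 1 1 - T 0 1 * T 0 1) := by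
  have hd := hG.det_pos p hp
  have h4 := hG.four_det_le hp hT
  obtain ⟨k, hk0, hk, i1, i2, i3, i4⟩ := hG.exists_inv_det hp
  have hS : (∑ a, ∑ b, ∑ c, ∑ d, (G p)⁻¹ a c * (G p)⁻¹ b d * T a b * T c d)
      = traceAt G p T ^ 2 - 2 * (k * (T 0 0 * T 1 1 - T 0 1 * T 0 1)) := by
    unfold traceAt
    simp only [Fin.sum_univ_two, i1, i2, i3, i4, hT]
    linear_combination (-2 * k * (T 0 0 * T 1 1 - T 0 1 * T 0 1)) * hk
  have hnn : 0 ≤ traceAt G p T ^ 2 - 2 * (k * (T 0 0 * T 1 1 - T 0 1 * T 0 1)) := by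
    have h5 := mul_le_mul_of_nonneg_left h4 hk0.le
    have h6 : k * (traceAt G p T ^ 2 * (G p 0 0 * G p 1 1 - G p 0 1 * G p 0 1))
        = traceAt G p T ^ 2 := by linear_combination traceAt G p T ^ 2 * hk
    rw [h6] at h5
    nlinarith [sq_nonneg (traceAt G p T)]
  unfold tensorNorm
  rw [hS, Real.sq_sqrt hnn]
  linear_combination (-2 * (T 0 0 * T 1 1 - T 0 1 * T 0 1)) * hk

theorem tensorNorm_nonneg : 0 ≤ tensorNorm G p T := Real.sqrt_nonneg _

/-- A symmetric tensor is bounded by its norm times the metric. -/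
theorem IsMetricOn.form_le_tensorNorm (hG : IsMetricOn U G) (hp : p ∈ U) (hT : T 1 0 = T 0 1)
    (v w : ℝ) :
    T 0 0 * (v * v) + 2 * (T 0 1 * (v * w)) + T 1 1 * (w * w) ≤ tensorNorm G p T *
      (G p 0 0 * (v * v) + 2 * (G p 0 1 * (v * w)) + G p 1 1 * (w * w)) := by
  have hd := hG.det_pos p hp
  have hn := hG.tensorNorm_sq hp hT
  have ht := hG.traceAt_mul_det hp hT
  have h4 := hG.four_det_le hp hT
  have h0 : 0 ≤ tensorNorm G p T := tensorNorm_nonneg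
  set η := tensorNorm G p T
  set τ := traceAt G p T
  set d := G p 0 0 * G p 1 1 - G p 0 1 * G p 0 1 with hdd
  have hτη : τ ≤ 2 * η := by
    have : τ ^ 2 * d ≤ 2 * (η ^ 2 * d) := by linarith
    have h2 : τ ^ 2 ≤ 2 * η ^ 2 := by
      have : τ ^ 2 * d ≤ (2 * η ^ 2) * d := by linarith
      exact le_of_mul_le_mul_right this hd
    nlinarith
  have h1 : 0 ≤ G p 1 1 * (η * G p 0 0 - T 0 0) - 2 * (G p 0 1 * (η * G p 0 1 - T 0 1))
      + G p 0 0 * (η * G p 1 1 - T 1 1) := by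
    have : G p 1 1 * (η * G p 0 0 - T 0 0) - 2 * (G p 0 1 * (η * G p 0 1 - T 0 1))
      + G p 0 0 * (η * G p 1 1 - T 1 1) = (2 * η - τ) * d := by
        rw [hdd]; rw [hdd] at ht; linear_combination ht
    rw [this]; exact mul_nonneg (by linarith) hd.le
  have h2 : 0 ≤ (η * G p 0 0 - T 0 0) * (η * G p 1 1 - T 1 1)
      - (η * G p 0 1 - T 0 1) * (η * G p 0 1 - T 0 1) := by
    have : (η * G p 0 0 - T 0 0) * (η * G p 1 1 - T 1 1)
      - (η * G p 0 1 - T 0 1) * (η * G p 0 1 - T 0 1) = (η - τ) ^ 2 * d / 2 := by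
        have e : (η * G p 0 0 - T 0 0) * (η * G p 1 1 - T 1 1)
          - (η * G p 0 1 - T 0 1) * (η * G p 0 1 - T 0 1) = η ^ 2 * d - η * (τ * d)
            + (T 0 0 * T 1 1 - T 0 1 * T 0 1) := by rw [ht, hdd]; ring
        rw [e]; linear_combination (1 / 2) * hn
    rw [this]; positivity
  have := form_nonneg_of_trace_of_det (hG.pos p hp) hd h1 h2 v w
  nlinarith [this]

theorem IsMetricOn.neg_tensorNorm_le_form (hG : IsMetricOn U G) (hp : p ∈ U)
    (hT : T 1 0 = T 0 1) (v w : ℝ) :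
    -(tensorNorm G p T * (G p 0 0 * (v * v) + 2 * (G p 0 1 * (v * w)) + G p 1 1 * (w * w)))
      ≤ T 0 0 * (v * v) + 2 * (T 0 1 * (v * w)) + T 1 1 * (w * w) := by
  have h := hG.form_le_tensorNorm hp (T := -T) (by simpa using hT) v w
  have hn : tensorNorm G p (-T) = tensorNorm G p T := by
    unfold tensorNorm; simp
  rw [hn] at h
  simp only [Matrix.neg_apply] at h
  linarith

/-! ### Solutions in a coordinate domain -/

/-- `f` is a solution, with TT-tensor `Z`, on the coordinate domain `U` with the hyperbolic
metric `G`. -/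
structure IsLocalSolution (U : Set Plane) (G Z : Plane → Matrix (Fin 2) (Fin 2) ℝ)
    (f : Plane → ℝ) : Prop where
  metric : IsMetricOn U G
  curv : ∀ q ∈ U, scalarCurv G q = -1
  smooth : ContDiffOn ℝ ∞ f U
  tensor_smooth : ∀ a b, ContDiffOn ℝ ∞ (fun q => Z q a b) U
  tensor_symm : ∀ q ∈ U, ∀ a b, Z q a b = Z q b a
  traceFree : ∀ q ∈ U, traceAt G q (Z q) = 0
  divFree : ∀ q ∈ U, ∀ a, divergence G Z a q = 0
  eqn : ∀ q ∈ U, lap G f q - f q + nonlinearTerm G Z f q = 0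

theorem one_le_nonlinearTerm : 1 ≤ nonlinearTerm G Z f p := by
  unfold nonlinearTerm
  rw [Real.one_le_sqrt]
  nlinarith [sq_nonneg (tensorNorm G p (xi G Z f p))]

namespace IsLocalSolution

theorem isOpen (h : IsLocalSolution U G Z f) : IsOpen U := h.metric.isOpen

theorem contDiffOn_codazziTensor (h : IsLocalSolution U G Z f) (a b : Fin 2) :
    ContDiffOn ℝ ∞ (fun q => codazziTensor G Z f q a b) U :=
  h.metric.contDiffOn_codazziTensor h.smooth h.tensor_smooth a b

theorem contDiffOn_nonlinearTerm (h : IsLocalSolution U G Z f) : ContDiffOn ℝ ∞ (nonlinearTerm G Z f) U := by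
  have h1 : ContDiffOn ℝ ∞ (fun q => f q - lap G f q) U := by
    unfold lap traceAt
    simp only [Fin.sum_univ_two]
    have h2 := fun a b => (h.metric.contDiffOn_inv a b).mul (h.metric.contDiffOn_hess h.smooth a b)
    exact h.smooth.sub (((h2 0 0).add (h2 0 1)).add ((h2 1 0).add (h2 1 1)))
  exact h1.congr fun q hq => by linarith [h.eqn q hq]

theorem codazziTensor_symm (h : IsLocalSolution U G Z f) (hp : p ∈ U) (a b : Fin 2) :
    codazziTensor G Z f p a b = codazziTensor G Z f p b a := by
  unfold codazziTensor
  simp only [Matrix.of_apply]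
  rw [h.tensor_symm p hp a b, h.metric.hess_symm h.smooth hp a b, h.metric.symm p hp a b]

theorem covDeriv_codazziTensor (h : IsLocalSolution U G Z f) (hp : p ∈ U) (a : Fin 2) :
    covDeriv G (codazziTensor G Z f) a 0 1 p = covDeriv G (codazziTensor G Z f) a 1 0 p :=
  h.metric.covDeriv_codazziTensor h.curv h.smooth h.tensor_smooth h.tensor_symm h.traceFree
    h.divFree hp a

/-- The trace of the Codazzi tensor is the nonlinear term. -/
theorem trace_codazziTensor (h : IsLocalSolution U G Z f) (hp : p ∈ U) :
    G p 1 1 * codazziTensor G Z f p 0 0 - 2 * (G p 0 1 * codazziTensor G Z f p 0 1)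
      + G p 0 0 * codazziTensor G Z f p 1 1
      = nonlinearTerm G Z f p * (G p 0 0 * G p 1 1 - G p 0 1 * G p 0 1) := by
  have h1 := h.metric.traceAt_mul_det hp (T := Z p) (h.tensor_symm p hp 1 0)
  rw [h.traceFree p hp] at h1
  have h2 := h.metric.traceAt_mul_det hp (T := hess G f p) (h.metric.hess_symm h.smooth hp 1 0)
  have h3 := h.eqn p hp
  unfold lap at h3
  unfold codazziTensor
  simp only [Matrix.of_apply]
  linear_combination -h1 + h2 - (G p 0 0 * G p 1 1 - G p 0 1 * G p 0 1) * h3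

/-- The Codazzi tensor has determinant `1 / 4`. -/
theorem det_codazziTensor (h : IsLocalSolution U G Z f) (hp : p ∈ U) :
    codazziTensor G Z f p 0 0 * codazziTensor G Z f p 1 1
      - codazziTensor G Z f p 0 1 * codazziTensor G Z f p 0 1
      = (G p 0 0 * G p 1 1 - G p 0 1 * G p 0 1) / 4 := by
  have hd := h.metric.det_pos p hp
  have hxs : xi G Z f p 1 0 = xi G Z f p 0 1 := by
    simp [xi, h.tensor_symm p hp 1 0, h.metric.hess_symm h.smooth hp 1 0, h.metric.symm p hp 1 0]
  have hn := h.metric.tensorNorm_sq hp hxs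
  have ht := h.metric.traceAt_mul_det hp hxs
  have h1 := h.metric.traceAt_mul_det hp (T := Z p) (h.tensor_symm p hp 1 0)
  rw [h.traceFree p hp] at h1
  have h2 := h.metric.traceAt_mul_det hp (T := hess G f p) (h.metric.hess_symm h.smooth hp 1 0)
  have h3 := h.eqn p hp
  have hB : nonlinearTerm G Z f p ^ 2 = 1 + 2 * tensorNorm G p (xi G Z f p) ^ 2 := by
    unfold nonlinearTerm
    rw [Real.sq_sqrt (by positivity)]
  have hbx : ∀ a b, codazziTensor G Z f p a b
      = xi G Z f p a b + 1 / 2 * (nonlinearTerm G Z f p * G p a b) := by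
    intro a b
    simp only [codazziTensor, xi, Matrix.of_apply, Matrix.smul_apply, Matrix.sub_apply, smul_eq_mul]
    linear_combination (-1 / 2 * G p a b) * h3
  have hx0 : traceAt G p (xi G Z f p) = 0 := by
    have : traceAt G p (xi G Z f p) * (G p 0 0 * G p 1 1 - G p 0 1 * G p 0 1) = 0 := by
      rw [ht]
      simp only [xi, Matrix.smul_apply, Matrix.sub_apply, smul_eq_mul]
      unfold lap
      linear_combination -h1 + h2
    exact (mul_eq_zero.1 this).resolve_right hd.ne'
  rw [hx0] at hn ht
  rw [hbx, hbx, hbx]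
  linear_combination (1 / 2) * hn + (G p 0 0 * G p 1 1 - G p 0 1 * G p 0 1) / 4 * hB
    - nonlinearTerm G Z f p / 2 * ht

theorem codazziTensor_pos (h : IsLocalSolution U G Z f) (hp : p ∈ U) : 0 < codazziTensor G Z f p 0 0 := by
  have hd := h.metric.det_pos p hp
  have h1 := h.trace_codazziTensor hp
  have h2 := h.det_codazziTensor hp
  have hB : 1 ≤ nonlinearTerm G Z f p := one_le_nonlinearTerm
  have h3 : 0 ≤ codazziTensor G Z f p 0 0 :=
    coeff_nonneg_of_trace_of_det (h.metric.pos p hp) hd (by rw [h1]; positivity)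
      (by rw [h2]; positivity)
  rcases h3.lt_or_eq with h4 | h4
  · exact h4
  · rw [← h4] at h2; nlinarith [mul_self_nonneg (codazziTensor G Z f p 0 1)]

theorem codazziTensor_form_nonneg (h : IsLocalSolution U G Z f) (hp : p ∈ U) (v w : ℝ) :
    0 ≤ codazziTensor G Z f p 0 0 * (v * v) + 2 * (codazziTensor G Z f p 0 1 * (v * w))
      + codazziTensor G Z f p 1 1 * (w * w) := by
  refine form_nonneg_of_coeff (h.codazziTensor_pos hp) ?_ v w
  rw [h.det_codazziTensor hp]
  linarith [h.metric.det_pos p hp]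

end IsLocalSolution

end

/-! ### Change of coordinates -/

/-- The Jacobian matrix of a map of the plane. -/
def jac (τ : Plane → Plane) (p : Plane) : Matrix (Fin 2) (Fin 2) ℝ :=
  Matrix.of fun a i => pd i (fun q => τ q a) p

/-- The pull-back of a (0,2)-tensor under a linear map. -/
def pullForm (J T : Matrix (Fin 2) (Fin 2) ℝ) : Matrix (Fin 2) (Fin 2) ℝ :=
  Matrix.of fun i j =>
    J 0 i * J 0 j * T 0 0 + J 0 i * J 1 j * T 0 1 + J 1 i * J 0 j * T 1 0 + J 1 i * J 1 j * T 1 1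

section

variable {U V : Set Plane} {G G' Z Z' : Plane → Matrix (Fin 2) (Fin 2) ℝ} {f : Plane → ℝ}
  {τ : Plane → Plane} {p : Plane}

theorem contDiffOn_coord (hτ : ContDiffOn ℝ ∞ τ V) (a : Fin 2) :
    ContDiffOn ℝ ∞ (fun q => τ q a) V :=
  (EuclideanSpace.proj a : Plane →L[ℝ] ℝ).contDiff.comp_contDiffOn hτ

theorem pd_pullForm (hV : IsOpen V) (hτ : ContDiffOn ℝ ∞ τ V) (hmaps : Set.MapsTo τ V U)
    (hG : IsMetricOn U G) (hGG : ∀ q ∈ V, G' q = pullForm (jac τ q) (G (τ q))) (hp : p ∈ V)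
    (k i j : Fin 2) :
    pd k (fun q => G' q i j) p = ∑ a, ∑ b,
      ((pd k (pd i fun q => τ q a) p * jac τ p b j + jac τ p a i * pd k (pd j fun q => τ q b) p)
        * G (τ p) a b + jac τ p a i * jac τ p b j *
          (pd 0 (fun q => G q a b) (τ p) * jac τ p 0 k + pd 1 (fun q => G q a b) (τ p)
            * jac τ p 1 k)) := by
  have hJd : ∀ a i, DifferentiableAt ℝ (pd i fun q => τ q a) p := fun a i =>
    diffAt_of_contDiffOn (contDiffOn_pd (contDiffOn_coord hτ a) hV i) hV hp
  have hτd : DifferentiableAt ℝ τ p := (hτ.contDiffAt (hV.mem_nhds hp)).differentiableAt (by simp)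
  have hGd : ∀ a b, DifferentiableAt ℝ (fun q => G (τ q) a b) p := fun a b =>
    DifferentiableAt.comp p (hG.diffAt (hmaps hp) a b) hτd
  have hterm : ∀ a b, pd k (fun q => pd i (fun q => τ q a) q * pd j (fun q => τ q b) q
      * G (τ q) a b) p =
      (pd k (pd i fun q => τ q a) p * jac τ p b j + jac τ p a i * pd k (pd j fun q => τ q b) p)
        * G (τ p) a b + jac τ p a i * jac τ p b j *
          (pd 0 (fun q => G q a b) (τ p) * jac τ p 0 k + pd 1 (fun q => G q a b) (τ p)
            * jac τ p 1 k) := by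
    intro a b
    rw [pd_mul ((hJd a i).fun_mul (hJd b j)) (hGd a b), pd_mul (hJd a i) (hJd b j),
      pd_comp_map (f := fun q => G q a b) (hG.diffAt (hmaps hp) a b) hτd]
    rfl
  have h1 : ∀ q ∈ V, G' q i j =
      (pd i (fun q => τ q 0) q * pd j (fun q => τ q 0) q * G (τ q) 0 0
        + pd i (fun q => τ q 0) q * pd j (fun q => τ q 1) q * G (τ q) 0 1)
      + (pd i (fun q => τ q 1) q * pd j (fun q => τ q 0) q * G (τ q) 1 0
        + pd i (fun q => τ q 1) q * pd j (fun q => τ q 1) q * G (τ q) 1 1) := by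
    intro q hq
    rw [hGG q hq]
    simp only [pullForm, jac, Matrix.of_apply]
    ring
  have hd : ∀ a b, DifferentiableAt ℝ (fun q => pd i (fun q => τ q a) q * pd j (fun q => τ q b) q
      * G (τ q) a b) p := fun a b => ((hJd a i).fun_mul (hJd b j)).fun_mul (hGd a b)
  rw [pd_congr_on hV h1 hp, pd_add ((hd _ _).fun_add (hd _ _)) ((hd _ _).fun_add (hd _ _)),
    pd_add (hd _ _) (hd _ _), pd_add (hd _ _) (hd _ _), hterm, hterm, hterm, hterm]
  simp only [Fin.sum_univ_two]

/-- The transformation law of the Christoffel symbols. -/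
theorem christoffel_change (hτ : ContDiffOn ℝ ∞ τ V) (hmaps : Set.MapsTo τ V U)
    (hG : IsMetricOn U G) (hG' : IsMetricOn V G')
    (hGG : ∀ q ∈ V, G' q = pullForm (jac τ q) (G (τ q))) (hp : p ∈ V) (c i j : Fin 2) :
    jac τ p c 0 * christoffel G' 0 i j p + jac τ p c 1 * christoffel G' 1 i j p =
      pd i (pd j fun q => τ q c) p
        + ∑ a, ∑ b, christoffel G c a b (τ p) * jac τ p a i * jac τ p b j := by
  have hV := hG'.isOpen
  have hq := hmaps hp
  have hlow := fun l => hG'.christoffel_lower hp l i j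
  simp only [pd_pullForm hV hτ hmaps hG hGG hp, Fin.sum_univ_two, hG.pd_metric hq,
    hG.symm _ hq 1 0, hG.christoffel_symm hq _ 1 0] at hlow
  have hcomm : ∀ c a b, pd a (pd b fun q => τ q c) p = pd b (pd a fun q => τ q c) p :=
    fun c a b => pd_comm (contDiffOn_coord hτ c) hV hp a b
  simp only [Fin.sum_univ_two, hG.christoffel_symm hq _ 1 0]
  have hG00 : ∀ l m, G' p l m = jac τ p 0 l * jac τ p 0 m * G (τ p) 0 0
      + jac τ p 0 l * jac τ p 1 m * G (τ p) 0 1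
      + jac τ p 1 l * jac τ p 0 m * G (τ p) 0 1 + jac τ p 1 l * jac τ p 1 m * G (τ p) 1 1 := by
    intro l m
    rw [hGG p hp]; simp only [pullForm, Matrix.of_apply, hG.symm _ hq 1 0]
  have hdet' := hG'.det_pos p hp
  rw [hG00, hG00, hG00] at hdet'
  have hdet := hG.det_pos _ hq
  set A := G (τ p) 0 0
  set B := G (τ p) 0 1
  set C := G (τ p) 1 1
  have hX : ∀ l, jac τ p 0 l * (A * (jac τ p 0 0 * christoffel G' 0 i j p
        + jac τ p 0 1 * christoffel G' 1 i j p - (pd i (pd j fun q => τ q 0) p +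
        ((christoffel G 0 0 0 (τ p) * jac τ p 0 i * jac τ p 0 j
          + christoffel G 0 0 1 (τ p) * jac τ p 0 i * jac τ p 1 j)
        + (christoffel G 0 0 1 (τ p) * jac τ p 1 i * jac τ p 0 j
          + christoffel G 0 1 1 (τ p) * jac τ p 1 i * jac τ p 1 j))))
      + B * (jac τ p 1 0 * christoffel G' 0 i j p
        + jac τ p 1 1 * christoffel G' 1 i j p - (pd i (pd j fun q => τ q 1) p +
        ((christoffel G 1 0 0 (τ p) * jac τ p 0 i * jac τ p 0 j
          + christoffel G 1 0 1 (τ p) * jac τ p 0 i * jac τ p 1 j)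
        + (christoffel G 1 0 1 (τ p) * jac τ p 1 i * jac τ p 0 j
          + christoffel G 1 1 1 (τ p) * jac τ p 1 i * jac τ p 1 j)))))
      + jac τ p 1 l * (B * (jac τ p 0 0 * christoffel G' 0 i j p
        + jac τ p 0 1 * christoffel G' 1 i j p - (pd i (pd j fun q => τ q 0) p +
        ((christoffel G 0 0 0 (τ p) * jac τ p 0 i * jac τ p 0 j
          + christoffel G 0 0 1 (τ p) * jac τ p 0 i * jac τ p 1 j)
        + (christoffel G 0 0 1 (τ p) * jac τ p 1 i * jac τ p 0 j
          + christoffel G 0 1 1 (τ p) * jac τ p 1 i * jac τ p 1 j))))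
      + C * (jac τ p 1 0 * christoffel G' 0 i j p
        + jac τ p 1 1 * christoffel G' 1 i j p - (pd i (pd j fun q => τ q 1) p +
        ((christoffel G 1 0 0 (τ p) * jac τ p 0 i * jac τ p 0 j
          + christoffel G 1 0 1 (τ p) * jac τ p 0 i * jac τ p 1 j)
        + (christoffel G 1 0 1 (τ p) * jac τ p 1 i * jac τ p 0 j
          + christoffel G 1 1 1 (τ p) * jac τ p 1 i * jac τ p 1 j))))) = 0 := by
    intro l
    have h := hlow l
    rw [hG00, hG00] at h
    rw [hcomm 0 j i, hcomm 1 j i, hcomm 0 l i, hcomm 1 l i, hcomm 0 l j, hcomm 1 l j] at h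
    linear_combination h
  set X0 := jac τ p 0 0 * christoffel G' 0 i j p
        + jac τ p 0 1 * christoffel G' 1 i j p - (pd i (pd j fun q => τ q 0) p +
        ((christoffel G 0 0 0 (τ p) * jac τ p 0 i * jac τ p 0 j
          + christoffel G 0 0 1 (τ p) * jac τ p 0 i * jac τ p 1 j)
        + (christoffel G 0 0 1 (τ p) * jac τ p 1 i * jac τ p 0 j
          + christoffel G 0 1 1 (τ p) * jac τ p 1 i * jac τ p 1 j))) with hX0
  set X1 := jac τ p 1 0 * christoffel G' 0 i j p
        + jac τ p 1 1 * christoffel G' 1 i j p - (pd i (pd j fun q => τ q 1) p +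
        ((christoffel G 1 0 0 (τ p) * jac τ p 0 i * jac τ p 0 j
          + christoffel G 1 0 1 (τ p) * jac τ p 0 i * jac τ p 1 j)
        + (christoffel G 1 0 1 (τ p) * jac τ p 1 i * jac τ p 0 j
          + christoffel G 1 1 1 (τ p) * jac τ p 1 i * jac τ p 1 j))) with hX1
  have e0 := hX 0
  have e1 := hX 1
  set j00 := jac τ p 0 0
  set j01 := jac τ p 0 1
  set j10 := jac τ p 1 0
  set j11 := jac τ p 1 1
  have hJ : j00 * j11 - j01 * j10 ≠ 0 := by
    intro h0
    have : (j00 * j11 - j01 * j10) ^ 2 * (A * C - B * B) = 0 := by rw [h0]; ring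
    nlinarith [this, hdet']
  have hu : A * X0 + B * X1 = 0 := by
    apply mul_left_cancel₀ hJ; linear_combination j11 * e0 - j10 * e1
  have hv : B * X0 + C * X1 = 0 := by
    apply mul_left_cancel₀ hJ; linear_combination j00 * e1 - j01 * e0
  have z0 : X0 = 0 := by
    apply mul_left_cancel₀ hdet.ne'; linear_combination C * hu - B * hv
  have z1 : X1 = 0 := by
    apply mul_left_cancel₀ hdet.ne'; linear_combination A * hv - B * hu
  fin_cases c
  · exact sub_eq_zero.1 z0
  · exact sub_eq_zero.1 z1

/-- The Hessian is a tensor. -/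
theorem hess_change (hτ : ContDiffOn ℝ ∞ τ V) (hmaps : Set.MapsTo τ V U)
    (hG : IsMetricOn U G) (hG' : IsMetricOn V G')
    (hGG : ∀ q ∈ V, G' q = pullForm (jac τ q) (G (τ q))) (hf : ContDiffOn ℝ ∞ f U) (hp : p ∈ V) :
    hess G' (f ∘ τ) p = pullForm (jac τ p) (hess G f (τ p)) := by
  have hV := hG'.isOpen
  have hU := hG.isOpen
  have hJd : ∀ a i, DifferentiableAt ℝ (pd i fun q => τ q a) p := fun a i =>
    diffAt_of_contDiffOn (contDiffOn_pd (contDiffOn_coord hτ a) hV i) hV hp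
  have hτd : ∀ q ∈ V, DifferentiableAt ℝ τ q := fun q hq =>
    (hτ.contDiffAt (hV.mem_nhds hq)).differentiableAt (by simp)
  have h1 : ∀ j, ∀ q ∈ V, pd j (f ∘ τ) q
      = pd 0 f (τ q) * pd j (fun q => τ q 0) q + pd 1 f (τ q) * pd j (fun q => τ q 1) q :=
    fun j q hq => pd_comp_map (diffAt_of_contDiffOn hf hU (hmaps hq)) (hτd q hq) j
  have hfd : ∀ a, DifferentiableAt ℝ (fun q => pd a f (τ q)) p := fun a =>
    DifferentiableAt.comp p (diffAt_of_contDiffOn (contDiffOn_pd hf hU a) hU (hmaps hp))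
      (hτd p hp)
  have h2 : ∀ i j, pd i (pd j (f ∘ τ)) p =
      ((pd 0 (pd 0 f) (τ p) * jac τ p 0 i + pd 1 (pd 0 f) (τ p) * jac τ p 1 i) * jac τ p 0 j
        + pd 0 f (τ p) * pd i (pd j fun q => τ q 0) p)
      + ((pd 0 (pd 1 f) (τ p) * jac τ p 0 i + pd 1 (pd 1 f) (τ p) * jac τ p 1 i) * jac τ p 1 j
        + pd 1 f (τ p) * pd i (pd j fun q => τ q 1) p) := by
    intro i j
    rw [pd_congr_on hV (h1 j) hp, pd_add ((hfd 0).fun_mul (hJd _ _)) ((hfd 1).fun_mul (hJd _ _)),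
      pd_mul (hfd 0) (hJd _ _), pd_mul (hfd 1) (hJd _ _),
      pd_comp_map (diffAt_of_contDiffOn (contDiffOn_pd hf hU 0) hU (hmaps hp)) (hτd p hp),
      pd_comp_map (diffAt_of_contDiffOn (contDiffOn_pd hf hU 1) hU (hmaps hp)) (hτd p hp)]
    rfl
  ext i j
  have hc0 := christoffel_change hτ hmaps hG hG' hGG hp 0 i j
  have hc1 := christoffel_change hτ hmaps hG hG' hGG hp 1 i j
  simp only [hess, pullForm, Matrix.of_apply, Fin.sum_univ_two] at hc0 hc1 ⊢
  rw [h2, h1 0 p hp, h1 1 p hp]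
  have hj : ∀ a i, pd i (fun q => τ q a) p = jac τ p a i := fun a i => rfl
  simp only [hj]
  linear_combination -(pd 0 f (τ p)) * hc0 - (pd 1 f (τ p)) * hc1

/-- The trace of a tensor does not depend on the coordinates. -/
theorem traceAt_change (hG : IsMetricOn U G) (hG' : IsMetricOn V G') (hp : p ∈ V)
    (hq : τ p ∈ U) {J T : Matrix (Fin 2) (Fin 2) ℝ} (hT : T 1 0 = T 0 1)
    (hGG : G' p = pullForm J (G (τ p))) :
    traceAt G' p (pullForm J T) = traceAt G (τ p) T := by
  have hd' := hG'.det_pos p hp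
  have hd := hG.det_pos _ hq
  have h1 := hG'.traceAt_mul_det hp (T := pullForm J T)
    (by simp only [pullForm, Matrix.of_apply, hT]; ring)
  have h2 := hG.traceAt_mul_det hq hT
  have hdet : G' p 0 0 * G' p 1 1 - G' p 0 1 * G' p 0 1 =
      (J 0 0 * J 1 1 - J 0 1 * J 1 0) ^ 2
        * (G (τ p) 0 0 * G (τ p) 1 1 - G (τ p) 0 1 * G (τ p) 0 1) := by
    rw [hGG]; simp only [pullForm, Matrix.of_apply, hG.symm _ hq 1 0]; ring
  apply mul_right_cancel₀ hd'.ne'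
  rw [h1, hdet]
  have : traceAt G (τ p) T * ((J 0 0 * J 1 1 - J 0 1 * J 1 0) ^ 2
        * (G (τ p) 0 0 * G (τ p) 1 1 - G (τ p) 0 1 * G (τ p) 0 1))
      = (J 0 0 * J 1 1 - J 0 1 * J 1 0) ^ 2 * (traceAt G (τ p) T
        * (G (τ p) 0 0 * G (τ p) 1 1 - G (τ p) 0 1 * G (τ p) 0 1)) := by ring
  rw [this, h2, hGG]
  simp only [pullForm, Matrix.of_apply, hT, hG.symm _ hq 1 0]
  ring

theorem tensorNorm_change (hG : IsMetricOn U G) (hG' : IsMetricOn V G') (hp : p ∈ V)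
    (hq : τ p ∈ U) {J T : Matrix (Fin 2) (Fin 2) ℝ} (hT : T 1 0 = T 0 1)
    (hGG : G' p = pullForm J (G (τ p))) :
    tensorNorm G' p (pullForm J T) = tensorNorm G (τ p) T := by
  have hd' := hG'.det_pos p hp
  have h1 := hG'.tensorNorm_sq hp (T := pullForm J T)
    (by simp only [pullForm, Matrix.of_apply, hT]; ring)
  have h2 := hG.tensorNorm_sq hq hT
  have hdet : G' p 0 0 * G' p 1 1 - G' p 0 1 * G' p 0 1 =
      (J 0 0 * J 1 1 - J 0 1 * J 1 0) ^ 2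
        * (G (τ p) 0 0 * G (τ p) 1 1 - G (τ p) 0 1 * G (τ p) 0 1) := by
    rw [hGG]; simp only [pullForm, Matrix.of_apply, hG.symm _ hq 1 0]; ring
  rw [traceAt_change hG hG' hp hq hT hGG] at h1
  have h3 : tensorNorm G' p (pullForm J T) ^ 2 = tensorNorm G (τ p) T ^ 2 := by
    apply mul_right_cancel₀ hd'.ne'
    rw [h1, hdet]
    simp only [pullForm, Matrix.of_apply, hT]
    linear_combination -(J 0 0 * J 1 1 - J 0 1 * J 1 0) ^ 2 * h2
  exact (sq_eq_sq₀ tensorNorm_nonneg tensorNorm_nonneg).1 h3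

end

/-! ### Coordinate expressions on a surface -/

variable {M : Type*} [TopologicalSpace M] [ChartedSpace Plane M] [IsManifold (𝓡 2) ∞ M]

theorem contMDiff_constVec (v : Plane) : ContMDiff (𝓡 2) (𝓡 2).tangent ∞
    (fun p : Plane => (⟨p, v⟩ : TangentBundle (𝓡 2) Plane)) := by
  intro p
  rw [Bundle.contMDiffAt_totalSpace]
  refine ⟨contMDiffAt_id, ?_⟩
  simp [trivializationAt_model_space_apply]
  exact contMDiffAt_const

theorem contMDiffOn_coordVec {e : OpenPartialHomeomorph M Plane} (he : e ∈ charts M) (a : Fin 2) :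
    ContMDiffOn (𝓡 2) (𝓡 2).tangent ∞
      (fun p => (⟨e.symm p, coordVec e p a⟩ : TangentBundle (𝓡 2) M)) e.target := by
  have h1 : ContMDiffOn (𝓡 2) (𝓡 2) ∞ e.symm e.target := contMDiffOn_symm_of_mem_maximalAtlas he
  have : IsManifold (𝓡 2) 1 M := IsManifold.of_le (n := ∞) (by exact_mod_cast le_top)
  have h2 := h1.contMDiffOn_tangentMapWithin (m := ∞) (by simp) e.open_target.uniqueMDiffOn
  have h3 := h2.comp (contMDiff_constVec (EuclideanSpace.single a 1)).contMDiffOn (s := e.target)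
    (fun p hp => hp)
  refine h3.congr fun p hp => ?_
  simp only [Function.comp, tangentMapWithin, coordVec]
  rw [mfderivWithin_of_isOpen e.open_target hp]

theorem contDiffOn_comps {T : (x : M) → TangentSpace (𝓡 2) x →L[ℝ] TangentSpace (𝓡 2) x →L[ℝ] ℝ}
    (hT : ContMDiff (𝓡 2) ((𝓡 2).prod 𝓘(ℝ, Plane →L[ℝ] Plane →L[ℝ] ℝ)) ∞
    (fun x => Bundle.TotalSpace.mk' (Plane →L[ℝ] Plane →L[ℝ] ℝ)
      (E := fun x : M => TangentSpace (𝓡 2) x →L[ℝ] TangentSpace (𝓡 2) x →L[ℝ] ℝ) x (T x)))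
    {e : OpenPartialHomeomorph M Plane} (he : e ∈ charts M) (a b : Fin 2) :
    ContDiffOn ℝ ∞ (fun p => comps T e p a b) e.target := by
  have h1 : ContMDiffOn (𝓡 2) (𝓡 2) ∞ e.symm e.target := contMDiffOn_symm_of_mem_maximalAtlas he
  have h2 : ContMDiffOn (𝓡 2) ((𝓡 2).prod 𝓘(ℝ, ℝ)) ∞
      (fun p => Bundle.TotalSpace.mk' ℝ (E := Bundle.Trivial M ℝ) (e.symm p)
        (T (e.symm p) (coordVec e p a) (coordVec e p b))) e.target := by
    apply ContMDiffOn.clm_bundle_apply₂ (F₁ := Plane) (F₂ := Plane)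
    · exact hT.comp_contMDiffOn h1
    · exact contMDiffOn_coordVec he a
    · exact contMDiffOn_coordVec he b
  rw [← contMDiffOn_iff_contDiffOn]
  intro p hp
  have h3 := h2 p hp
  simp only [Bundle.contMDiffWithinAt_totalSpace] at h3
  exact h3.2

theorem mdifferentiableAt_symm {e : OpenPartialHomeomorph M Plane} (he : e ∈ charts M) {p : Plane}
    (hp : p ∈ e.target) : MDifferentiableAt (𝓡 2) (𝓡 2) e.symm p :=
  ((contMDiffOn_symm_of_mem_maximalAtlas (n := ∞) he).contMDiffAt
    (e.open_target.mem_nhds hp)).mdifferentiableAt (by simp)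

/-- A transition map of the surface. -/
theorem contDiffOn_transition {e e' : OpenPartialHomeomorph M Plane} (he : e ∈ charts M)
    (he' : e' ∈ charts M) :
    ContDiffOn ℝ ∞ (e ∘ e'.symm) (e'.target ∩ e'.symm ⁻¹' e.source) := by
  rw [← contMDiffOn_iff_contDiffOn]
  exact (contMDiffOn_of_mem_maximalAtlas (n := ∞) he).comp
    ((contMDiffOn_symm_of_mem_maximalAtlas (n := ∞) he').mono Set.inter_subset_left)
    (fun p hp => hp.2)

theorem coordVec_change {e e' : OpenPartialHomeomorph M Plane} (he : e ∈ charts M)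
    (he' : e' ∈ charts M) {p : Plane} (hp : p ∈ e'.target) (hpe : e'.symm p ∈ e.source)
    (i : Fin 2) :
    (coordVec e' p i : Plane) = jac (e ∘ e'.symm) p 0 i • (coordVec e (e (e'.symm p)) 0 : Plane)
      + jac (e ∘ e'.symm) p 1 i • (coordVec e (e (e'.symm p)) 1 : Plane) := by
  set τ := e ∘ e'.symm with hτ
  have hopen : IsOpen (e'.target ∩ e'.symm ⁻¹' e.source) :=
    e'.symm.isOpen_inter_preimage e.open_source
  have hmem : p ∈ e'.target ∩ e'.symm ⁻¹' e.source := ⟨hp, hpe⟩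
  have hτd : DifferentiableAt ℝ τ p :=
    ((contDiffOn_transition he he').contDiffAt (hopen.mem_nhds hmem)).differentiableAt (by simp)
  have hev : (e'.symm : Plane → M) =ᶠ[nhds p] e.symm ∘ τ := by
    filter_upwards [hopen.mem_nhds hmem] with q hq
    simp [hτ, e.left_inv hq.2]
  have h1 : mfderiv (𝓡 2) (𝓡 2) e'.symm p = mfderiv (𝓡 2) (𝓡 2) (e.symm ∘ τ) p :=
    hev.mfderiv_eq
  have hτp : τ p ∈ e.target := e.map_source hpe
  have h2 := mfderiv_comp (I := 𝓡 2) (I' := 𝓡 2) (I'' := 𝓡 2) p (mdifferentiableAt_symm he hτp)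
    hτd.mdifferentiableAt
  have h3 : ∀ k, (fderiv ℝ τ p (EuclideanSpace.single i 1)) k = jac τ p k i := by
    intro k
    simp only [jac, Matrix.of_apply, pd]
    have h3 : HasFDerivAt (fun q => τ q k)
        ((EuclideanSpace.proj k : Plane →L[ℝ] ℝ).comp (fderiv ℝ τ p)) p :=
      (EuclideanSpace.proj k : Plane →L[ℝ] ℝ).hasFDerivAt.comp p hτd.hasFDerivAt
    rw [h3.fderiv]; simp
  have hv : fderiv ℝ τ p (EuclideanSpace.single i 1)
      = jac τ p 0 i • EuclideanSpace.single (0 : Fin 2) (1 : ℝ)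
      + jac τ p 1 i • EuclideanSpace.single (1 : Fin 2) (1 : ℝ) := by
    ext k; fin_cases k <;> simp [h3]
  have h4 : (coordVec e' p i : Plane)
      = mfderiv (𝓡 2) (𝓡 2) e.symm (τ p) (fderiv ℝ τ p (EuclideanSpace.single i 1)) := by
    unfold coordVec
    rw [h1, h2, mfderiv_eq_fderiv]
    rfl
  have hlin : ∀ (L : Plane →L[ℝ] Plane) (a b : ℝ) (v w : Plane),
      L (a • v + b • w) = a • L v + b • L w := fun L a b v w => by simp
  rw [h4, hv]
  exact hlin (mfderiv (𝓡 2) (𝓡 2) e.symm (τ p)) _ _ _ _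

theorem comps_change (T : (x : M) → TangentSpace (𝓡 2) x →L[ℝ] TangentSpace (𝓡 2) x →L[ℝ] ℝ)
    {e e' : OpenPartialHomeomorph M Plane} (he : e ∈ charts M)
    (he' : e' ∈ charts M) {p : Plane} (hp : p ∈ e'.target) (hpe : e'.symm p ∈ e.source) :
    comps T e' p = pullForm (jac (e ∘ e'.symm) p) (comps T e (e (e'.symm p))) := by
  have hT : ∀ x y : M, x = y → ∀ v w : Plane,
      (T x : Plane →L[ℝ] Plane →L[ℝ] ℝ) v w = (T y : Plane →L[ℝ] Plane →L[ℝ] ℝ) v w := by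
    rintro x y rfl v w; rfl
  have hx : e.symm (e (e'.symm p)) = e'.symm p := e.left_inv hpe
  ext i j
  simp only [comps, pullForm, Matrix.of_apply]
  have h0 := coordVec_change he he' hp hpe i
  have h1 := coordVec_change he he' hp hpe j
  have h2 := hT _ _ hx.symm (coordVec e' p i) (coordVec e' p j)
  refine h2.trans ?_
  have hbil : ∀ (S : Plane →L[ℝ] Plane →L[ℝ] ℝ) (a b c d : ℝ) (v w : Plane),
      S (a • v + b • w) (c • v + d • w)
        = a * c * S v v + a * d * S v w + b * c * S w v + b * d * S w w := by
    intro S a b c d v w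
    simp only [map_add, map_smul, add_apply, smul_apply, smul_eq_mul]
    ring
  rw [h0, h1]
  exact hbil (T (e.symm (e (e'.symm p)))) _ _ _ _ _ _

theorem trans_mem_charts {e : OpenPartialHomeomorph M Plane} (he : e ∈ charts M)
    {τ : OpenPartialHomeomorph Plane Plane} (h1 : ContDiffOn ℝ ∞ τ τ.source)
    (h2 : ContDiffOn ℝ ∞ τ.symm τ.target) : e.trans τ ∈ charts M := by
  apply OpenPartialHomeomorph.mem_maximalAtlas_of_contMDiffOn
  · have h3 : ContMDiffOn (𝓡 2) (𝓡 2) ∞ e (e.trans τ).source :=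
      (contMDiffOn_of_mem_maximalAtlas (n := ∞) he).mono
        (by rw [OpenPartialHomeomorph.trans_source]; exact Set.inter_subset_left)
    refine (contMDiffOn_iff_contDiffOn.2 h1).comp h3 fun x hx => ?_
    rw [OpenPartialHomeomorph.trans_source] at hx
    exact hx.2
  · have h3 : ContMDiffOn (𝓡 2) (𝓡 2) ∞ τ.symm (e.trans τ).target :=
      (contMDiffOn_iff_contDiffOn.2 h2).mono
        (by rw [OpenPartialHomeomorph.trans_target]; exact Set.inter_subset_left)
    refine (contMDiffOn_symm_of_mem_maximalAtlas (n := ∞) he).comp h3 fun x hx => ?_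
    rw [OpenPartialHomeomorph.trans_target] at hx
    exact hx.2

section Invariance

variable {ρ : SurfaceMetric M}
  {z : (x : M) → TangentSpace (𝓡 2) x →L[ℝ] TangentSpace (𝓡 2) x →L[ℝ] ℝ} {u : M → ℝ}
  {e e' : OpenPartialHomeomorph M Plane} {p : Plane}

theorem mfderiv_symm_ne_zero (he : e ∈ charts M) (hp : p ∈ e.target) {v : Plane} (hv : v ≠ 0) :
    (mfderiv (𝓡 2) (𝓡 2) e.symm p v : Plane) ≠ 0 := by
  intro h0
  have hx : e.symm p ∈ e.source := e.map_target hp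
  have h1 : MDifferentiableAt (𝓡 2) (𝓡 2) e (e.symm p) :=
    ((contMDiffOn_of_mem_maximalAtlas (n := ∞) he).contMDiffAt
      (e.open_source.mem_nhds hx)).mdifferentiableAt (by simp)
  have h2 := mfderiv_comp (I := 𝓡 2) (I' := 𝓡 2) (I'' := 𝓡 2) p h1 (mdifferentiableAt_symm he hp)
  have h3 : (e ∘ e.symm : Plane → Plane) =ᶠ[nhds p] id := by
    filter_upwards [e.open_target.mem_nhds hp] with q hq using e.right_inv hq
  rw [h3.mfderiv_eq, mfderiv_id] at h2
  have h4 := congrArg (fun L : Plane →L[ℝ] Plane => L v) h2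
  have h5 : v = (mfderiv (𝓡 2) (𝓡 2) e (e.symm p) : Plane →L[ℝ] Plane)
      (mfderiv (𝓡 2) (𝓡 2) e.symm p v) := h4
  rw [h0, map_zero] at h5
  exact hv h5

theorem comps_form (T : (x : M) → TangentSpace (𝓡 2) x →L[ℝ] TangentSpace (𝓡 2) x →L[ℝ] ℝ)
    (e : OpenPartialHomeomorph M Plane) (p v : Plane) :
    T (e.symm p) (mfderiv (𝓡 2) (𝓡 2) e.symm p v) (mfderiv (𝓡 2) (𝓡 2) e.symm p v)
      = v 0 * v 0 * comps T e p 0 0 + v 0 * v 1 * comps T e p 0 1 + v 1 * v 0 * comps T e p 1 0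
        + v 1 * v 1 * comps T e p 1 1 := by
  have hv : v = v 0 • EuclideanSpace.single (0 : Fin 2) (1 : ℝ)
      + v 1 • EuclideanSpace.single (1 : Fin 2) (1 : ℝ) := by
    ext k; fin_cases k <;> simp
  have hbil : ∀ (S : Plane →L[ℝ] Plane →L[ℝ] ℝ) (L : Plane →L[ℝ] Plane) (a b : ℝ) (v w : Plane),
      S (L (a • v + b • w)) (L (a • v + b • w))
        = a * a * S (L v) (L v) + a * b * S (L v) (L w) + b * a * S (L w) (L v)
          + b * b * S (L w) (L w) := by
    intro S L a b v w
    simp only [map_add, map_smul, add_apply, smul_apply, smul_eq_mul]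
    ring
  have h := hbil (T (e.symm p)) (mfderiv (𝓡 2) (𝓡 2) e.symm p) (v 0) (v 1)
    (EuclideanSpace.single 0 1) (EuclideanSpace.single 1 1)
  rw [← hv] at h
  exact h

theorem isMetricOn_comps (he : e ∈ charts M) : IsMetricOn e.target (comps ρ.inner e) := by
  have hs : ∀ q a b, comps ρ.inner e q a b = comps ρ.inner e q b a := by
    intro q a b
    simp only [comps, Matrix.of_apply]
    exact ρ.symm _ _ _
  have hpos : ∀ q ∈ e.target, ∀ v : Plane, v ≠ 0 →
      0 < v 0 * v 0 * comps ρ.inner e q 0 0 + v 0 * v 1 * comps ρ.inner e q 0 1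
        + v 1 * v 0 * comps ρ.inner e q 1 0 + v 1 * v 1 * comps ρ.inner e q 1 1 := by
    intro q hq v hv
    rw [← comps_form]
    exact ρ.pos _ _ (mfderiv_symm_ne_zero he hq hv)
  have h00 : ∀ q ∈ e.target, 0 < comps ρ.inner e q 0 0 := by
    intro q hq
    simpa using hpos q hq (EuclideanSpace.single 0 1) (by
      intro h; have := congrArg (fun v : Plane => v 0) h; simp at this)
  refine ⟨e.open_target, fun a b => contDiffOn_comps ρ.contMDiff he a b, fun q _ a b => hs q a b,
    h00, fun q hq => ?_⟩
  have h1 := hpos q hq (!₂[-comps ρ.inner e q 0 1, comps ρ.inner e q 0 0]) (by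
      intro h; have := congrArg (fun v : Plane => v 1) h; simp at this
      exact (h00 q hq).ne' this)
  simp only [PiLp.toLp_apply, Matrix.cons_val_zero, Matrix.cons_val_one, hs q 1 0] at h1
  have h2 : 0 < comps ρ.inner e q 0 0 * (comps ρ.inner e q 0 0 * comps ρ.inner e q 1 1
      - comps ρ.inner e q 0 1 * comps ρ.inner e q 0 1) := by linarith
  exact pos_of_mul_pos_right h2 (h00 q hq).le

theorem contDiffOn_comp_symm (hu : ContMDiff (𝓡 2) 𝓘(ℝ) ∞ u) (he : e ∈ charts M) :
    ContDiffOn ℝ ∞ (u ∘ e.symm) e.target := by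
  rw [← contMDiffOn_iff_contDiffOn]
  exact hu.comp_contMDiffOn (contMDiffOn_symm_of_mem_maximalAtlas (n := ∞) he)

theorem comps_symm (hz : IsTT ρ z) (e : OpenPartialHomeomorph M Plane) (p : Plane) (a b : Fin 2) :
    comps z e p a b = comps z e p b a := by
  simp only [comps, Matrix.of_apply]; exact hz.symm _ _ _

theorem isLocalSolution (hρ : HasScalarCurvature ρ (-1)) (hz : IsTT ρ z) (hu : IsSolution ρ z u)
    (he : e ∈ charts M) :
    IsLocalSolution e.target (comps ρ.inner e) (comps z e) (u ∘ e.symm) where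
  metric := isMetricOn_comps he
  curv := hρ e he
  smooth := contDiffOn_comp_symm hu.smooth he
  tensor_smooth := fun a b => contDiffOn_comps hz.smooth he a b
  tensor_symm := fun q _ a b => comps_symm hz e q a b
  traceFree := hz.traceFree e he
  divFree := hz.divFree e he
  eqn := hu.eqn e he

theorem IsMetricOn.mono {U V : Set Plane} {G : Plane → Matrix (Fin 2) (Fin 2) ℝ}
    (h : IsMetricOn U G) (hV : IsOpen V) (hVU : V ⊆ U) : IsMetricOn V G :=
  ⟨hV, fun a b => (h.smooth a b).mono hVU, fun q hq => h.symm q (hVU hq),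
    fun q hq => h.pos q (hVU hq), fun q hq => h.det_pos q (hVU hq)⟩

theorem hess_congr {G : Plane → Matrix (Fin 2) (Fin 2) ℝ} {f g : Plane → ℝ}
    (h : f =ᶠ[nhds p] g) : hess G f p = hess G g p := by
  ext a b
  simp only [hess, Matrix.of_apply, Fin.sum_univ_two]
  have h1 : pd b f =ᶠ[nhds p] pd b g := by
    filter_upwards [h.eventuallyEq_nhds] with q hq using pd_congr hq b
  rw [pd_congr h1, pd_congr h, pd_congr h]

theorem hess_change_chart (hu : ContMDiff (𝓡 2) 𝓘(ℝ) ∞ u) (he : e ∈ charts M) (he' : e' ∈ charts M)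
    (hp : p ∈ e'.target) (hpe : e'.symm p ∈ e.source) :
    hess (comps ρ.inner e') (u ∘ e'.symm) p = pullForm (jac (e ∘ e'.symm) p)
      (hess (comps ρ.inner e) (u ∘ e.symm) (e (e'.symm p))) := by
  have hopen : IsOpen (e'.target ∩ e'.symm ⁻¹' e.source) :=
    e'.symm.isOpen_inter_preimage e.open_source
  have hmem : p ∈ e'.target ∩ e'.symm ⁻¹' e.source := ⟨hp, hpe⟩
  have h1 : (u ∘ e'.symm) =ᶠ[nhds p] (u ∘ e.symm) ∘ (e ∘ e'.symm) := by
    filter_upwards [hopen.mem_nhds hmem] with q hq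
    simp [e.left_inv hq.2]
  rw [hess_congr h1]
  exact hess_change (contDiffOn_transition he he') (U := e.target)
    (fun q hq => e.map_source hq.2) (isMetricOn_comps he)
    ((isMetricOn_comps he').mono hopen Set.inter_subset_left)
    (fun q hq => comps_change ρ.inner he he' hq.1 hq.2) (contDiffOn_comp_symm hu he) hmem

theorem nonlinearTerm_change_chart (hz : IsTT ρ z) (hu : ContMDiff (𝓡 2) 𝓘(ℝ) ∞ u)
    (he : e ∈ charts M) (he' : e' ∈ charts M) (hp : p ∈ e'.target) (hpe : e'.symm p ∈ e.source) :
    nonlinearTerm (comps ρ.inner e') (comps z e') (u ∘ e'.symm) p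
      = nonlinearTerm (comps ρ.inner e) (comps z e) (u ∘ e.symm) (e (e'.symm p)) := by
  have hG := comps_change ρ.inner he he' hp hpe
  have hZ := comps_change z he he' hp hpe
  have hH := hess_change_chart (ρ := ρ) hu he he' hp hpe
  have hq : e (e'.symm p) ∈ e.target := e.map_source hpe
  have hHs := (isMetricOn_comps (ρ := ρ) he).hess_symm (contDiffOn_comp_symm hu he) hq 1 0
  have hl : lap (comps ρ.inner e') (u ∘ e'.symm) p
      = lap (comps ρ.inner e) (u ∘ e.symm) (e (e'.symm p)) := by
    unfold lap
    rw [hH]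
    exact traceAt_change (τ := e ∘ e'.symm) (isMetricOn_comps he) (isMetricOn_comps he') hp hq
      hHs hG
  have hxi : xi (comps ρ.inner e') (comps z e') (u ∘ e'.symm) p = pullForm (jac (e ∘ e'.symm) p)
      (xi (comps ρ.inner e) (comps z e) (u ∘ e.symm) (e (e'.symm p))) := by
    unfold xi
    rw [hl, hH, hG, hZ]
    ext i j
    simp only [pullForm, Matrix.of_apply, Matrix.smul_apply, Matrix.sub_apply, smul_eq_mul]
    ring
  unfold nonlinearTerm
  rw [hxi, tensorNorm_change (τ := e ∘ e'.symm) (isMetricOn_comps he) (isMetricOn_comps he') hp hq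
    _ hG]
  · rfl
  · simp only [xi, Matrix.smul_apply, Matrix.sub_apply, comps_symm hz e _ 1 0, hHs,
      (isMetricOn_comps (ρ := ρ) he).symm _ hq 1 0]

theorem codazziTensor_change_chart (hu : ContMDiff (𝓡 2) 𝓘(ℝ) ∞ u)
    (he : e ∈ charts M) (he' : e' ∈ charts M) (hp : p ∈ e'.target) (hpe : e'.symm p ∈ e.source) :
    codazziTensor (comps ρ.inner e') (comps z e') (u ∘ e'.symm) p = pullForm (jac (e ∘ e'.symm) p)
      (codazziTensor (comps ρ.inner e) (comps z e) (u ∘ e.symm) (e (e'.symm p))) := by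
  have hG := comps_change ρ.inner he he' hp hpe
  have hZ := comps_change z he he' hp hpe
  have hH := hess_change_chart (ρ := ρ) hu he he' hp hpe
  unfold codazziTensor
  rw [hH, hG, hZ]
  ext i j
  simp only [pullForm, Matrix.of_apply, Function.comp, e.left_inv hpe]
  ring

theorem tensorNorm_change_chart (hz : IsTT ρ z)
    (he : e ∈ charts M) (he' : e' ∈ charts M) (hp : p ∈ e'.target) (hpe : e'.symm p ∈ e.source) :
    tensorNorm (comps ρ.inner e') p (comps z e' p)
      = tensorNorm (comps ρ.inner e) (e (e'.symm p)) (comps z e (e (e'.symm p))) := by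
  rw [comps_change z he he' hp hpe]
  exact tensorNorm_change (τ := e ∘ e'.symm) (isMetricOn_comps he) (isMetricOn_comps he') hp
    (e.map_source hpe) (comps_symm hz e _ 1 0) (comps_change ρ.inner he he' hp hpe)

end Invariance

/-! ### The length of the gradient in coordinates -/

/-- The squared norm `ρ^{ab} ∂_a f ∂_b f` of the gradient of `f`. -/
def gradSq (G : Plane → Matrix (Fin 2) (Fin 2) ℝ) (f : Plane → ℝ) (p : Plane) : ℝ :=
  ∑ a, ∑ b, (G p)⁻¹ a b * pd a f p * pd b f p

section

variable {U V : Set Plane} {G G' Z : Plane → Matrix (Fin 2) (Fin 2) ℝ} {f : Plane → ℝ} {p : Plane}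
  {τ : Plane → Plane}

theorem IsMetricOn.gradSq_mul_det (hG : IsMetricOn U G) (hp : p ∈ U) :
    gradSq G f p * (G p 0 0 * G p 1 1 - G p 0 1 * G p 0 1)
      = G p 1 1 * (pd 0 f p * pd 0 f p) - 2 * (G p 0 1 * (pd 0 f p * pd 1 f p))
        + G p 0 0 * (pd 1 f p * pd 1 f p) := by
  obtain ⟨k, hk0, hk, i1, i2, i3, i4⟩ := hG.exists_inv_det hp
  unfold gradSq
  simp only [Fin.sum_univ_two, i1, i2, i3, i4]
  linear_combination (G p 1 1 * (pd 0 f p * pd 0 f p) - 2 * (G p 0 1 * (pd 0 f p * pd 1 f p))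
        + G p 0 0 * (pd 1 f p * pd 1 f p)) * hk

theorem IsMetricOn.contDiffOn_gradSq (hG : IsMetricOn U G) (hf : ContDiffOn ℝ ∞ f U) :
    ContDiffOn ℝ ∞ (gradSq G f) U := by
  unfold gradSq
  simp only [Fin.sum_univ_two]
  have h := fun a b => ((hG.contDiffOn_inv a b).mul (contDiffOn_pd hf hG.isOpen a)).mul
    (contDiffOn_pd hf hG.isOpen b)
  exact ((h 0 0).add (h 0 1)).add ((h 1 0).add (h 1 1))

theorem gradSq_change (hG : IsMetricOn U G) (hG' : IsMetricOn V G')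
    (hmaps : τ p ∈ U) (hp : p ∈ V) (hτ : DifferentiableAt ℝ τ p)
    (hf : DifferentiableAt ℝ f (τ p)) (hGG : G' p = pullForm (jac τ p) (G (τ p))) :
    gradSq G' (f ∘ τ) p = gradSq G f (τ p) := by
  have hd' := hG'.det_pos p hp
  have h1 := hG'.gradSq_mul_det (f := f ∘ τ) hp
  have h2 := hG.gradSq_mul_det (f := f) hmaps
  have hdet : G' p 0 0 * G' p 1 1 - G' p 0 1 * G' p 0 1 =
      (jac τ p 0 0 * jac τ p 1 1 - jac τ p 0 1 * jac τ p 1 0) ^ 2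
        * (G (τ p) 0 0 * G (τ p) 1 1 - G (τ p) 0 1 * G (τ p) 0 1) := by
    rw [hGG]; simp only [pullForm, Matrix.of_apply, hG.symm _ hmaps 1 0]; ring
  have h3 : ∀ i, pd i (f ∘ τ) p = pd 0 f (τ p) * jac τ p 0 i + pd 1 f (τ p) * jac τ p 1 i :=
    fun i => pd_comp_map hf hτ i
  apply mul_right_cancel₀ hd'.ne'
  rw [h1, hdet, h3, h3, hGG]
  simp only [pullForm, Matrix.of_apply, hG.symm _ hmaps 1 0]
  linear_combination -(jac τ p 0 0 * jac τ p 1 1 - jac τ p 0 1 * jac τ p 1 0) ^ 2 * h2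

/-- The derivative of the squared length of the gradient, in terms of the Hessian. -/
theorem IsMetricOn.pd_gradSq (hG : IsMetricOn U G) (hf : ContDiffOn ℝ ∞ f U) (hp : p ∈ U)
    (c : Fin 2) :
    pd c (gradSq G f) p * (G p 0 0 * G p 1 1 - G p 0 1 * G p 0 1) =
      2 * (hess G f p c 0 * (G p 1 1 * pd 0 f p - G p 0 1 * pd 1 f p)
        + hess G f p c 1 * (G p 0 0 * pd 1 f p - G p 0 1 * pd 0 f p)) := by
  have hU := hG.isOpen
  have hdG := fun a b => hG.diffAt hp a b
  have hdf := fun i => diffAt_of_contDiffOn (contDiffOn_pd hf hU i) hU hp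
  have hdg := diffAt_of_contDiffOn (hG.contDiffOn_gradSq hf) hU hp
  have h := pd_congr_on hU (fun q hq => hG.gradSq_mul_det (f := f) hq) hp c
  rw [pd_mul hdg (by fun_prop), pd_sub (by fun_prop) (by fun_prop), pd_mul (hdG _ _) (hdG _ _),
    pd_mul (hdG _ _) (hdG _ _), pd_add (by fun_prop) (by fun_prop),
    pd_sub (by fun_prop) (by fun_prop), pd_const_mul (by fun_prop),
    pd_mul (hdG _ _) (by fun_prop), pd_mul (hdG _ _) (by fun_prop),
    pd_mul (hdG _ _) (by fun_prop), pd_mul (hdf _) (hdf _), pd_mul (hdf _) (hdf _),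
    pd_mul (hdf _) (hdf _)] at h
  simp only [hG.pd_metric hp, hG.symm p hp 1 0] at h
  have h0 := hG.gradSq_mul_det (f := f) hp
  simp only [hess, Matrix.of_apply, Fin.sum_univ_two]
  linear_combination h - 2 * (christoffel G 0 c 0 p + christoffel G 1 c 1 p) * h0

/-- At a critical point of `|∇f|² / 2 - A f` with `A` large, a solution is stationary. -/
theorem IsLocalSolution.gradSq_nonpos (h : IsLocalSolution U G Z f) (hp : p ∈ U) {A : ℝ}
    (hA : tensorNorm G p (Z p) + f p / 2 < A)
    (hcrit : ∀ c, pd c (gradSq G f) p = 2 * (A * pd c f p)) : gradSq G f p ≤ 0 := by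
  have hG := h.metric
  obtain ⟨k, hk0, hk, -⟩ := hG.exists_inv_det hp
  have h0 := hG.gradSq_mul_det (f := f) hp
  have e0 := hG.pd_gradSq h.smooth hp 0
  have e1 := hG.pd_gradSq h.smooth hp 1
  rw [hcrit] at e0 e1
  have hs := hG.hess_symm h.smooth hp 1 0
  rw [hs] at e1
  set w0 := G p 1 1 * pd 0 f p - G p 0 1 * pd 1 f p with hw0
  set w1 := G p 0 0 * pd 1 f p - G p 0 1 * pd 0 f p with hw1
  set d := G p 0 0 * G p 1 1 - G p 0 1 * G p 0 1 with hdd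
  have hd : 0 < d := hG.det_pos p hp
  have hb := h.codazziTensor_form_nonneg hp w0 w1
  have hz := hG.form_le_tensorNorm hp (T := Z p) (h.tensor_symm p hp 1 0) w0 w1
  have hgw : G p 0 0 * (w0 * w0) + 2 * (G p 0 1 * (w0 * w1)) + G p 1 1 * (w1 * w1)
      = gradSq G f p * d * d := by
    rw [h0, hw0, hw1, hdd]; ring
  have hhw : hess G f p 0 0 * (w0 * w0) + 2 * (hess G f p 0 1 * (w0 * w1))
      + hess G f p 1 1 * (w1 * w1) = A * (gradSq G f p * d * d) := by
    have : pd 0 f p * w0 + pd 1 f p * w1 = gradSq G f p * d := by rw [h0, hw0, hw1]; ring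
    linear_combination (-w0 / 2) * e0 - (w1 / 2) * e1 + A * d * this
  simp only [codazziTensor, Matrix.of_apply] at hb
  have h5 : 0 ≤ (tensorNorm G p (Z p) + f p / 2 - A) * (gradSq G f p * d * d) := by
    have : (tensorNorm G p (Z p) + f p / 2 - A) * (gradSq G f p * d * d)
      = tensorNorm G p (Z p) * (gradSq G f p * d * d) + f p / 2 * (gradSq G f p * d * d)
        - A * (gradSq G f p * d * d) := by ring
    rw [this, ← hhw, ← hgw]
    rw [← hgw] at *
    linarith
  by_contra hcon
  push Not at hcon
  have h6 : 0 < gradSq G f p * d * d := by positivity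
  nlinarith [mul_neg_of_neg_of_pos (sub_neg.2 hA) h6]

/-- The bound for a solution at an interior maximum. -/
theorem IsLocalSolution.le_of_isLocalMax (h : IsLocalSolution U G Z f) (hp : p ∈ U)
    (hmax : IsLocalMax f p) : f p ≤ 1 + 2 * tensorNorm G p (Z p) := by
  by_contra hcon
  push Not at hcon
  have hG := h.metric
  have hd := hG.det_pos p hp
  set κ := f p / 2 - tensorNorm G p (Z p) with hκ
  have hκ1 : 1 / 2 < κ := by rw [hκ]; linarith
  have hh : ∀ a b, hess G f p a b = pd a (pd b f) p := by
    intro a b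
    simp [hess, pd_eq_zero_of_isLocalMax hmax]
  have key := sq_mul_det_le_det (κ := κ) (x := codazziTensor G Z f p 0 0)
    (y := codazziTensor G Z f p 0 1) (z := codazziTensor G Z f p 1 1) (hG.pos p hp) hd
    (by linarith) (by
      intro v w
      have h1 := sum_pd_pd_nonpos_of_isLocalMax h.smooth h.isOpen hp hmax (!₂[v, w])
      simp only [Matrix.cons_val_zero, Matrix.cons_val_one] at h1
      have h2 := hG.neg_tensorNorm_le_form hp (T := Z p) (h.tensor_symm p hp 1 0) v w
      simp only [codazziTensor, Matrix.of_apply, hh]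
      rw [hκ]
      linarith)
  rw [h.det_codazziTensor hp] at key
  have : 1 / 4 < κ ^ 2 := by nlinarith
  nlinarith [mul_lt_mul_of_pos_right this hd]

theorem IsLocalSolution.one_le_of_isLocalMin (h : IsLocalSolution U G Z f) (hp : p ∈ U)
    (hmin : IsLocalMin f p) : 1 ≤ f p := by
  have hG := h.metric
  have hd := hG.det_pos p hp
  have hmax : IsLocalMax (fun q => - f q) p := hmin.neg
  have hpd : ∀ a, pd a f p = 0 := by
    intro a
    have := pd_eq_zero_of_isLocalMax hmax a
    rw [pd_neg] at this
    linarith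
  have hh : ∀ a b, hess G f p a b = pd a (pd b f) p := by
    intro a b
    simp [hess, hpd]
  have hpp : ∀ a b, pd a (pd b fun q => - f q) p = - pd a (pd b f) p := by
    intro a b
    have : pd b (fun q => - f q) = fun q => - pd b f q := by
      funext q; exact pd_neg b
    rw [this, pd_neg]
  have h1 := trace_nonneg_of_form (x := hess G f p 0 0) (y := hess G f p 0 1)
    (z := hess G f p 1 1) (hG.pos p hp) hd (by
      intro v w
      have h1 := sum_pd_pd_nonpos_of_isLocalMax h.smooth.neg h.isOpen hp hmax (!₂[v, w])
      simp only [Matrix.cons_val_zero, Matrix.cons_val_one, hpp] at h1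
      simp only [hh]
      linarith)
  rw [← hG.traceAt_mul_det hp (hG.hess_symm h.smooth hp 1 0)] at h1
  have h2 : 0 ≤ lap G f p := nonneg_of_mul_nonneg_left h1 hd
  have h3 := h.eqn p hp
  have h4 : 1 ≤ nonlinearTerm G Z f p := one_le_nonlinearTerm
  linarith

end

/-! ### Functions on a closed surface -/

section Global

variable {M : Type*} [TopologicalSpace M] [ChartedSpace Plane M] [IsManifold (𝓡 2) ∞ M]
  {ρ : SurfaceMetric M} {z : (x : M) → TangentSpace (𝓡 2) x →L[ℝ] TangentSpace (𝓡 2) x →L[ℝ] ℝ}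
  {u : M → ℝ} {e : OpenPartialHomeomorph M Plane} {p : Plane}

theorem chartAt_mem_charts (x : M) : chartAt Plane x ∈ charts M :=
  IsManifold.chart_mem_maximalAtlas x

theorem continuous_of_charts {F : M → ℝ}
    (hF : ∀ e ∈ charts M, ContinuousOn (fun p => F (e.symm p)) e.target) : Continuous F := by
  rw [continuous_iff_continuousAt]
  intro x
  set e := chartAt Plane x
  have hx : x ∈ e.source := mem_chart_source Plane x
  have h1 : ContinuousAt (fun p => F (e.symm p)) (e x) :=
    (hF e (chartAt_mem_charts x)).continuousAt (e.open_target.mem_nhds (e.map_source hx))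
  have h2 : ContinuousAt (fun y => F (e.symm (e y))) x :=
    ContinuousAt.comp (f := e) h1 (e.continuousAt hx)
  refine h2.congr ?_
  filter_upwards [e.open_source.mem_nhds hx] with y hy
  rw [e.left_inv hy]

theorem exists_forall_le_of_charts [CompactSpace M] [Nonempty M] {F : M → ℝ}
    (hF : ∀ e ∈ charts M, ContinuousOn (fun p => F (e.symm p)) e.target) :
    ∃ x₀, ∀ x, F x ≤ F x₀ := by
  obtain ⟨x₀, -, h⟩ := isCompact_univ.exists_isMaxOn Set.univ_nonempty
    (continuous_of_charts hF).continuousOn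
  exact ⟨x₀, fun x => h (Set.mem_univ x)⟩

theorem isLocalMax_comp_symm {F : M → ℝ} {x₀ : M} (h : ∀ x, F x ≤ F x₀) (hx : x₀ ∈ e.source) :
    IsLocalMax (fun p => F (e.symm p)) (e x₀) :=
  Filter.Eventually.of_forall fun p => by
    simp only [e.left_inv hx]; exact h _

theorem tensorNorm_le_supNorm [CompactSpace M] (hz : IsTT ρ z) (he : e ∈ charts M)
    (hp : p ∈ e.target) : tensorNorm (comps ρ.inner e) p (comps z e p) ≤ supNorm ρ z := by
  set F : M → ℝ := fun x => tensorNorm (comps ρ.inner (chartAt Plane x)) (chartAt Plane x x)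
    (comps z (chartAt Plane x) (chartAt Plane x x)) with hF
  have hFe : ∀ e ∈ charts M, ∀ p ∈ e.target, F (e.symm p)
      = tensorNorm (comps ρ.inner e) p (comps z e p) := by
    intro e he p hp
    rw [tensorNorm_change_chart hz (chartAt_mem_charts (e.symm p)) he hp (mem_chart_source _ _)]
  have hc : Continuous F := by
    apply continuous_of_charts
    intro e he
    have h1 : ContinuousOn (fun p => tensorNorm (comps ρ.inner e) p (comps z e p)) e.target := by
      unfold tensorNorm
      apply ContinuousOn.sqrt
      have hi := fun a b => ((isMetricOn_comps (ρ := ρ) he).contDiffOn_inv a b).continuousOn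
      have hzc := fun a b => (contDiffOn_comps hz.smooth he a b).continuousOn
      refine continuousOn_finsetSum _ fun a _ => continuousOn_finsetSum _ fun b _ =>
        continuousOn_finsetSum _ fun c _ => continuousOn_finsetSum _ fun d _ => ?_
      exact (((hi a c).mul (hi b d)).mul (hzc a b)).mul (hzc c d)
    exact h1.congr fun p hp => hFe e he p hp
  rw [← hFe e he p hp]
  exact le_ciSup (isCompact_range hc).bddAbove (e.symm p)

theorem supNorm_nonneg : 0 ≤ supNorm ρ z :=
  Real.iSup_nonneg fun _ => tensorNorm_nonneg

theorem solution_le [CompactSpace M] [Nonempty M] (hρ : HasScalarCurvature ρ (-1)) (hz : IsTT ρ z)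
    (hu : IsSolution ρ z u) (x : M) : u x ≤ 1 + 2 * supNorm ρ z := by
  obtain ⟨x₀, hx₀⟩ := exists_forall_le_of_charts (F := u) fun e he =>
    (contDiffOn_comp_symm hu.smooth he).continuousOn
  set e := chartAt Plane x₀
  have he : e ∈ charts M := chartAt_mem_charts x₀
  have hx : x₀ ∈ e.source := mem_chart_source Plane x₀
  have h1 := (isLocalSolution hρ hz hu he).le_of_isLocalMax (e.map_source hx)
    (isLocalMax_comp_symm hx₀ hx)
  have h2 := tensorNorm_le_supNorm hz he (e.map_source hx)
  simp only [Function.comp, e.left_inv hx] at h1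
  linarith [hx₀ x]

theorem one_le_solution [CompactSpace M] [Nonempty M] (hρ : HasScalarCurvature ρ (-1))
    (hz : IsTT ρ z) (hu : IsSolution ρ z u) (x : M) : 1 ≤ u x := by
  obtain ⟨x₀, hx₀⟩ := exists_forall_le_of_charts (F := fun x => - u x) fun e he =>
    (contDiffOn_comp_symm hu.smooth he).continuousOn.neg
  set e := chartAt Plane x₀
  have he : e ∈ charts M := chartAt_mem_charts x₀
  have hx : x₀ ∈ e.source := mem_chart_source Plane x₀
  have h0 := (isLocalMax_comp_symm hx₀ hx).neg
  simp only [neg_neg] at h0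
  have h1 := (isLocalSolution hρ hz hu he).one_le_of_isLocalMin (e.map_source hx) h0
  simp only [Function.comp, e.left_inv hx] at h1
  linarith [hx₀ x]

theorem gradSq_change_chart (hu : ContMDiff (𝓡 2) 𝓘(ℝ) ∞ u) {e' : OpenPartialHomeomorph M Plane}
    (he : e ∈ charts M) (he' : e' ∈ charts M) (hp : p ∈ e'.target) (hpe : e'.symm p ∈ e.source) :
    gradSq (comps ρ.inner e') (u ∘ e'.symm) p
      = gradSq (comps ρ.inner e) (u ∘ e.symm) (e (e'.symm p)) := by
  have hopen : IsOpen (e'.target ∩ e'.symm ⁻¹' e.source) :=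
    e'.symm.isOpen_inter_preimage e.open_source
  have hmem : p ∈ e'.target ∩ e'.symm ⁻¹' e.source := ⟨hp, hpe⟩
  have h1 : (u ∘ e'.symm) =ᶠ[nhds p] (u ∘ e.symm) ∘ (e ∘ e'.symm) := by
    filter_upwards [hopen.mem_nhds hmem] with q hq
    simp [e.left_inv hq.2]
  have h2 : gradSq (comps ρ.inner e') (u ∘ e'.symm) p
      = gradSq (comps ρ.inner e') ((u ∘ e.symm) ∘ (e ∘ e'.symm)) p := by
    unfold gradSq
    simp only [Fin.sum_univ_two, pd_congr h1]
  rw [h2]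
  exact gradSq_change (τ := e ∘ e'.symm) (isMetricOn_comps he) (isMetricOn_comps he')
    (e.map_source hpe) hp
    (((contDiffOn_transition he he').contDiffAt (hopen.mem_nhds hmem)).differentiableAt (by simp))
    (diffAt_of_contDiffOn (contDiffOn_comp_symm hu he) e.open_target (e.map_source hpe))
    (comps_change ρ.inner he he' hp hpe)

/-- The gradient bound for solutions. -/
theorem gradSq_le [CompactSpace M] [Nonempty M] (hρ : HasScalarCurvature ρ (-1))
    (hz : IsTT ρ z) (hu : IsSolution ρ z u) (he : e ∈ charts M) (hp : p ∈ e.target) :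
    gradSq (comps ρ.inner e) (u ∘ e.symm) p ≤ (3 * (1 + supNorm ρ z)) ^ 2 := by
  set Zs := supNorm ρ z
  have hZs : 0 ≤ Zs := supNorm_nonneg
  set A := 2 + 2 * Zs with hA
  set E : M → ℝ := fun x => gradSq (comps ρ.inner (chartAt Plane x)) (u ∘ (chartAt Plane x).symm)
    (chartAt Plane x x) - 2 * (A * u x) with hE
  have hEe : ∀ e ∈ charts M, ∀ p ∈ e.target, E (e.symm p)
      = gradSq (comps ρ.inner e) (u ∘ e.symm) p - 2 * (A * (u ∘ e.symm) p) := by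
    intro e he p hp
    rw [gradSq_change_chart hu.smooth (chartAt_mem_charts (e.symm p)) he hp (mem_chart_source _ _)]
    rfl
  have hEs : ∀ e ∈ charts M, ContDiffOn ℝ ∞
      (fun p => gradSq (comps ρ.inner e) (u ∘ e.symm) p - 2 * (A * (u ∘ e.symm) p)) e.target :=
    fun e he => ((isMetricOn_comps he).contDiffOn_gradSq (contDiffOn_comp_symm hu.smooth he)).sub
      (contDiffOn_const.mul (contDiffOn_const.mul (contDiffOn_comp_symm hu.smooth he)))
  obtain ⟨x₀, hx₀⟩ := exists_forall_le_of_charts (F := E) fun e he =>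
    (hEs e he).continuousOn.congr fun p hp => hEe e he p hp
  have hle : E x₀ ≤ 0 := by
    set c := chartAt Plane x₀
    have hc : c ∈ charts M := chartAt_mem_charts x₀
    have hx : x₀ ∈ c.source := mem_chart_source Plane x₀
    have hq := c.map_source hx
    have hsol := isLocalSolution hρ hz hu hc
    have hmax := isLocalMax_comp_symm hx₀ hx
    have hux := solution_le hρ hz hu x₀
    have hcrit : ∀ k, pd k (gradSq (comps ρ.inner c) (u ∘ c.symm)) (c x₀)
        = 2 * (A * pd k (u ∘ c.symm) (c x₀)) := by
      intro k
      have h1 := pd_eq_zero_of_isLocalMax hmax k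
      rw [pd_congr_on c.open_target (fun p hp => hEe c hc p hp) hq] at h1
      have hd := diffAt_of_contDiffOn hsol.smooth hsol.isOpen hq
      rw [pd_sub (diffAt_of_contDiffOn (hsol.metric.contDiffOn_gradSq hsol.smooth) hsol.isOpen hq)
        ((hd.const_mul _).const_mul _), pd_const_mul (hd.const_mul _), pd_const_mul hd] at h1
      linarith
    have h2 := hsol.gradSq_nonpos hq (A := A) (by
      have := tensorNorm_le_supNorm hz hc hq
      simp only [Function.comp, c.left_inv hx]
      rw [hA]; linarith) hcrit
    have h3 := one_le_solution hρ hz hu x₀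
    have h4 : E x₀ = gradSq (comps ρ.inner c) (u ∘ c.symm) (c x₀) - 2 * (A * u x₀) := rfl
    rw [h4]
    have : 0 ≤ A * u x₀ := by positivity
    linarith
  have h5 := hx₀ (e.symm p)
  rw [hEe e he p hp] at h5
  have h6 := solution_le hρ hz hu (e.symm p)
  simp only [Function.comp] at h5
  have h7 : A * u (e.symm p) ≤ A * (1 + 2 * Zs) :=
    mul_le_mul_of_nonneg_left h6 (by positivity)
  rw [hA] at h5 h7
  have h8 : gradSq (comps ρ.inner e) (u ∘ e.symm) p ≤ 2 * ((2 + 2 * Zs) * (1 + 2 * Zs)) := by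
    linarith!
  nlinarith

end Global

/-! ### The sinh-Gordon equation in natural coordinates -/

section SinhGordon

variable {U : Set Plane} {G : Plane → Matrix (Fin 2) (Fin 2) ℝ} {v : Plane → ℝ} {p : Plane}

theorem pd_cosh_comp (hv : DifferentiableAt ℝ v p) (c : ℝ) (i : Fin 2) :
    pd i (fun q => Real.cosh (v q) + c) p = Real.sinh (v p) * pd i v p :=
  pd_comp (φ := fun x => Real.cosh x + c) ((Real.hasDerivAt_cosh _).add_const c) hv i

/-- If the metric is diagonal with coefficients `cosh v ± 1`, then scalar curvature `-1` means
that `v` solves the sinh-Gordon equation. -/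
theorem laplace_eq_sinh (hG : IsMetricOn U G) (hR : ∀ q ∈ U, scalarCurv G q = -1)
    (hv : ContDiffOn ℝ ∞ v U) (hvpos : ∀ q ∈ U, 0 < v q)
    (h00 : ∀ q ∈ U, G q 0 0 = Real.cosh (v q) + 1) (h01 : ∀ q ∈ U, G q 0 1 = 0)
    (h11 : ∀ q ∈ U, G q 1 1 = Real.cosh (v q) + (-1)) (hp : p ∈ U) :
    pd 0 (pd 0 v) p + pd 1 (pd 1 v) p = Real.sinh (v p) := by
  have hU := hG.isOpen
  have hdv : ∀ q ∈ U, DifferentiableAt ℝ v q := fun q hq => diffAt_of_contDiffOn hv hU hq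
  have hcosh : ∀ q ∈ U, 1 < Real.cosh (v q) := fun q hq =>
    Real.one_lt_cosh.2 (hvpos q hq).ne'
  have p00 : ∀ q ∈ U, ∀ i, pd i (fun q => G q 0 0) q = Real.sinh (v q) * pd i v q :=
    fun q hq i => by rw [pd_congr_on hU h00 hq, pd_cosh_comp (hdv q hq)]
  have p11 : ∀ q ∈ U, ∀ i, pd i (fun q => G q 1 1) q = Real.sinh (v q) * pd i v q :=
    fun q hq i => by rw [pd_congr_on hU h11 hq, pd_cosh_comp (hdv q hq)]
  have p01 : ∀ q ∈ U, ∀ i, pd i (fun q => G q 0 1) q = 0 :=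
    fun q hq i => by rw [pd_congr_on hU h01 hq, pd_const]
  have p10 : ∀ q ∈ U, ∀ i, pd i (fun q => G q 1 0) q = 0 :=
    fun q hq i => by rw [hG.pd_symm hq, p01 q hq]
  have i00 : ∀ q ∈ U, (G q)⁻¹ 0 0 = (Real.cosh (v q) + 1)⁻¹ ∧ (G q)⁻¹ 0 1 = 0 ∧
      (G q)⁻¹ 1 0 = 0 ∧ (G q)⁻¹ 1 1 = (Real.cosh (v q) - 1)⁻¹ := by
    intro q hq
    obtain ⟨a1, a2, a3, a4⟩ := hG.inv_apply hq
    have hc := hcosh q hq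
    have e1 : Real.cosh (v q) + 1 ≠ 0 := by linarith
    have e2 : Real.cosh (v q) - 1 ≠ 0 := by linarith
    rw [a1, a2, a3, a4, h00 q hq, h01 q hq, h11 q hq, ← sub_eq_add_neg]
    refine ⟨?_, by simp, by simp, ?_⟩
    · rw [mul_zero, sub_zero]; field_simp
    · rw [mul_zero, sub_zero]; field_simp
  set R : ℝ → ℝ := fun x => Real.sinh x / (Real.cosh x + 1) with hRdef
  set T : ℝ → ℝ := fun x => Real.sinh x / (Real.cosh x - 1) with hTdef
  have g000 : christoffel G 0 0 0 p = R (v p) / 2 * pd 0 v p := by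
    unfold christoffel
    obtain ⟨a1, a2, a3, a4⟩ := i00 p hp
    simp only [Fin.sum_univ_two, a1, a2, p00 p hp, hRdef]; ring
  have g001 : christoffel G 0 0 1 p = R (v p) / 2 * pd 1 v p := by
    unfold christoffel
    obtain ⟨a1, a2, a3, a4⟩ := i00 p hp
    simp only [Fin.sum_univ_two, a1, a2, p00 p hp, p01 p hp, p10 p hp, hRdef]; ring
  have g100 : ∀ q ∈ U, christoffel G 1 0 0 q = (- (1 / 2)) * (T (v q) * pd 1 v q) := by
    intro q hq
    unfold christoffel
    obtain ⟨a1, a2, a3, a4⟩ := i00 q hq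
    simp only [Fin.sum_univ_two, a3, a4, p00 q hq, p01 q hq, hTdef]; ring
  have g101 : ∀ q ∈ U, christoffel G 1 0 1 q = 1 / 2 * (T (v q) * pd 0 v q) := by
    intro q hq
    unfold christoffel
    obtain ⟨a1, a2, a3, a4⟩ := i00 q hq
    simp only [Fin.sum_univ_two, a3, a4, p11 q hq, p01 q hq, hTdef]; ring
  have g111 : christoffel G 1 1 1 p = T (v p) / 2 * pd 1 v p := by
    unfold christoffel
    obtain ⟨a1, a2, a3, a4⟩ := i00 p hp
    simp only [Fin.sum_univ_two, a3, a4, p11 p hp, hTdef]; ring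
  have hc := hcosh p hp
  have e1 : Real.cosh (v p) + 1 ≠ 0 := by linarith
  have e2 : Real.cosh (v p) - 1 ≠ 0 := by linarith
  have hsq := Real.cosh_sq (v p)
  have hT' : HasDerivAt T (-(Real.cosh (v p) - 1)⁻¹) (v p) := by
    have h := (Real.hasDerivAt_sinh (v p)).fun_div ((Real.hasDerivAt_cosh (v p)).sub_const 1) e2
    refine h.congr_deriv ?_
    field_simp
    linear_combination hsq
  have hddv := fun i => diffAt_of_contDiffOn (contDiffOn_pd hv hU i) hU hp
  have hdT : DifferentiableAt ℝ (fun q => T (v q)) p :=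
    DifferentiableAt.comp p hT'.differentiableAt (hdv p hp)
  have hpT : ∀ i, pd i (fun q => T (v q)) p = -(Real.cosh (v p) - 1)⁻¹ * pd i v p :=
    fun i => pd_comp hT' (hdv p hp) i
  have hriem := (hG.riem_eq hp (hR p hp)).2.1
  unfold riem at hriem
  rw [pd_congr_on hU g101 hp, pd_congr_on hU g100 hp,
    pd_const_mul (hdT.fun_mul (hddv 0)), pd_const_mul (hdT.fun_mul (hddv 1)),
    pd_mul hdT (hddv 0), pd_mul hdT (hddv 1), hpT, hpT] at hriem
  simp only [Fin.sum_univ_two, hG.christoffel_symm hp 1 1 0, g100 p hp, g101 p hp, g111, g000,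
    g001, h00 p hp] at hriem
  have hTR : T (v p) * R (v p) = 1 := by
    simp only [hTdef, hRdef]
    field_simp
    linear_combination -hsq
  have hTT : T (v p) * T (v p) * (Real.cosh (v p) - 1) = Real.cosh (v p) + 1 := by
    simp only [hTdef]
    field_simp
    linear_combination -hsq
  have hS : 0 < Real.sinh (v p) := Real.sinh_pos_iff.2 (hvpos p hp)
  have hTs : T (v p) * (Real.cosh (v p) - 1) = Real.sinh (v p) := by
    simp only [hTdef]; field_simp
  have hinv : (Real.cosh (v p) - 1)⁻¹ * (Real.cosh (v p) - 1) = 1 := inv_mul_cancel₀ e2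
  generalize (Real.cosh (v p) - 1)⁻¹ = k at *
  have key : Real.sinh (v p) * (pd 0 (pd 0 v) p + pd 1 (pd 1 v) p)
      = Real.sinh (v p) * Real.sinh (v p) := by
    linear_combination 2 * (Real.cosh (v p) - 1) * hriem
      + (pd 0 v p ^ 2 + pd 1 v p ^ 2) * (hinv + (Real.cosh (v p) - 1) / 2 * hTR - hTT / 2)
      + hsq - (pd 0 (pd 0 v) p + pd 1 (pd 1 v) p) * hTs
  exact mul_left_cancel₀ hS.ne' key

theorem sq_sum_of_eigenvector {x y r t w μ : ℝ} (hxy : x ^ 2 + y ^ 2 ≠ 0)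
    (h1 : x * r + y * t = μ * x) (h2 : x * t + y * w = μ * y) :
    r ^ 2 + 2 * t ^ 2 + w ^ 2 = μ ^ 2 + (r + w - μ) ^ 2 := by
  have hd : (r - μ) * (w - μ) - t * t = 0 := by
    have e1 : x * ((r - μ) * (w - μ) - t * t) = 0 := by
      linear_combination (w - μ) * h1 - t * h2
    have e2 : y * ((r - μ) * (w - μ) - t * t) = 0 := by
      linear_combination (r - μ) * h2 - t * h1
    apply mul_left_cancel₀ hxy
    linear_combination x * e1 + y * e2
  linear_combination -2 * hd

/-- The gradient estimate for the sinh-Gordon equation at a maximum of `|∇v|² / sinh⁵ v`. -/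
theorem sinhGordon_gradient_bound (hU : IsOpen U) (hv : ContDiffOn ℝ ∞ v U)
    (hvpos : ∀ q ∈ U, 0 < v q)
    (heq : ∀ q ∈ U, pd 0 (pd 0 v) q + pd 1 (pd 1 v) q = Real.sinh (v q)) (hp : p ∈ U)
    (hmax : IsLocalMax (fun q => (pd 0 v q ^ 2 + pd 1 v q ^ 2) * (Real.sinh (v q) ^ 5)⁻¹) p) :
    5 * (pd 0 v p ^ 2 + pd 1 v p ^ 2) ≤ 13 * (Real.cosh (v p) * Real.sinh (v p) ^ 2) := by
  have hS : ∀ q ∈ U, 0 < Real.sinh (v q) := fun q hq => Real.sinh_pos_iff.2 (hvpos q hq)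
  have hC : ∀ q, 0 < Real.cosh (v q) := fun q => Real.cosh_pos _
  by_cases hN0 : pd 0 v p ^ 2 + pd 1 v p ^ 2 = 0
  · rw [hN0]
    have := hS p hp; have := hC p
    simp only [mul_zero]; positivity
  set φ : ℝ → ℝ := fun x => (Real.sinh x ^ 5)⁻¹ with hφ
  set φ' : ℝ → ℝ := fun x => -5 * (Real.cosh x * (Real.sinh x ^ 6)⁻¹) with hφ'
  set N : Plane → ℝ := fun q => pd 0 v q * pd 0 v q + pd 1 v q * pd 1 v q with hN
  have d1 := fun i => contDiffOn_pd hv hU i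
  have d2 := fun i j => contDiffOn_pd (d1 j) hU i
  have hφd : ∀ x, 0 < Real.sinh x → HasDerivAt φ (φ' x) x := by
    intro x hx
    have h := ((Real.hasDerivAt_sinh x).fun_pow 5).fun_inv (by positivity)
    refine h.congr_deriv ?_
    have hx' := hx.ne'
    simp only [hφ']
    push_cast
    field_simp
  have hφ'd : ∀ x, 0 < Real.sinh x → HasDerivAt φ'
      (30 * (Real.cosh x ^ 2 * (Real.sinh x ^ 7)⁻¹) - 5 * (Real.sinh x ^ 5)⁻¹) x := by
    intro x hx
    have h := ((Real.hasDerivAt_cosh x).fun_mul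
      (((Real.hasDerivAt_sinh x).fun_pow 6).fun_inv (by positivity))).const_mul (-5)
    refine h.congr_deriv ?_
    have hx' := hx.ne'
    push_cast
    field_simp
    ring
  have hNs : ContDiffOn ℝ ∞ N U := ((d1 0).mul (d1 0)).add ((d1 1).mul (d1 1))
  have hφs : ContDiffOn ℝ ∞ (fun q => φ (v q)) U := by
    have h1 : ContDiffOn ℝ ∞ (fun q => Real.sinh (v q) ^ 5) U :=
      (Real.contDiff_sinh.comp_contDiffOn hv).pow 5
    exact h1.inv fun q hq => by have := hS q hq; positivity
  have hφ's : ContDiffOn ℝ ∞ (fun q => φ' (v q)) U := by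
    have h1 : ContDiffOn ℝ ∞ (fun q => Real.sinh (v q) ^ 6) U :=
      (Real.contDiff_sinh.comp_contDiffOn hv).pow 6
    exact contDiffOn_const.mul ((Real.contDiff_cosh.comp_contDiffOn hv).mul
      (h1.inv fun q hq => by have := hS q hq; positivity))
  have dif : ∀ {g : Plane → ℝ}, ContDiffOn ℝ ∞ g U → ∀ {q}, q ∈ U → DifferentiableAt ℝ g q :=
    fun hg _ hq => diffAt_of_contDiffOn hg hU hq
  have hQmax : IsLocalMax (fun q => N q * φ (v q)) p := by
    have : (fun q => (pd 0 v q ^ 2 + pd 1 v q ^ 2) * (Real.sinh (v q) ^ 5)⁻¹)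
        = fun q => N q * φ (v q) := by funext q; simp only [hN, hφ]; ring
    rwa [this] at hmax
  have hQs : ContDiffOn ℝ ∞ (fun q => N q * φ (v q)) U := hNs.mul hφs
  have pQ : ∀ i, ∀ q ∈ U, pd i (fun q => N q * φ (v q)) q
      = pd i N q * φ (v q) + N q * (φ' (v q) * pd i v q) := by
    intro i q hq
    rw [pd_mul (dif hNs hq) (dif hφs hq), pd_comp (hφd _ (hS q hq)) (dif hv hq)]
  have pN : ∀ i, ∀ q ∈ U, pd i N q
      = 2 * (pd 0 v q * pd i (pd 0 v) q + pd 1 v q * pd i (pd 1 v) q) := by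
    intro i q hq
    simp only [hN]
    rw [pd_add ((dif (d1 0) hq).fun_mul (dif (d1 0) hq)) ((dif (d1 1) hq).fun_mul (dif (d1 1) hq)),
      pd_mul (dif (d1 0) hq) (dif (d1 0) hq), pd_mul (dif (d1 1) hq) (dif (d1 1) hq)]
    ring
  have pNN : ∀ i, pd i (pd i N) p
      = 2 * ((pd i (pd 0 v) p * pd i (pd 0 v) p + pd 0 v p * pd i (pd i (pd 0 v)) p)
        + (pd i (pd 1 v) p * pd i (pd 1 v) p + pd 1 v p * pd i (pd i (pd 1 v)) p)) := by
    intro i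
    have m := fun j => (dif (d1 j) hp).fun_mul (dif (d2 i j) hp)
    rw [pd_congr_on hU (pN i) hp, pd_const_mul ((m 0).fun_add (m 1)), pd_add (m 0) (m 1),
      pd_mul (dif (d1 0) hp) (dif (d2 i 0) hp), pd_mul (dif (d1 1) hp) (dif (d2 i 1) hp)]
  have pQQ : ∀ i, pd i (pd i (fun q => N q * φ (v q))) p
      = (pd i (pd i N) p * φ (v p) + pd i N p * (φ' (v p) * pd i v p))
        + (pd i N p * (φ' (v p) * pd i v p) + N p *
          (((30 * (Real.cosh (v p) ^ 2 * (Real.sinh (v p) ^ 7)⁻¹) - 5 * (Real.sinh (v p) ^ 5)⁻¹)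
            * pd i v p) * pd i v p + φ' (v p) * pd i (pd i v) p)) := by
    intro i
    have m1 := dif (contDiffOn_pd hNs hU i) hp
    have m2 := (dif hφ's hp).fun_mul (dif (d1 i) hp)
    rw [pd_congr_on hU (pQ i) hp, pd_add (m1.fun_mul (dif hφs hp)) ((dif hNs hp).fun_mul m2),
      pd_mul m1 (dif hφs hp), pd_mul (dif hNs hp) m2, pd_mul (dif hφ's hp) (dif (d1 i) hp),
      pd_comp (hφd _ (hS p hp)) (dif hv hp), pd_comp (hφ'd _ (hS p hp)) (dif hv hp)]
  -- third derivatives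
  have h3 : ∀ i, pd 0 (pd 0 (pd i v)) p + pd 1 (pd 1 (pd i v)) p
      = Real.cosh (v p) * pd i v p := by
    intro i
    have h := pd_congr_on hU heq hp i
    rw [pd_add (dif (d2 0 0) hp) (dif (d2 1 1) hp),
      pd_comp (φ := Real.sinh) (Real.hasDerivAt_sinh _) (dif hv hp)] at h
    have s1 : ∀ j, pd i (pd j (pd j v)) p = pd j (pd j (pd i v)) p := by
      intro j
      rw [pd_comm (d1 j) hU hp i j]
      exact pd_congr_on hU (fun q hq => pd_comm hv hU hq i j) hp j
    rw [s1, s1] at h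
    exact h
  have hc0 := pd_eq_zero_of_isLocalMax hQmax 0
  have hc1 := pd_eq_zero_of_isLocalMax hQmax 1
  have hL0 := sum_pd_pd_nonpos_of_isLocalMax hQs hU hp hQmax (!₂[1, 0])
  have hL1 := sum_pd_pd_nonpos_of_isLocalMax hQs hU hp hQmax (!₂[0, 1])
  simp at hL0 hL1
  rw [pQ 0 p hp, pN 0 p hp] at hc0
  rw [pQ 1 p hp, pN 1 p hp] at hc1
  rw [pQQ, pNN, pN 0 p hp] at hL0
  rw [pQQ, pNN, pN 1 p hp] at hL1
  have h30 := h3 0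
  have h31 := h3 1
  have hsym := pd_comm hv hU hp 1 0
  have heqp := heq p hp
  have hSp := hS p hp
  have hcs := Real.cosh_sq (v p)
  rw [hsym] at hc1 hL1
  simp only [hφ, hφ', hN] at hc0 hc1 hL0 hL1
  generalize pd 0 (pd 0 (pd 0 v)) p = A0 at *
  generalize pd 1 (pd 1 (pd 0 v)) p = A1 at *
  generalize pd 0 (pd 0 (pd 1 v)) p = B0 at *
  generalize pd 1 (pd 1 (pd 1 v)) p = B1 at *
  generalize pd 0 (pd 0 v) p = r at *
  generalize pd 0 (pd 1 v) p = t at *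
  generalize pd 1 (pd 1 v) p = w at *
  generalize pd 0 v p = x at *
  generalize pd 1 v p = y at *
  generalize Real.sinh (v p) = S at *
  generalize Real.cosh (v p) = C at *
  have hSne : S ≠ 0 := hSp.ne'
  have k0 : x * r + y * t = (5 / 2 * (C / S) * (x ^ 2 + y ^ 2)) * x := by
    field_simp at hc0 ⊢
    linear_combination hc0
  have k1 : x * t + y * w = (5 / 2 * (C / S) * (x ^ 2 + y ^ 2)) * y := by
    field_simp at hc1 ⊢
    linear_combination hc1
  have hq := sq_sum_of_eigenvector hN0 k0 k1
  rw [heqp] at hq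
  set n := x ^ 2 + y ^ 2 with hn
  have hsum : 5 * n ^ 2 - 13 * C * n * S ^ 2 + 2 * S ^ 4 ≤ 0 := by
    have e := mul_nonpos_of_nonneg_of_nonpos (by positivity : 0 ≤ S ^ 7) (add_nonpos hL0 hL1)
    refine le_of_eq_of_le ?_ e
    have hS7 : S ^ 7 * (S ^ 5)⁻¹ = S ^ 2 := by field_simp
    have hS6 : S ^ 7 * (S ^ 6)⁻¹ = S := by field_simp
    have hS1 : S ^ 7 * (S ^ 7)⁻¹ = 1 := by field_simp
    have hCS : C / S * S = C := by field_simp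
    generalize C / S = c at *
    subst hCS
    simp only [← sq, ← hn] at hL0 hL1 ⊢
    linear_combination
      -(2 * (r ^ 2 + t ^ 2 + x * (A0 + A1) + (t ^ 2 + w ^ 2) + y * (B0 + B1)) - 5 * n * n) * hS7
      - (-5 * (c * S) * (4 * (x * (x * r + y * t) + y * (x * t + y * w)) + n * (r + w))) * hS6
      - 30 * (c * S) ^ 2 * n * n * hS1 - 2 * S ^ 2 * hq - 2 * S ^ 2 * (x * h30 + y * h31)
      + 20 * c * S ^ 2 * (x * k0 + y * k1) + 5 * c * S ^ 2 * n * heqp - 5 * n ^ 2 * hcs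
  have hn0 : 0 < n := lt_of_le_of_ne (by positivity) (Ne.symm hN0)
  have : n * (5 * n - 13 * (C * S ^ 2)) ≤ 0 := by nlinarith [sq_nonneg (S ^ 2)]
  nlinarith [(mul_nonpos_iff_pos_imp_nonpos.1 this).1 hn0]

end SinhGordon

/-! ### Natural frames -/

section NaturalFrame

/-- A symmetric matrix of rank one is the square of one of its normalized rows. -/
theorem rank_one_factor {N : Matrix (Fin 2) (Fin 2) ℝ} (hs : N 1 0 = N 0 1)
    (hdet : N 0 0 * N 1 1 - N 0 1 * N 0 1 = 0) {i : Fin 2} (hi : 0 < N i i) (k l : Fin 2) :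
    N i k / √(N i i) * (N i l / √(N i i)) = N k l := by
  have h1 : √(N i i) * √(N i i) = N i i := Real.mul_self_sqrt hi.le
  have h2 : √(N i i) ≠ 0 := (Real.sqrt_pos.2 hi).ne'
  rw [div_mul_div_comm, h1, div_eq_iff hi.ne']
  fin_cases i <;> fin_cases k <;> fin_cases l <;> simp [hs] <;>
    first | ring1 | linear_combination -hdet

theorem exists_diag_pos {a b c : ℝ} {N : Matrix (Fin 2) (Fin 2) ℝ} (ha : 0 < a)
    (hd : 0 < a * c - b * b) (hdet : N 0 0 * N 1 1 - N 0 1 * N 0 1 = 0)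
    (htr : 0 < c * N 0 0 - 2 * (b * N 0 1) + a * N 1 1) : ∃ i, 0 < N i i := by
  have h0 : 0 ≤ N 0 0 := coeff_nonneg_of_trace_of_det ha hd htr.le hdet.ge
  rcases h0.lt_or_eq with h | h
  · exact ⟨0, h⟩
  · refine ⟨1, ?_⟩
    have h01 : N 0 1 = 0 := by
      rw [← h] at hdet
      exact mul_self_eq_zero.1 (by linarith)
    rw [h01, ← h] at htr
    have : 0 < a * N 1 1 := by linarith
    exact (mul_pos_iff_of_pos_left ha).1 this

/-- Coordinate coframe `a`, `c` and function `v` with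
`G = (cosh v + 1) a² + (cosh v - 1) c²`, `b = (sinh v / 2) (a² + c²)` and `B = coth v`. -/
structure IsNaturalFrame (W : Set Plane) (G b : Plane → Matrix (Fin 2) (Fin 2) ℝ) (B : Plane → ℝ)
    (a c : Fin 2 → Plane → ℝ) (v : Plane → ℝ) : Prop where
  smooth_fst : ∀ i, ContDiffOn ℝ ∞ (a i) W
  smooth_snd : ∀ i, ContDiffOn ℝ ∞ (c i) W
  smooth : ContDiffOn ℝ ∞ v W
  pos : ∀ q ∈ W, 0 < v q
  coth : ∀ q ∈ W, B q = Real.cosh (v q) / Real.sinh (v q)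
  metric : ∀ q ∈ W, ∀ i j, G q i j =
    (Real.cosh (v q) + 1) * (a i q * a j q) + (Real.cosh (v q) - 1) * (c i q * c j q)
  tensor : ∀ q ∈ W, ∀ i j, b q i j = Real.sinh (v q) / 2 * (a i q * a j q + c i q * c j q)

variable {U : Set Plane} {G Z : Plane → Matrix (Fin 2) (Fin 2) ℝ} {f : Plane → ℝ} {p : Plane}

theorem IsLocalSolution.exists_isNaturalFrame (h : IsLocalSolution U G Z f) (hp : p ∈ U)
    (hB : 1 < nonlinearTerm G Z f p) :
    ∃ r > 0, Metric.ball p r ⊆ U ∧ ∃ a c v, IsNaturalFrame (Metric.ball p r) G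
      (codazziTensor G Z f) (nonlinearTerm G Z f) a c v := by
  have hU := h.isOpen
  set B := nonlinearTerm G Z f with hBdef
  set b := codazziTensor G Z f with hbdef
  have hBs : ContDiffOn ℝ ∞ B U := h.contDiffOn_nonlinearTerm
  set U₁ := {q ∈ U | 1 < B q} with hU₁
  have hU₁o : IsOpen U₁ := by
    have := hBs.continuousOn.isOpen_inter_preimage hU isOpen_Ioi (t := Set.Ioi 1)
    exact this
  set σ : Plane → ℝ := fun q => √(B q ^ 2 - 1) with hσ
  have hσpos : ∀ q ∈ U₁, 0 < B q ^ 2 - 1 := fun q hq => by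
    have := hq.2; nlinarith
  have hσ0 : ∀ q ∈ U₁, 0 < σ q := fun q hq => Real.sqrt_pos.2 (hσpos q hq)
  have hσ2 : ∀ q ∈ U₁, σ q * σ q = B q ^ 2 - 1 := fun q hq => Real.mul_self_sqrt (hσpos q hq).le
  have hBs1 : ContDiffOn ℝ ∞ B U₁ := hBs.mono fun q hq => hq.1
  have hσs : ContDiffOn ℝ ∞ σ U₁ :=
    ((hBs1.pow 2).sub contDiffOn_const).sqrt fun q hq => (hσpos q hq).ne'
  have hσB : ∀ q ∈ U₁, σ q < B q := fun q hq => by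
    have := hσ2 q hq; have := hq.2
    nlinarith [hσ0 q hq]
  set N : Plane → Matrix (Fin 2) (Fin 2) ℝ := fun q =>
    Matrix.of fun i j => 1 / 2 * G q i j - (B q - σ q) * b q i j with hN
  set L : Plane → Matrix (Fin 2) (Fin 2) ℝ := fun q =>
    Matrix.of fun i j => (B q + σ q) * b q i j - 1 / 2 * G q i j with hL
  have hGs := fun i j => (h.metric.smooth i j).mono (fun q (hq : q ∈ U₁) => hq.1)
  have hbs := fun i j => (h.contDiffOn_codazziTensor i j).mono (fun q (hq : q ∈ U₁) => hq.1)
  have hNs : ∀ i j, ContDiffOn ℝ ∞ (fun q => N q i j) U₁ := fun i j =>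
    (contDiffOn_const.mul (hGs i j)).sub ((hBs1.sub hσs).mul (hbs i j))
  have hLs : ∀ i j, ContDiffOn ℝ ∞ (fun q => L q i j) U₁ := fun i j =>
    ((hBs1.add hσs).mul (hbs i j)).sub (contDiffOn_const.mul (hGs i j))
  have hNsym : ∀ q ∈ U₁, N q 1 0 = N q 0 1 := fun q hq => by
    simp only [hN, Matrix.of_apply]
    rw [h.metric.symm q hq.1 1 0, hbdef, h.codazziTensor_symm hq.1 1 0]
  have hLsym : ∀ q ∈ U₁, L q 1 0 = L q 0 1 := fun q hq => by
    simp only [hL, Matrix.of_apply]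
    rw [h.metric.symm q hq.1 1 0, hbdef, h.codazziTensor_symm hq.1 1 0]
  have hNdet : ∀ q ∈ U₁, N q 0 0 * N q 1 1 - N q 0 1 * N q 0 1 = 0 := fun q hq => by
    have h1 := h.trace_codazziTensor hq.1
    have h2 := h.det_codazziTensor hq.1
    have h3 := hσ2 q hq
    simp only [hN, Matrix.of_apply]
    linear_combination -(1 / 2) * (B q - σ q) * h1 + (B q - σ q) ^ 2 * h2
      + (G q 0 0 * G q 1 1 - G q 0 1 * G q 0 1) / 4 * h3
  have hLdet : ∀ q ∈ U₁, L q 0 0 * L q 1 1 - L q 0 1 * L q 0 1 = 0 := fun q hq => by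
    have h1 := h.trace_codazziTensor hq.1
    have h2 := h.det_codazziTensor hq.1
    have h3 := hσ2 q hq
    simp only [hL, Matrix.of_apply]
    linear_combination -(1 / 2) * (B q + σ q) * h1 + (B q + σ q) ^ 2 * h2
      + (G q 0 0 * G q 1 1 - G q 0 1 * G q 0 1) / 4 * h3
  have hp1 : p ∈ U₁ := ⟨hp, hB⟩
  have hd := h.metric.det_pos p hp
  obtain ⟨i, hi⟩ := exists_diag_pos (h.metric.pos p hp) hd (hNdet p hp1) (by
    have e : G p 1 1 * N p 0 0 - 2 * (G p 0 1 * N p 0 1) + G p 0 0 * N p 1 1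
        = σ p * (B p - σ p) * (G p 0 0 * G p 1 1 - G p 0 1 * G p 0 1) := by
      have h1 := h.trace_codazziTensor hp
      have h3 := hσ2 p hp1
      simp only [hN, Matrix.of_apply]
      linear_combination -(B p - σ p) * h1 - (G p 0 0 * G p 1 1 - G p 0 1 * G p 0 1) * h3
        + 2 * (G p 0 0 * G p 1 1 - G p 0 1 * G p 0 1) * h3
    rw [e]
    exact mul_pos (mul_pos (hσ0 p hp1) (sub_pos.2 (hσB p hp1))) hd)
  obtain ⟨j, hj⟩ := exists_diag_pos (h.metric.pos p hp) hd (hLdet p hp1) (by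
    have e : G p 1 1 * L p 0 0 - 2 * (G p 0 1 * L p 0 1) + G p 0 0 * L p 1 1
        = σ p * (B p + σ p) * (G p 0 0 * G p 1 1 - G p 0 1 * G p 0 1) := by
      have h1 := h.trace_codazziTensor hp
      have h3 := hσ2 p hp1
      simp only [hL, Matrix.of_apply]
      linear_combination (B p + σ p) * h1 - (G p 0 0 * G p 1 1 - G p 0 1 * G p 0 1) * h3
    rw [e]
    exact mul_pos (mul_pos (hσ0 p hp1) (add_pos (by linarith) (hσ0 p hp1))) hd)
  have hWo : IsOpen ((U₁ ∩ {q | 0 < N q i i}) ∩ (U₁ ∩ {q | 0 < L q j j})) :=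
    ((hNs i i).continuousOn.isOpen_inter_preimage hU₁o isOpen_Ioi (t := Set.Ioi 0)).inter
      ((hLs j j).continuousOn.isOpen_inter_preimage hU₁o isOpen_Ioi (t := Set.Ioi 0))
  obtain ⟨r, hr, hrW⟩ := Metric.isOpen_iff.1 hWo p ⟨⟨hp1, hi⟩, hp1, hj⟩
  have m1 : ∀ q ∈ Metric.ball p r, q ∈ U₁ := fun q hq => (hrW hq).1.1
  have mN : ∀ q ∈ Metric.ball p r, 0 < N q i i := fun q hq => (hrW hq).1.2
  have mL : ∀ q ∈ Metric.ball p r, 0 < L q j j := fun q hq => (hrW hq).2.2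
  refine ⟨r, hr, fun q hq => (m1 q hq).1, fun k q => N q i k / √(N q i i),
    fun k q => L q j k / √(L q j j), fun q => Real.arsinh (1 / σ q), ?_⟩
  have hsinh : ∀ q, Real.sinh (Real.arsinh (1 / σ q)) = 1 / σ q := fun q => Real.sinh_arsinh _
  have hcosh : ∀ q ∈ U₁, Real.cosh (Real.arsinh (1 / σ q)) = B q / σ q := fun q hq => by
    have h0 := hσ0 q hq
    have hBq : 0 < B q := by linarith [hq.2]
    rw [Real.cosh_arsinh, show 1 + (1 / σ q) ^ 2 = (B q / σ q) ^ 2 by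
      field_simp; linear_combination hσ2 q hq, Real.sqrt_sq (by positivity)]
  have hfac : ∀ q ∈ Metric.ball p r, ∀ k l, N q i k / √(N q i i) * (N q i l / √(N q i i)) = N q k l :=
    fun q hq k l => rank_one_factor (hNsym q (m1 q hq)) (hNdet q (m1 q hq)) (mN q hq) k l
  have hfacL : ∀ q ∈ Metric.ball p r, ∀ k l, L q j k / √(L q j j) * (L q j l / √(L q j j)) = L q k l :=
    fun q hq k l => rank_one_factor (hLsym q (m1 q hq)) (hLdet q (m1 q hq)) (mL q hq) k l
  refine ⟨fun k => ?_, fun k => ?_, ?_, ?_, ?_, ?_, ?_⟩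
  · exact ((hNs i k).mono m1).div (((hNs i i).mono m1).sqrt fun q hq => (mN q hq).ne')
      fun q hq => (Real.sqrt_pos.2 (mN q hq)).ne'
  · exact ((hLs j k).mono m1).div (((hLs j j).mono m1).sqrt fun q hq => (mL q hq).ne')
      fun q hq => (Real.sqrt_pos.2 (mL q hq)).ne'
  · exact Real.contDiff_arsinh.comp_contDiffOn
      (contDiffOn_const.div (hσs.mono m1) fun q hq => (hσ0 q (m1 q hq)).ne')
  · intro q hq
    exact Real.arsinh_pos_iff.2 (one_div_pos.2 (hσ0 q (m1 q hq)))
  · intro q hq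
    have h0 := hσ0 q (m1 q hq)
    rw [hsinh, hcosh q (m1 q hq)]
    field_simp
  · intro q hq k l
    have h0 := hσ0 q (m1 q hq)
    rw [hcosh q (m1 q hq), hfac q hq, hfacL q hq]
    simp only [hN, hL, Matrix.of_apply]
    field_simp
    ring
  · intro q hq k l
    have h0 := hσ0 q (m1 q hq)
    rw [hsinh, hfac q hq, hfacL q hq]
    simp only [hN, hL, Matrix.of_apply]
    field_simp
    ring

end NaturalFrame

/-! ### Natural coordinates -/

section NaturalCoordinates

/-- The algebra behind the closedness of the natural coframe: `A i k`, `C i k` are the covariant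
derivatives `a_{i;k}`, `c_{i;k}` of the coframe. -/
theorem natural_coframe_closed {a c φ σ : Fin 2 → ℝ} {A C : Fin 2 → Fin 2 → ℝ} {E F s : ℝ}
    (hs : s ≠ 0) (hD : a 0 * c 1 - a 1 * c 0 ≠ 0) (hEF : E = F + 2)
    (hs2 : 4 * (s * s) = E * F) (hσ : ∀ k, 8 * (s * σ k) = φ k * (E + F))
    (hmet : ∀ i j k, φ k * (a i * a j + c i * c j) + E * (A i k * a j + a i * A j k)
      + F * (C i k * c j + c i * C j k) = 0)
    (hcod : ∀ i, σ 1 * (a i * a 0 + c i * c 0)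
        + s * (A i 1 * a 0 + a i * A 0 1 + (C i 1 * c 0 + c i * C 0 1))
      = σ 0 * (a i * a 1 + c i * c 1)
        + s * (A i 0 * a 1 + a i * A 1 0 + (C i 0 * c 1 + c i * C 1 0))) :
    A 0 1 = A 1 0 ∧ C 0 1 = C 1 0 := by
  set D := a 0 * c 1 - a 1 * c 0 with hDdef
  have e1 : ∀ k, φ k * D + 2 * (E * (c 1 * A 0 k - c 0 * A 1 k)) = 0 := fun k => by
    apply mul_left_cancel₀ hD
    rw [hDdef]
    linear_combination c 1 * c 1 * hmet 0 0 k - 2 * (c 0 * c 1) * hmet 0 1 k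
      + c 0 * c 0 * hmet 1 1 k
  have e2 : ∀ k, φ k * D + 2 * (F * (a 0 * C 1 k - a 1 * C 0 k)) = 0 := fun k => by
    apply mul_left_cancel₀ hD
    rw [hDdef]
    linear_combination a 1 * a 1 * hmet 0 0 k - 2 * (a 0 * a 1) * hmet 0 1 k
      + a 0 * a 0 * hmet 1 1 k
  have e3 : ∀ k, E * (a 0 * A 1 k - a 1 * A 0 k) + F * (c 1 * C 0 k - c 0 * C 1 k) = 0 :=
    fun k => by
    apply mul_left_cancel₀ hD
    rw [hDdef]
    linear_combination -(a 1 * c 1) * hmet 0 0 k + (a 0 * c 1 + a 1 * c 0) * hmet 0 1 k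
      - a 0 * c 0 * hmet 1 1 k
  -- the Codazzi equation contracted with the dual frame
  have e4 : (a 0 * σ 1 - a 1 * σ 0) * D
        + 2 * (s * (a 0 * (c 1 * A 0 1 - c 0 * A 1 1) - a 1 * (c 1 * A 0 0 - c 0 * A 1 0)))
      = s * ((c 1 * (a 0 * A 1 0 - a 1 * A 0 0) - c 0 * (a 0 * A 1 1 - a 1 * A 0 1))
        + (c 1 * (c 1 * C 0 0 - c 0 * C 1 0) - c 0 * (c 1 * C 0 1 - c 0 * C 1 1))) := by
    apply mul_left_cancel₀ hD
    rw [hDdef]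
    linear_combination (a 0 * c 1 - a 1 * c 0) * (c 1 * hcod 0 - c 0 * hcod 1)
  have e5 : s * ((a 0 * (a 0 * A 1 1 - a 1 * A 0 1) - a 1 * (a 0 * A 1 0 - a 1 * A 0 0))
        + (a 0 * (c 1 * C 0 1 - c 0 * C 1 1) - a 1 * (c 1 * C 0 0 - c 0 * C 1 0)))
      = (c 1 * σ 0 - c 0 * σ 1) * D
        + 2 * (s * (c 1 * (a 0 * C 1 0 - a 1 * C 0 0) - c 0 * (a 0 * C 1 1 - a 1 * C 0 1))) := by
    apply mul_left_cancel₀ hD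
    rw [hDdef]
    linear_combination (a 0 * c 1 - a 1 * c 0) * (a 0 * hcod 1 - a 1 * hcod 0)
  have hAD : D * (A 0 1 - A 1 0) = (a 0 * (c 1 * A 0 1 - c 0 * A 1 1) - a 1 * (c 1 * A 0 0 - c 0 * A 1 0))
      - (c 1 * (a 0 * A 1 0 - a 1 * A 0 0) - c 0 * (a 0 * A 1 1 - a 1 * A 0 1)) := by
    rw [hDdef]; ring
  have hCD : D * (C 0 1 - C 1 0) = (a 0 * (c 1 * C 0 1 - c 0 * C 1 1) - a 1 * (c 1 * C 0 0 - c 0 * C 1 0))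
      - (c 1 * (a 0 * C 1 0 - a 1 * C 0 0) - c 0 * (a 0 * C 1 1 - a 1 * C 0 1)) := by
    rw [hDdef]; ring
  have e10 := e1 0
  have e11 := e1 1
  have e20 := e2 0
  have e21 := e2 1
  have e30 := e3 0
  have e31 := e3 1
  have s0 := hσ 0
  have s1 := hσ 1
  generalize c 1 * A 0 0 - c 0 * A 1 0 = X0 at *
  generalize c 1 * A 0 1 - c 0 * A 1 1 = X1 at *
  generalize a 0 * A 1 0 - a 1 * A 0 0 = Y0 at *
  generalize a 0 * A 1 1 - a 1 * A 0 1 = Y1 at *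
  generalize c 1 * C 0 0 - c 0 * C 1 0 = P0 at *
  generalize c 1 * C 0 1 - c 0 * C 1 1 = P1 at *
  generalize a 0 * C 1 0 - a 1 * C 0 0 = Q0 at *
  generalize a 0 * C 1 1 - a 1 * C 0 1 = Q1 at *
  subst hEF
  constructor
  · have h1 : 16 * (s * s) * (D * (A 0 1 - A 1 0)) = 0 := by
      linear_combination 16 * (s * s) * hAD - 8 * s * F * e4 - 8 * (s * s) * (c 1 * e30 - c 0 * e31)
        + F * D * (a 0 * s1 - a 1 * s0) + F * (F + 2 + F) * (a 0 * e11 - a 1 * e10)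
        + 2 * (F + 2 + F) * (a 0 * X1 - a 1 * X0) * hs2
    have h2 : A 0 1 - A 1 0 = 0 := by simpa [hs, hD] using h1
    linarith
  · have h1 : 16 * (s * s) * (D * (C 0 1 - C 1 0)) = 0 := by
      linear_combination 16 * (s * s) * hCD + 8 * s * (F + 2) * e5
        - 8 * (s * s) * (a 0 * e31 - a 1 * e30) + (F + 2) * D * (c 1 * s0 - c 0 * s1)
        + (F + 2) * (F + 2 + F) * (c 1 * e20 - c 0 * e21)
        + 2 * (F + 2 + F) * (c 1 * Q0 - c 0 * Q1) * hs2
    have h2 : C 0 1 - C 1 0 = 0 := by simpa [hs, hD] using h1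
    linarith

variable {U W : Set Plane} {G b : Plane → Matrix (Fin 2) (Fin 2) ℝ} {B : Plane → ℝ}
  {a c : Fin 2 → Plane → ℝ} {v : Plane → ℝ} {p : Plane}

theorem IsNaturalFrame.det_ne_zero (h : IsNaturalFrame W G b B a c v) (hG : IsMetricOn W G)
    (hp : p ∈ W) : a 0 p * c 1 p - a 1 p * c 0 p ≠ 0 := by
  intro h0
  have hd := hG.det_pos p hp
  rw [h.metric p hp, h.metric p hp, h.metric p hp] at hd
  have : ((Real.cosh (v p) + 1) * (a 0 p * a 0 p) + (Real.cosh (v p) - 1) * (c 0 p * c 0 p))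
      * ((Real.cosh (v p) + 1) * (a 1 p * a 1 p) + (Real.cosh (v p) - 1) * (c 1 p * c 1 p))
      - ((Real.cosh (v p) + 1) * (a 0 p * a 1 p) + (Real.cosh (v p) - 1) * (c 0 p * c 1 p))
      * ((Real.cosh (v p) + 1) * (a 0 p * a 1 p) + (Real.cosh (v p) - 1) * (c 0 p * c 1 p))
      = (Real.cosh (v p) + 1) * (Real.cosh (v p) - 1) * (a 0 p * c 1 p - a 1 p * c 0 p) ^ 2 := by
    ring
  rw [this, h0] at hd
  simp at hd

/-- The natural coframe is closed. -/
theorem IsNaturalFrame.closed (h : IsNaturalFrame W G b B a c v) (hG : IsMetricOn W G)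
    (hb : ∀ q ∈ W, ∀ i, covDeriv G b i 0 1 q = covDeriv G b i 1 0 q) (hp : p ∈ W) :
    pd 1 (a 0) p = pd 0 (a 1) p ∧ pd 1 (c 0) p = pd 0 (c 1) p := by
  have hW := hG.isOpen
  have da := fun i => diffAt_of_contDiffOn (h.smooth_fst i) hW hp
  have dc := fun i => diffAt_of_contDiffOn (h.smooth_snd i) hW hp
  have dv := diffAt_of_contDiffOn h.smooth hW hp
  have hv := h.pos p hp
  have hC : 1 < Real.cosh (v p) := Real.one_lt_cosh.2 hv.ne'
  have hS : 0 < Real.sinh (v p) := Real.sinh_pos_iff.2 hv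
  have hcs := Real.cosh_sq (v p)
  have dE : ∀ r : ℝ, DifferentiableAt ℝ (fun q => Real.cosh (v q) + r) p := fun r =>
    (dv.cosh).add_const r
  have ds : DifferentiableAt ℝ (fun q => Real.sinh (v q) / 2) p := by
    simpa [div_eq_mul_inv] using dv.sinh.mul_const (2 : ℝ)⁻¹
  have pG : ∀ i j k, pd k (fun q => G q i j) p = Real.sinh (v p) * pd k v p * (a i p * a j p)
      + (Real.cosh (v p) + 1) * (pd k (a i) p * a j p + a i p * pd k (a j) p)
      + (Real.sinh (v p) * pd k v p * (c i p * c j p)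
      + (Real.cosh (v p) + (-1)) * (pd k (c i) p * c j p + c i p * pd k (c j) p)) := by
    intro i j k
    rw [pd_congr_on hW (fun q hq => (by rw [h.metric q hq i j, sub_eq_add_neg] : G q i j =
      (Real.cosh (v q) + 1) * (a i q * a j q) + (Real.cosh (v q) + (-1)) * (c i q * c j q))) hp,
      pd_add ((dE 1).fun_mul ((da i).fun_mul (da j))) ((dE (-1)).fun_mul ((dc i).fun_mul (dc j))),
      pd_mul (dE 1) ((da i).fun_mul (da j)), pd_mul (dE (-1)) ((dc i).fun_mul (dc j)),
      pd_mul (da i) (da j), pd_mul (dc i) (dc j), pd_cosh_comp dv, pd_cosh_comp dv]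
  have pb : ∀ i j k, pd k (fun q => b q i j) p
      = Real.cosh (v p) / 2 * pd k v p * (a i p * a j p + c i p * c j p)
      + Real.sinh (v p) / 2 * (pd k (a i) p * a j p + a i p * pd k (a j) p
        + (pd k (c i) p * c j p + c i p * pd k (c j) p)) := by
    intro i j k
    rw [pd_congr_on hW (fun q hq => h.tensor q hq i j) hp,
      pd_mul ds (((da i).fun_mul (da j)).fun_add ((dc i).fun_mul (dc j))),
      pd_add ((da i).fun_mul (da j)) ((dc i).fun_mul (dc j)),
      pd_mul (da i) (da j), pd_mul (dc i) (dc j),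
      pd_comp (φ := fun x => Real.sinh x / 2) ((Real.hasDerivAt_sinh _).div_const 2) dv]
  have key := natural_coframe_closed (a := fun i => a i p) (c := fun i => c i p)
    (φ := fun k => Real.sinh (v p) * pd k v p) (σ := fun k => Real.cosh (v p) / 2 * pd k v p)
    (A := fun i k => pd k (a i) p - (christoffel G 0 k i p * a 0 p + christoffel G 1 k i p * a 1 p))
    (C := fun i k => pd k (c i) p - (christoffel G 0 k i p * c 0 p + christoffel G 1 k i p * c 1 p))
    (E := Real.cosh (v p) + 1) (F := Real.cosh (v p) - 1) (s := Real.sinh (v p) / 2)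
    (by positivity) (h.det_ne_zero hG hp) (by ring)
    (by linear_combination -hcs) (fun k => by ring)
    (fun i j k => by
      have h1 := pG i j k
      rw [hG.pd_metric hp k i j, h.metric p hp, h.metric p hp, h.metric p hp, h.metric p hp] at h1
      linear_combination -h1)
    (fun i => by
      have h1 := hb p hp i
      unfold covDeriv at h1
      simp only [Fin.sum_univ_two, pb, h.tensor p hp] at h1
      rw [hG.christoffel_symm hp 0 1 0, hG.christoffel_symm hp 1 1 0] at h1 ⊢
      linear_combination h1)
  obtain ⟨k1, k2⟩ := key
  simp only [hG.christoffel_symm hp 0 1 0, hG.christoffel_symm hp 1 1 0] at k1 k2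
  constructor <;> linarith

/-- A closed one-form on a ball is exact. -/
theorem exists_potential {r : ℝ} (ha : ∀ i, ContDiffOn ℝ ∞ (a i) (Metric.ball p r))
    (hc : ∀ q ∈ Metric.ball p r, pd 1 (a 0) q = pd 0 (a 1) q) :
    ∃ x : Plane → ℝ, ContDiffOn ℝ ∞ x (Metric.ball p r) ∧
      ∀ q ∈ Metric.ball p r, ∀ i, pd i x q = a i q := by
  set P : Fin 2 → Plane →L[ℝ] ℝ := fun i => EuclideanSpace.proj i with hP
  set θ : Plane → Plane →L[ℝ] ℝ := fun q => a 0 q • P 0 + a 1 q • P 1 with hθ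
  have hθ_smooth : ContDiffOn ℝ ∞ θ (Metric.ball p r) :=
    ((ha 0).smul contDiffOn_const).add ((ha 1).smul contDiffOn_const)
  have hW : IsOpen (Metric.ball p r) := Metric.isOpen_ball
  obtain ⟨x, hx⟩ := (convex_ball p r).exists_forall_hasFDerivAt_of_fderiv_symmetric hW
    (hθ_smooth.differentiableOn (by simp)) (by
      intro q hq y z
      have d := fun i => diffAt_of_contDiffOn (ha i) hW hq
      have h1 : HasFDerivAt θ ((fderiv ℝ (a 0) q).smulRight (P 0) + (fderiv ℝ (a 1) q).smulRight (P 1)) q :=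
        ((d 0).hasFDerivAt.smul_const (P 0)).add ((d 1).hasFDerivAt.smul_const (P 1))
      have hPa : ∀ i w, P i w = w i := fun _ _ => rfl
      rw [h1.fderiv]
      simp only [add_apply, ContinuousLinearMap.smulRight_apply, smul_apply, fderiv_eq_sum_pd,
        smul_eq_mul, hPa]
      rw [hc q hq]
      ring)
  refine ⟨x, ?_, fun q hq i => ?_⟩
  · rw [contDiffOn_infty_iff_fderiv_of_isOpen hW]
    exact ⟨fun q hq => (hx q hq).differentiableAt.differentiableWithinAt,
      hθ_smooth.congr fun q hq => (hx q hq).fderiv⟩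
  · unfold pd
    rw [(hx q hq).fderiv]
    fin_cases i <;> simp [hθ, hP]

/-- Two functions with independent differentials are local coordinates. -/
theorem exists_coordinates {x y : Plane → ℝ} (hW : IsOpen W) (hx : ContDiffOn ℝ ∞ x W)
    (hy : ContDiffOn ℝ ∞ y W) (hp : p ∈ W)
    (hD : ∀ q ∈ W, pd 0 x q * pd 1 y q - pd 1 x q * pd 0 y q ≠ 0) :
    ∃ τ : OpenPartialHomeomorph Plane Plane, p ∈ τ.source ∧ τ.source ⊆ W ∧
      (∀ q, τ q = !₂[x q, y q]) ∧ ContDiffOn ℝ ∞ τ τ.source ∧ ContDiffOn ℝ ∞ τ.symm τ.target := by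
  set Φ : Plane → Plane := fun q => !₂[x q, y q] with hΦ
  have hΦs : ContDiffOn ℝ ∞ Φ W := by
    rw [contDiffOn_euclidean]
    intro i
    fin_cases i
    · exact hx
    · exact hy
  have hder : ∀ q ∈ W, ∃ L : Plane ≃L[ℝ] Plane, HasFDerivAt Φ (L : Plane →L[ℝ] Plane) q := by
    intro q hq
    have hd : DifferentiableAt ℝ Φ q := (hΦs.contDiffAt (hW.mem_nhds hq)).differentiableAt (by simp)
    have hap : ∀ w : Plane, ∀ i, fderiv ℝ Φ q w i = w 0 * pd 0 (fun q => Φ q i) q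
        + w 1 * pd 1 (fun q => Φ q i) q := by
      intro w i
      rw [← fderiv_eq_sum_pd]
      have := ((EuclideanSpace.proj i : Plane →L[ℝ] ℝ).hasFDerivAt.comp q hd.hasFDerivAt).fderiv
      have h2 : fderiv ℝ (fun q => Φ q i) q
        = (EuclideanSpace.proj i : Plane →L[ℝ] ℝ).comp (fderiv ℝ Φ q) := this
      rw [h2]; rfl
    have hinj : Function.Injective (fderiv ℝ Φ q) := by
      rw [injective_iff_map_eq_zero]
      intro w hw
      have h0 := hap w 0
      have h1 := hap w 1
      rw [hw] at h0 h1
      have e0 : w 0 * pd 0 x q + w 1 * pd 1 x q = 0 := h0.symm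
      have e1 : w 0 * pd 0 y q + w 1 * pd 1 y q = 0 := h1.symm
      ext i
      fin_cases i
      · exact mul_left_cancel₀ (hD q hq) (by
          show _ * w 0 = _ * 0
          linear_combination pd 1 y q * e0 - pd 1 x q * e1)
      · exact mul_left_cancel₀ (hD q hq) (by
          show _ * w 1 = _ * 0
          linear_combination pd 0 x q * e1 - pd 0 y q * e0)
    refine ⟨(LinearEquiv.ofInjectiveEndo (fderiv ℝ Φ q : Plane →ₗ[ℝ] Plane)
      hinj).toContinuousLinearEquiv, ?_⟩
    convert hd.hasFDerivAt using 1
    ext w i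
    simp
  obtain ⟨L, hL⟩ := hder p hp
  set τ₀ := (hΦs.contDiffAt (hW.mem_nhds hp)).toOpenPartialHomeomorph Φ hL (by simp) with hτ₀
  have hτ₀c : ∀ q, τ₀ q = Φ q := fun q => rfl
  refine ⟨τ₀.restrOpen W hW, ?_, ?_, ?_, ?_, ?_⟩
  · simp only [OpenPartialHomeomorph.restrOpen_source]
    exact ⟨ContDiffAt.mem_toOpenPartialHomeomorph_source _ _ _, hp⟩
  · rw [OpenPartialHomeomorph.restrOpen_source]
    exact Set.inter_subset_right
  · intro q; exact hτ₀c q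
  · rw [OpenPartialHomeomorph.restrOpen_source]
    exact hΦs.mono Set.inter_subset_right
  · intro q hq
    have hs := (τ₀.restrOpen W hW).map_target hq
    rw [OpenPartialHomeomorph.restrOpen_source] at hs
    obtain ⟨L', hL'⟩ := hder _ hs.2
    exact ((τ₀.restrOpen W hW).contDiffAt_symm hq hL'
      (hΦs.contDiffAt (hW.mem_nhds hs.2))).contDiffWithinAt

end NaturalCoordinates

/-! ### The gradient of the nonlinear term with respect to the Codazzi tensor -/

theorem pullForm_injective {J X Y : Matrix (Fin 2) (Fin 2) ℝ}
    (hJ : J 0 0 * J 1 1 - J 0 1 * J 1 0 ≠ 0) (h : pullForm J X = pullForm J Y) : X = Y := by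
  have e : ∀ i j, pullForm J X i j = pullForm J Y i j := fun i j => by rw [h]
  simp only [pullForm, Matrix.of_apply] at e
  have e00 := e 0 0
  have e01 := e 0 1
  have e10 := e 1 0
  have e11 := e 1 1
  have hJ2 := mul_ne_zero hJ hJ
  ext i j
  fin_cases i <;> fin_cases j <;> refine mul_left_cancel₀ hJ2 ?_ <;>
    simp only [Fin.zero_eta, Fin.mk_one, Fin.isValue]
  · linear_combination J 1 1 * J 1 1 * e00 - J 1 1 * J 1 0 * e01 - J 1 0 * J 1 1 * e10
      + J 1 0 * J 1 0 * e11
  · linear_combination -(J 1 1 * J 0 1) * e00 + J 1 1 * J 0 0 * e01 + J 1 0 * J 0 1 * e10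
      - J 1 0 * J 0 0 * e11
  · linear_combination -(J 0 1 * J 1 1) * e00 + J 0 1 * J 1 0 * e01 + J 0 0 * J 1 1 * e10
      - J 0 0 * J 1 0 * e11
  · linear_combination J 0 1 * J 0 1 * e00 - J 0 1 * J 0 0 * e01 - J 0 0 * J 0 1 * e10
      + J 0 0 * J 0 0 * e11

section

variable {U : Set Plane} {G Z : Plane → Matrix (Fin 2) (Fin 2) ℝ} {f : Plane → ℝ} {p : Plane}

/-- The Codazzi tensor of a solution is itself a Riemannian metric. -/
theorem IsLocalSolution.isMetricOn_codazziTensor (h : IsLocalSolution U G Z f) :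
    IsMetricOn U (codazziTensor G Z f) where
  isOpen := h.isOpen
  smooth := h.contDiffOn_codazziTensor
  symm := fun _ hq => h.codazziTensor_symm hq
  pos := fun _ hq => h.codazziTensor_pos hq
  det_pos := fun q hq => by
    rw [h.det_codazziTensor hq]
    have := h.metric.det_pos q hq
    positivity

end

section Surface

variable {M : Type*} [TopologicalSpace M] [ChartedSpace Plane M] [IsManifold (𝓡 2) ∞ M]
  {ρ : SurfaceMetric M} {z : (x : M) → TangentSpace (𝓡 2) x →L[ℝ] TangentSpace (𝓡 2) x →L[ℝ] ℝ}
  {u : M → ℝ} {e e' : OpenPartialHomeomorph M Plane} {p : Plane}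

/-- The squared length of the differential of the nonlinear term with respect to the Codazzi
tensor, in a chart. -/
def energy (ρ : SurfaceMetric M)
    (z : (x : M) → TangentSpace (𝓡 2) x →L[ℝ] TangentSpace (𝓡 2) x →L[ℝ] ℝ) (u : M → ℝ)
    (e : OpenPartialHomeomorph M Plane) (p : Plane) : ℝ :=
  gradSq (codazziTensor (comps ρ.inner e) (comps z e) (u ∘ e.symm))
    (nonlinearTerm (comps ρ.inner e) (comps z e) (u ∘ e.symm)) p

theorem energy_change_chart (hρ : HasScalarCurvature ρ (-1)) (hz : IsTT ρ z) (hu : IsSolution ρ z u)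
    (he : e ∈ charts M) (he' : e' ∈ charts M) (hp : p ∈ e'.target) (hpe : e'.symm p ∈ e.source) :
    energy ρ z u e' p = energy ρ z u e (e (e'.symm p)) := by
  have hopen : IsOpen (e'.target ∩ e'.symm ⁻¹' e.source) :=
    e'.symm.isOpen_inter_preimage e.open_source
  have hmem : p ∈ e'.target ∩ e'.symm ⁻¹' e.source := ⟨hp, hpe⟩
  have hs := isLocalSolution hρ hz hu he
  have hs' := isLocalSolution hρ hz hu he'
  have hB : ∀ q ∈ e'.target ∩ e'.symm ⁻¹' e.source,
      nonlinearTerm (comps ρ.inner e') (comps z e') (u ∘ e'.symm) q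
      = (nonlinearTerm (comps ρ.inner e) (comps z e) (u ∘ e.symm) ∘ (e ∘ e'.symm)) q :=
    fun q hq => nonlinearTerm_change_chart hz hu.smooth he he' hq.1 hq.2
  have h1 := gradSq_change (τ := e ∘ e'.symm) hs.isMetricOn_codazziTensor
    hs'.isMetricOn_codazziTensor (e.map_source hpe) hp
    (((contDiffOn_transition he he').contDiffAt (hopen.mem_nhds hmem)).differentiableAt (by simp))
    (diffAt_of_contDiffOn hs.contDiffOn_nonlinearTerm hs.isOpen (e.map_source hpe))
    (codazziTensor_change_chart (ρ := ρ) (z := z) hu.smooth he he' hp hpe)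
  unfold energy
  refine Eq.trans ?_ h1
  unfold gradSq
  simp only [pd_congr_on hopen hB hmem]

/-- Away from the points where the nonlinear term is `1` there are charts in which the metric is
`(cosh v + 1) dx² + (cosh v - 1) dy²` and the Codazzi tensor is `(sinh v / 2) (dx² + dy²)`. -/
theorem exists_natural_chart (hρ : HasScalarCurvature ρ (-1)) (hz : IsTT ρ z)
    (hu : IsSolution ρ z u) (he : e ∈ charts M) (hp : p ∈ e.target)
    (hB : 1 < nonlinearTerm (comps ρ.inner e) (comps z e) (u ∘ e.symm) p) :
    ∃ e' ∈ charts M, e.symm p ∈ e'.source ∧ ∃ v : Plane → ℝ, ContDiffOn ℝ ∞ v e'.target ∧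
      ∀ q ∈ e'.target, 0 < v q ∧
        comps ρ.inner e' q = !![Real.cosh (v q) + 1, 0; 0, Real.cosh (v q) - 1] ∧
        codazziTensor (comps ρ.inner e') (comps z e') (u ∘ e'.symm) q
          = !![Real.sinh (v q) / 2, 0; 0, Real.sinh (v q) / 2] ∧
        nonlinearTerm (comps ρ.inner e') (comps z e') (u ∘ e'.symm) q
          = Real.cosh (v q) / Real.sinh (v q) := by
  have hs := isLocalSolution hρ hz hu he
  obtain ⟨r, hr, hrU, a, c, v, hf⟩ := hs.exists_isNaturalFrame hp hB
  have hGm := hs.metric.mono (V := Metric.ball p r) Metric.isOpen_ball hrU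
  have hcl := fun q hq => hf.closed (p := q) hGm
    (fun q hq i => hs.covDeriv_codazziTensor (hrU hq) i) hq
  obtain ⟨x, hxs, hx⟩ := exists_potential hf.smooth_fst fun q hq => (hcl q hq).1
  obtain ⟨y, hys, hy⟩ := exists_potential hf.smooth_snd fun q hq => (hcl q hq).2
  obtain ⟨τ, hpτ, hτW, hτ, hτs, hτs'⟩ := exists_coordinates Metric.isOpen_ball hxs hys
    (Metric.mem_ball_self hr) (fun q hq => by
      rw [hx q hq, hx q hq, hy q hq, hy q hq]; exact hf.det_ne_zero hGm hq)
  have he' := trans_mem_charts he hτs hτs'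
  refine ⟨e.trans τ, he', ?_, v ∘ τ.symm, ?_, ?_⟩
  · rw [OpenPartialHomeomorph.trans_source]
    refine ⟨e.map_target hp, ?_⟩
    simpa [e.right_inv hp] using hpτ
  · rw [OpenPartialHomeomorph.trans_target]
    exact hf.smooth.comp (hτs'.mono Set.inter_subset_left)
      fun q hq => hτW (τ.map_target hq.1)
  · intro q hq
    rw [OpenPartialHomeomorph.trans_target] at hq
    obtain ⟨hqτ, hqe⟩ := hq
    set q' := τ.symm q with hq'
    have hqe : q' ∈ e.target := hqe
    have hq's : q' ∈ τ.source := τ.map_target hqτ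
    have hW := hτW hq's
    have hmem : e.symm q' ∈ (e.trans τ).source := by
      rw [OpenPartialHomeomorph.trans_source]
      exact ⟨e.map_target hqe, by simpa [e.right_inv hqe] using hq's⟩
    have hval : (e.trans τ) (e.symm q') = q := by
      rw [OpenPartialHomeomorph.trans_apply, e.right_inv hqe, hq', τ.right_inv hqτ]
    have hfun : ∀ w ∈ e.target, ((e.trans τ) ∘ e.symm) w = !₂[x w, y w] := by
      intro w hw
      simp [e.right_inv hw, hτ]
    have hJ0 : ∀ i, jac ((e.trans τ) ∘ e.symm) q' 0 i = a i q' := by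
      intro i
      rw [← hx q' hW i]
      exact pd_congr_on e.open_target (fun w hw => by rw [hfun w hw]; rfl) hqe i
    have hJ1 : ∀ i, jac ((e.trans τ) ∘ e.symm) q' 1 i = c i q' := by
      intro i
      rw [← hy q' hW i]
      exact pd_congr_on e.open_target (fun w hw => by rw [hfun w hw]; rfl) hqe i
    have hdet := hf.det_ne_zero hGm hW
    have hJd : jac ((e.trans τ) ∘ e.symm) q' 0 0 * jac ((e.trans τ) ∘ e.symm) q' 1 1
        - jac ((e.trans τ) ∘ e.symm) q' 0 1 * jac ((e.trans τ) ∘ e.symm) q' 1 0 ≠ 0 := by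
      rw [hJ0, hJ0, hJ1, hJ1]; exact hdet
    have hG := comps_change ρ.inner he' he hqe hmem
    have hb := codazziTensor_change_chart (ρ := ρ) (z := z) hu.smooth he' he hqe hmem
    have hN := nonlinearTerm_change_chart hz hu.smooth he' he hqe hmem
    rw [hval] at hG hb hN
    refine ⟨hf.pos q' hW, ?_, ?_, ?_⟩
    · apply pullForm_injective hJd
      rw [← hG]
      ext i j
      rw [hf.metric q' hW i j]
      simp only [pullForm, Matrix.of_apply, hJ0, hJ1, Function.comp]
      simp
      ring
    · apply pullForm_injective hJd
      rw [← hb]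
      ext i j
      rw [hf.tensor q' hW i j]
      simp only [pullForm, Matrix.of_apply, hJ0, hJ1, Function.comp]
      simp
      ring
    · rw [← hN, hf.coth q' hW]; rfl

theorem hasDerivAt_coth {x : ℝ} (hx : 0 < Real.sinh x) :
    HasDerivAt (fun x => Real.cosh x / Real.sinh x) (-(Real.sinh x ^ 2)⁻¹) x := by
  refine ((Real.hasDerivAt_cosh x).fun_div (Real.hasDerivAt_sinh x) hx.ne').congr_deriv ?_
  have := Real.cosh_sq x
  have := hx.ne'
  field_simp
  linarith

/-- The estimate of the energy at an interior maximum. -/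
theorem energy_le_of_isLocalMax (hρ : HasScalarCurvature ρ (-1)) (hz : IsTT ρ z)
    (hu : IsSolution ρ z u) (he : e ∈ charts M) {v : Plane → ℝ} (hvs : ContDiffOn ℝ ∞ v e.target)
    (hv : ∀ q ∈ e.target, 0 < v q ∧
        comps ρ.inner e q = !![Real.cosh (v q) + 1, 0; 0, Real.cosh (v q) - 1] ∧
        codazziTensor (comps ρ.inner e) (comps z e) (u ∘ e.symm) q
          = !![Real.sinh (v q) / 2, 0; 0, Real.sinh (v q) / 2] ∧
        nonlinearTerm (comps ρ.inner e) (comps z e) (u ∘ e.symm) q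
          = Real.cosh (v q) / Real.sinh (v q)) (hp : p ∈ e.target)
    (hmax : IsLocalMax (energy ρ z u e) p) : energy ρ z u e p
      ≤ 6 * nonlinearTerm (comps ρ.inner e) (comps z e) (u ∘ e.symm) p ^ 3 := by
  have hs := isLocalSolution hρ hz hu he
  have hsinh : ∀ q ∈ e.target, 0 < Real.sinh (v q) := fun q hq =>
    Real.sinh_pos_iff.2 (hv q hq).1
  have hE : ∀ q ∈ e.target, energy ρ z u e q
      = 2 * ((pd 0 v q ^ 2 + pd 1 v q ^ 2) * (Real.sinh (v q) ^ 5)⁻¹) := by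
    intro q hq
    have h1 := hs.isMetricOn_codazziTensor.gradSq_mul_det
      (f := nonlinearTerm (comps ρ.inner e) (comps z e) (u ∘ e.symm)) hq
    have hpd : ∀ i, pd i (nonlinearTerm (comps ρ.inner e) (comps z e) (u ∘ e.symm)) q
        = -(Real.sinh (v q) ^ 2)⁻¹ * pd i v q := by
      intro i
      rw [pd_congr_on e.open_target (fun w hw => (hv w hw).2.2.2) hq,
        pd_comp (φ := fun x => Real.cosh x / Real.sinh x) (hasDerivAt_coth (hsinh q hq))
          (diffAt_of_contDiffOn hvs e.open_target hq)]
    rw [(hv q hq).2.2.1, hpd, hpd] at h1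
    simp only [Matrix.of_apply, Matrix.cons_val', Matrix.cons_val_zero, Matrix.cons_val_one,
      Matrix.cons_val_fin_one] at h1
    have h0 := (hsinh q hq).ne'
    have h2 : Real.sinh (v q) / 2 * (Real.sinh (v q) / 2) - 0 * 0 ≠ 0 := by
      simpa using h0
    apply mul_right_cancel₀ h2
    unfold energy
    rw [h1]
    field_simp
    ring
  have heq : ∀ q ∈ e.target, pd 0 (pd 0 v) q + pd 1 (pd 1 v) q = Real.sinh (v q) := by
    intro q hq
    refine laplace_eq_sinh hs.metric hs.curv hvs (fun q hq => (hv q hq).1) ?_ ?_ ?_ hq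
    · intro q hq; rw [(hv q hq).2.1]; simp
    · intro q hq; rw [(hv q hq).2.1]; simp
    · intro q hq; rw [(hv q hq).2.1]; simp [sub_eq_add_neg]
  have hmax' : IsLocalMax
      (fun q => (pd 0 v q ^ 2 + pd 1 v q ^ 2) * (Real.sinh (v q) ^ 5)⁻¹) p := by
    filter_upwards [hmax, e.open_target.mem_nhds hp] with q hq hqe
    rw [hE q hqe, hE p hp] at hq
    linarith
  have hb := sinhGordon_gradient_bound e.open_target hvs (fun q hq => (hv q hq).1) heq hp hmax'
  rw [hE p hp, (hv p hp).2.2.2]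
  have h0 := hsinh p hp
  have hC := Real.cosh_pos (v p)
  have hcs := Real.cosh_sq (v p)
  generalize Real.sinh (v p) = S at *
  generalize Real.cosh (v p) = C at *
  generalize pd 0 v p ^ 2 + pd 1 v p ^ 2 = N at *
  have h1 : 2 * N * S ^ 3 ≤ 6 * C ^ 3 * S ^ 5 := by
    have e1 : 2 * N ≤ 6 * C ^ 3 * S ^ 2 := by
      have : C * S ^ 2 ≤ C ^ 3 * S ^ 2 := by
        have e2 : C ^ 3 * S ^ 2 = C * S ^ 2 + C * S ^ 2 * S ^ 2 := by
          linear_combination C * S ^ 2 * hcs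
        rw [e2]
        have : 0 ≤ C * S ^ 2 * S ^ 2 := by positivity
        linarith
      have : 0 ≤ C * S ^ 2 := by positivity
      linarith
    have e3 := mul_le_mul_of_nonneg_right e1 (by positivity : 0 ≤ S ^ 3)
    linarith
  rw [div_pow, ← mul_assoc, ← mul_div_assoc, ← div_eq_mul_inv, div_le_div_iff₀ (by positivity) (by positivity)]
  exact h1

theorem energy_le [CompactSpace M] [Nonempty M] (hρ : HasScalarCurvature ρ (-1)) (hz : IsTT ρ z)
    (hu : IsSolution ρ z u) {h : ℝ} (hh : ∀ e ∈ charts M, ∀ p ∈ e.target,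
      nonlinearTerm (comps ρ.inner e) (comps z e) (u ∘ e.symm) p ≤ h)
    (he : e ∈ charts M) (hp : p ∈ e.target) : energy ρ z u e p ≤ 6 * h ^ 3 := by
  set F : M → ℝ := fun x => energy ρ z u (chartAt Plane x) (chartAt Plane x x) with hF
  have hFe : ∀ e ∈ charts M, ∀ p ∈ e.target, F (e.symm p) = energy ρ z u e p := by
    intro e he p hp
    rw [energy_change_chart hρ hz hu (chartAt_mem_charts (e.symm p)) he hp (mem_chart_source _ _)]
  obtain ⟨x₀, hx₀⟩ := exists_forall_le_of_charts (F := F) fun e he => by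
    have hs := isLocalSolution hρ hz hu he
    exact (hs.isMetricOn_codazziTensor.contDiffOn_gradSq
      hs.contDiffOn_nonlinearTerm).continuousOn.congr fun p hp => hFe e he p hp
  rw [← hFe e he p hp]
  refine (hx₀ _).trans ?_
  set c := chartAt Plane x₀ with hcdef
  have hc : c ∈ charts M := chartAt_mem_charts x₀
  have hx : x₀ ∈ c.source := mem_chart_source Plane x₀
  have hq := c.map_source hx
  have hs := isLocalSolution hρ hz hu hc
  have hB1 : ∀ q, 1 ≤ nonlinearTerm (comps ρ.inner c) (comps z c) (u ∘ c.symm) q := fun q =>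
    one_le_nonlinearTerm
  have hh1 : 1 ≤ h := (hB1 (c x₀)).trans (hh c hc _ hq)
  rcases (hB1 (c x₀)).lt_or_eq with hB | hB
  · obtain ⟨e', he', hmem, v, hvs, hv⟩ := exists_natural_chart hρ hz hu hc hq hB
    rw [c.left_inv hx] at hmem
    have hq' := e'.map_source hmem
    have hmax : IsLocalMax (energy ρ z u e') (e' x₀) := by
      have := isLocalMax_comp_symm hx₀ hmem
      filter_upwards [this, e'.open_target.mem_nhds hq'] with w hw hwe
      simpa only [hFe e' he' w hwe, hFe e' he' _ hq'] using hw
    have h1 := energy_le_of_isLocalMax hρ hz hu he' hvs hv hq' hmax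
    rw [← hFe e' he' _ hq', e'.left_inv hmem] at h1
    refine h1.trans ?_
    have h2 := hh e' he' _ hq'
    have h3 : 1 ≤ nonlinearTerm (comps ρ.inner e') (comps z e') (u ∘ e'.symm) (e' x₀) :=
      one_le_nonlinearTerm
    gcongr
  · have hmin : IsLocalMax (fun q => -nonlinearTerm (comps ρ.inner c) (comps z c) (u ∘ c.symm) q)
        (c x₀) := Filter.Eventually.of_forall fun q => by
      simp only [← hB]; linarith [hB1 q]
    have hpd : ∀ i, pd i (nonlinearTerm (comps ρ.inner c) (comps z c) (u ∘ c.symm)) (c x₀) = 0 := by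
      intro i
      have := pd_eq_zero_of_isLocalMax hmin i
      rw [pd_neg] at this
      linarith
    have h0 : F x₀ = 0 := by
      simp only [hF, energy, gradSq, ← hcdef, hpd]
      simp
    rw [h0]; positivity

end Surface

/-! ### A one-sided estimate for sweeping out by curves -/

section Sweep

open Set intervalIntegral MeasureTheory

variable {ℓ η : ℝ}

theorem continuousOn_slice {F : ℝ → ℝ → ℝ}
    (hF : ContinuousOn (fun z : ℝ × ℝ => F z.1 z.2) (Icc 0 ℓ ×ˢ Icc (-η) η)) {y : ℝ}
    (hy : y ∈ Icc (-η) η) : ContinuousOn (fun x => F x y) (Icc 0 ℓ) :=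
  hF.comp (f := fun x => (x, y)) (by fun_prop) fun _ hx => ⟨hx, hy⟩

/-- Differentiation under the integral sign on a rectangle. -/
theorem hasDerivAt_integral_of_continuousOn (hℓ : 0 ≤ ℓ) {F F' : ℝ → ℝ → ℝ}
    (hF : ContinuousOn (fun z : ℝ × ℝ => F z.1 z.2) (Icc 0 ℓ ×ˢ Icc (-η) η))
    (hF' : ContinuousOn (fun z : ℝ × ℝ => F' z.1 z.2) (Icc 0 ℓ ×ˢ Icc (-η) η))
    (hd : ∀ x ∈ Icc 0 ℓ, ∀ y ∈ Ioo (-η) η, HasDerivAt (F x) (F' x y) y) {y : ℝ}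
    (hy : y ∈ Ioo (-η) η) :
    HasDerivAt (fun y => ∫ x in 0..ℓ, F x y) (∫ x in 0..ℓ, F' x y) y := by
  obtain ⟨K, hK⟩ := (isCompact_Icc.prod isCompact_Icc).exists_bound_of_continuousOn hF'
  have hI : uIoc 0 ℓ ⊆ Icc 0 ℓ := by rw [uIoc_of_le hℓ]; exact Ioc_subset_Icc_self
  have meas : ∀ {H : ℝ → ℝ → ℝ},
      ContinuousOn (fun z : ℝ × ℝ => H z.1 z.2) (Icc 0 ℓ ×ˢ Icc (-η) η) → ∀ y ∈ Ioo (-η) η,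
      IntervalIntegrable (fun x => H x y) volume 0 ℓ := fun hH y hy =>
    ContinuousOn.intervalIntegrable (by
      rw [uIcc_of_le hℓ]; exact continuousOn_slice hH (Ioo_subset_Icc_self hy))
  have hnhds : Ioo (-η) η ∈ nhds y := isOpen_Ioo.mem_nhds hy
  refine (hasDerivAt_integral_of_dominated_loc_of_deriv_le (F := fun y x => F x y)
    (F' := fun y x => F' x y) (bound := fun _ => K) hnhds ?_ (meas hF y hy) ?_ ?_
    intervalIntegrable_const ?_).2
  · filter_upwards [hnhds] with w hw
    exact (intervalIntegrable_iff.1 (meas hF w hw)).aestronglyMeasurable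
  · exact (intervalIntegrable_iff.1 (meas hF' y hy)).aestronglyMeasurable
  · exact Filter.Eventually.of_forall fun x hx w hw =>
      hK (x, w) ⟨hI hx, Ioo_subset_Icc_self hw⟩
  · exact Filter.Eventually.of_forall fun x hx w hw => hd x (hI hx) w hw

/-- The coefficients `p`, `q`, `t` of a positive quadratic form on a rectangle swept out by a
family of curves, with `∂_y p - ∂_x q` of lower order and `t` bounded above by a derivative. -/
structure IsSweep (ℓ η c A T : ℝ) (p q t g py qx gy : ℝ → ℝ → ℝ) : Prop where
  cont_p : ContinuousOn (fun z : ℝ × ℝ => p z.1 z.2) (Icc 0 ℓ ×ˢ Icc (-η) η)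
  cont_q : ContinuousOn (fun z : ℝ × ℝ => q z.1 z.2) (Icc 0 ℓ ×ˢ Icc (-η) η)
  cont_g : ContinuousOn (fun z : ℝ × ℝ => g z.1 z.2) (Icc 0 ℓ ×ˢ Icc (-η) η)
  cont_py : ContinuousOn (fun z : ℝ × ℝ => py z.1 z.2) (Icc 0 ℓ ×ˢ Icc (-η) η)
  cont_qx : ContinuousOn (fun z : ℝ × ℝ => qx z.1 z.2) (Icc 0 ℓ ×ˢ Icc (-η) η)
  cont_gy : ContinuousOn (fun z : ℝ × ℝ => gy z.1 z.2) (Icc 0 ℓ ×ˢ Icc (-η) η)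
  deriv_p : ∀ x ∈ Icc 0 ℓ, ∀ y ∈ Ioo (-η) η, HasDerivAt (p x) (py x y) y
  deriv_q : ∀ x ∈ Icc 0 ℓ, ∀ y ∈ Ioo (-η) η, HasDerivAt (fun x => q x y) (qx x y) x
  deriv_g : ∀ x ∈ Icc 0 ℓ, ∀ y ∈ Ioo (-η) η, HasDerivAt (g x) (gy x y) y
  pos : ∀ x ∈ Icc 0 ℓ, ∀ y ∈ Ioo (-η) η, 0 < p x y
  disc : ∀ x ∈ Icc 0 ℓ, ∀ y ∈ Ioo (-η) η, c ≤ p x y * t x y - q x y ^ 2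
  err : ∀ x ∈ Icc 0 ℓ, ∀ y ∈ Ico 0 η,
    |py x y - qx x y| ≤ A * (p x y + |q x y|) + A * y * (|q x y| + t x y)
  upper : ∀ x ∈ Icc 0 ℓ, ∀ y ∈ Ioo (-η) η, t x y ≤ -gy x y + T
  bound : ∀ x ∈ Icc 0 ℓ, ∀ y ∈ Ioo (-η) η, |g x y| ≤ T

theorem le_of_sq_le_mul {X a b : ℝ} (ha : 0 ≤ a) (hb : 0 ≤ b) (h : X ^ 2 ≤ a * b) :
    X ≤ a / 4 + b := by
  by_contra hc
  push Not at hc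
  nlinarith [sq_nonneg (a / 4 - b)]

/-- The pointwise inequality behind the sweeping estimate. -/
theorem sweep_pointwise {p q t e A c s y θ θ' Ω ℓ : ℝ} (hp : 0 < p) (hc : 0 < c)
    (hdisc : c ≤ p * t - q ^ 2) (hA : 0 ≤ A) (hs : 0 < s) (hy : 0 ≤ y) (hys : y ≤ s)
    (hs1 : s ≤ 1) (hAs : 4 * (A * s) ≤ 1) (hθ : 0 ≤ θ) (hθΩ : θ ≤ Ω) (hℓ : |θ'| ≤ ℓ)
    (he : |e| ≤ A * (p + |q|) + A * y * (|q| + t)) :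
    e * θ ^ 2 / s - q * (2 * θ * θ') / s - p * θ ^ 2 / s ^ 2
      ≤ (A * Ω ^ 2 + (2 * ℓ + 2 * A * Ω) ^ 2 + 1) * t - √c * (θ / s) := by
  have ht : 0 < t := by
    have : 0 < p * t := by nlinarith [sq_nonneg q]
    exact (mul_pos_iff_of_pos_left hp).1 this
  have hΩ0 : 0 ≤ Ω := hθ.trans hθΩ
  have hℓ0 : 0 ≤ ℓ := (abs_nonneg _).trans hℓ
  set r := θ / s with hr
  have hr0 : 0 ≤ r := by positivity
  have hθr : θ = r * s := by rw [hr]; field_simp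
  have h1 : |q| * r * (2 * ℓ + 2 * A * Ω) ≤ p * r ^ 2 / 4 + (2 * ℓ + 2 * A * Ω) ^ 2 * t := by
    apply le_of_sq_le_mul (by positivity) (by positivity)
    have : |q| ^ 2 ≤ p * t := by rw [sq_abs]; linarith
    calc (|q| * r * (2 * ℓ + 2 * A * Ω)) ^ 2
        = |q| ^ 2 * (r ^ 2 * (2 * ℓ + 2 * A * Ω) ^ 2) := by ring
      _ ≤ p * t * (r ^ 2 * (2 * ℓ + 2 * A * Ω) ^ 2) := by gcongr
      _ = _ := by ring
  have h2 : √c * r ≤ p * r ^ 2 / 4 + t := by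
    apply le_of_sq_le_mul (by positivity) ht.le
    calc (√c * r) ^ 2 = c * r ^ 2 := by rw [mul_pow, Real.sq_sqrt hc.le]
      _ ≤ p * t * r ^ 2 := by gcongr; nlinarith [sq_nonneg q]
      _ = _ := by ring
  have e1 : e * θ ^ 2 / s - q * (2 * θ * θ') / s - p * θ ^ 2 / s ^ 2
      = e * θ * r - q * (2 * r * θ') - p * r ^ 2 := by
    rw [hθr]; field_simp
  rw [e1]
  have h3 : e * θ * r ≤ |e| * θ * r := by gcongr; exact le_abs_self e
  have h4 : |e| * θ * r ≤ (A * (p + |q|) + A * y * (|q| + t)) * θ * r := by gcongr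
  have h5 : -(q * (2 * r * θ')) ≤ |q| * (2 * r * ℓ) := by
    calc -(q * (2 * r * θ')) ≤ |q * (2 * r * θ')| := neg_le_abs _
      _ = |q| * (2 * r * |θ'|) := by rw [abs_mul, abs_mul, abs_of_nonneg (by positivity : 0 ≤ 2 * r)]
      _ ≤ _ := by gcongr
  have h6 : A * p * θ * r ≤ p * r ^ 2 / 4 := by
    calc A * p * θ * r = (4 * (A * s)) * (p * r ^ 2 / 4) := by rw [hθr]; ring
      _ ≤ 1 * (p * r ^ 2 / 4) := by gcongr
      _ = _ := by ring
  have h7 : A * |q| * θ * r ≤ A * |q| * Ω * r := by gcongr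
  have h8 : A * y * |q| * θ * r ≤ A * 1 * |q| * Ω * r := by
    gcongr; linarith
  have hyr : y * r ≤ θ := by
    rw [hθr, mul_comm]; gcongr
  have h9 : A * y * t * θ * r ≤ A * Ω ^ 2 * t := by
    calc A * y * t * θ * r = A * t * θ * (y * r) := by ring
      _ ≤ A * t * Ω * Ω := by gcongr; exact hyr.trans hθΩ
      _ = _ := by ring
  have h10 : (0:ℝ) ≤ p * r ^ 2 := by positivity
  linarith

theorem IsSweep.neg_log_le (hℓ : 0 < ℓ) (hη : 0 < η) {c A : ℝ} (hc : 0 < c) (hA : 0 ≤ A) :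
    ∃ C > 0, ∀ (T : ℝ) (p q t g py qx gy : ℝ → ℝ → ℝ), 0 ≤ T →
      IsSweep ℓ η c A T p q t g py qx gy →
      -Real.log (∫ x in 0..ℓ, p x 0 * (x * (ℓ - x)) ^ 2) ≤ C * (1 + T) := by
  set η₁ := min (η / 2) (1 / (8 * A + 8)) with hη₁
  have hη₁0 : 0 < η₁ := by positivity
  have hη₁η : η₁ < η := (min_le_left _ _).trans_lt (by linarith)
  have hη₁A : η₁ * (8 * A + 8) ≤ 1 := by
    have := min_le_right (η / 2) (1 / (8 * A + 8))
    rwa [← hη₁, le_div_iff₀ (by positivity)] at this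
  set C₁ := A * (ℓ ^ 2) ^ 2 + (2 * ℓ + 2 * A * ℓ ^ 2) ^ 2 + 1 with hC₁
  have hC₁0 : 0 < C₁ := by positivity
  set κ := √c * ∫ x in 0..ℓ, x * (ℓ - x) with hκ
  have hpos_int : 0 < ∫ x in 0..ℓ, x * (ℓ - x) := by
    refine intervalIntegral_pos_of_pos_on (Continuous.intervalIntegrable (by fun_prop) _ _) ?_ hℓ
    intro x hx
    exact mul_pos hx.1 (by linarith [hx.2])
  have hκ0 : 0 < κ := mul_pos (Real.sqrt_pos.2 hc) hpos_int
  have hΩ : ∀ x ∈ Icc 0 ℓ, 0 ≤ x * (ℓ - x) ∧ x * (ℓ - x) ≤ ℓ ^ 2 := fun x hx => by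
    constructor
    · exact mul_nonneg hx.1 (by linarith [hx.2])
    · nlinarith [hx.1, hx.2]
  refine ⟨|Real.log η₁| + (1 + 3 * C₁ * ℓ + κ * |Real.log η₁|) / κ, by positivity, ?_⟩
  intro T p q t g py qx gy hT h
  set δ := ∫ x in 0..ℓ, p x 0 * (x * (ℓ - x)) ^ 2 with hδ
  have hIoo : ∀ y ∈ Icc 0 η₁, y ∈ Ioo (-η) η := fun y hy =>
    ⟨by linarith [hy.1], by linarith [hy.2]⟩
  have hφc : ContinuousOn (fun z : ℝ × ℝ => (z.1 * (ℓ - z.1)) ^ 2) (Icc 0 ℓ ×ˢ Icc (-η) η) := by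
    fun_prop
  set D : ℝ → ℝ := fun y => ∫ x in 0..ℓ, p x y * (x * (ℓ - x)) ^ 2 with hD
  have hDd : ∀ y ∈ Ioo (-η) η, HasDerivAt D (∫ x in 0..ℓ, py x y * (x * (ℓ - x)) ^ 2) y :=
    fun y hy => hasDerivAt_integral_of_continuousOn hℓ.le
      (F := fun x y => p x y * (x * (ℓ - x)) ^ 2) (F' := fun x y => py x y * (x * (ℓ - x)) ^ 2)
      (h.cont_p.mul hφc) (h.cont_py.mul hφc)
      (fun x hx y hy => (h.deriv_p x hx y hy).mul_const _) hy
  set Γ : ℝ → ℝ := fun y => ∫ x in 0..ℓ, g x y with hΓ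
  have hΓd : ∀ y ∈ Ioo (-η) η, HasDerivAt Γ (∫ x in 0..ℓ, gy x y) y := fun y hy =>
    hasDerivAt_integral_of_continuousOn hℓ.le h.cont_g h.cont_gy h.deriv_g hy
  have hD0 : ∀ y ∈ Ioo (-η) η, 0 ≤ D y := fun y hy =>
    integral_nonneg hℓ.le fun x hx => mul_nonneg (h.pos x hx y hy).le (sq_nonneg _)
  have intg : ∀ {H : ℝ → ℝ → ℝ},
      ContinuousOn (fun z : ℝ × ℝ => H z.1 z.2) (Icc 0 ℓ ×ˢ Icc (-η) η) → ∀ y ∈ Ioo (-η) η,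
      IntervalIntegrable (fun x => H x y) volume 0 ℓ := fun hH y hy =>
    ContinuousOn.intervalIntegrable (by
      rw [uIcc_of_le hℓ.le]; exact continuousOn_slice hH (Ioo_subset_Icc_self hy))
  have hδ0 : 0 < δ := by
    have h0 : (0 : ℝ) ∈ Ioo (-η) η := ⟨by linarith, hη⟩
    refine intervalIntegral_pos_of_pos_on
      (intg (H := fun x y => p x y * (x * (ℓ - x)) ^ 2) (h.cont_p.mul hφc) 0 h0) ?_ hℓ
    intro x hx
    have : 0 < x * (ℓ - x) := mul_pos hx.1 (by linarith [hx.2])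
    exact mul_pos (h.pos x (Ioo_subset_Icc_self hx) 0 h0) (by positivity)
  have hΓb : ∀ y ∈ Ioo (-η) η, |Γ y| ≤ T * ℓ := fun y hy => by
    have := norm_integral_le_of_norm_le_const (a := 0) (b := ℓ) (f := fun x => g x y) (C := T)
      fun x hx => h.bound x (by rw [uIoc_of_le hℓ.le] at hx; exact Ioc_subset_Icc_self hx) y hy
    simpa [abs_of_pos hℓ] using this
  by_cases hδη : η₁ < δ
  · have h1 : Real.log η₁ ≤ Real.log δ := Real.log_le_log hη₁0 hδη.le
    have h2 := neg_abs_le (Real.log η₁)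
    have h3 : 0 ≤ (1 + 3 * C₁ * ℓ + κ * |Real.log η₁|) / κ := by positivity
    nlinarith [abs_nonneg (Real.log η₁)]
  push Not at hδη
  -- the monotone quantity
  set Ψ : ℝ → ℝ := fun y => D y / (y + δ) + κ * Real.log (y + δ) + C₁ * Γ y - C₁ * ℓ * T * y with hΨ
  have hΨd : ∀ y ∈ Icc 0 η₁, HasDerivAt Ψ
      (((∫ x in 0..ℓ, py x y * (x * (ℓ - x)) ^ 2) * (y + δ) - D y * 1) / (y + δ) ^ 2
        + κ * (1 / (y + δ)) + C₁ * (∫ x in 0..ℓ, gy x y) - C₁ * ℓ * T * 1) y := by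
    intro y hy
    have hs : 0 < y + δ := by linarith [hy.1]
    have hid : HasDerivAt (fun y => y + δ) 1 y := (hasDerivAt_id y).add_const δ
    exact ((((hDd y (hIoo y hy)).fun_div hid hs.ne').fun_add
      ((hid.log hs.ne').const_mul κ)).fun_add ((hΓd y (hIoo y hy)).const_mul C₁)).fun_sub
        ((hasDerivAt_id y).const_mul _)
  have hanti : AntitoneOn Ψ (Icc 0 η₁) := by
    refine antitoneOn_of_deriv_nonpos (convex_Icc 0 η₁)
      (fun y hy => (hΨd y hy).continuousAt.continuousWithinAt) ?_ ?_
    · intro y hy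
      exact (hΨd y (interior_subset hy)).differentiableAt.differentiableWithinAt
    · intro y hy
      have hy' : y ∈ Icc 0 η₁ := interior_subset hy
      rw [(hΨd y hy').deriv]
      have hyη := hIoo y hy'
      set s := y + δ with hs
      have hs0 : 0 < s := by linarith [hy'.1]
      have hs2 : s ≤ 2 * η₁ := by linarith [hy'.2]
      have hparts : ∫ x in 0..ℓ, (qx x y * (x * (ℓ - x)) ^ 2
          + q x y * (2 * (x * (ℓ - x)) * (ℓ - 2 * x))) = 0 := by
        have := integral_eq_sub_of_hasDerivAt (a := 0) (b := ℓ)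
          (f := fun x => q x y * (x * (ℓ - x)) ^ 2)
          (f' := fun x => qx x y * (x * (ℓ - x)) ^ 2
            + q x y * (2 * (x * (ℓ - x)) * (ℓ - 2 * x))) (fun x hx => by
            rw [uIcc_of_le hℓ.le] at hx
            refine (h.deriv_q x hx y hyη).fun_mul ?_
            have h1 : HasDerivAt (fun x : ℝ => x * (ℓ - x)) (1 * (ℓ - x) + x * (0 - 1)) x :=
              (hasDerivAt_id x).fun_mul ((hasDerivAt_const x ℓ).fun_sub (hasDerivAt_id x))
            refine (h1.fun_pow 2).congr_deriv ?_
            push_cast; ring)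
          (intg (H := fun x y => qx x y * (x * (ℓ - x)) ^ 2
            + q x y * (2 * (x * (ℓ - x)) * (ℓ - 2 * x)))
            ((h.cont_qx.mul hφc).add (h.cont_q.mul (by fun_prop))) y hyη)
        rw [this]; simp
      have ip := intg (H := fun x y => p x y * (x * (ℓ - x)) ^ 2) (h.cont_p.mul hφc) y hyη
      have ipy := intg (H := fun x y => py x y * (x * (ℓ - x)) ^ 2) (h.cont_py.mul hφc) y hyη
      have iq := intg (H := fun x y => qx x y * (x * (ℓ - x)) ^ 2
            + q x y * (2 * (x * (ℓ - x)) * (ℓ - 2 * x)))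
            ((h.cont_qx.mul hφc).add (h.cont_q.mul (by fun_prop))) y hyη
      have igy := intg h.cont_gy y hyη
      have iθ : IntervalIntegrable (fun x : ℝ => x * (ℓ - x)) volume 0 ℓ :=
        Continuous.intervalIntegrable (by fun_prop) _ _
      have hmono : ∫ x in 0..ℓ, (s⁻¹ * (py x y * (x * (ℓ - x)) ^ 2)
            - (s ^ 2)⁻¹ * (p x y * (x * (ℓ - x)) ^ 2)
            - s⁻¹ * (qx x y * (x * (ℓ - x)) ^ 2 + q x y * (2 * (x * (ℓ - x)) * (ℓ - 2 * x))))
          ≤ ∫ x in 0..ℓ, (C₁ * T - C₁ * gy x y - √c * s⁻¹ * (x * (ℓ - x))) := by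
        refine integral_mono_on hℓ.le (((ipy.const_mul _).sub (ip.const_mul _)).sub
          (iq.const_mul _)) ((intervalIntegrable_const.sub (igy.const_mul _)).sub
          (iθ.const_mul _)) ?_
        intro x hx
        have hpw := sweep_pointwise (p := p x y) (q := q x y) (t := t x y)
          (e := py x y - qx x y) (A := A) (c := c) (s := s) (y := y) (θ := x * (ℓ - x))
          (θ' := ℓ - 2 * x) (Ω := ℓ ^ 2) (ℓ := ℓ) (h.pos x hx y hyη) hc (h.disc x hx y hyη) hA hs0
          hy'.1 (by linarith) (by nlinarith) (by nlinarith) (hΩ x hx).1 (hΩ x hx).2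
          (abs_le.2 ⟨by linarith [hx.2], by linarith [hx.1]⟩) (h.err x hx y ⟨hy'.1, hyη.2⟩)
        have hup := mul_le_mul_of_nonneg_left (h.upper x hx y hyη) hC₁0.le
        simp only [div_eq_mul_inv] at hpw
        rw [← hC₁] at hpw
        linarith
      rw [integral_sub ((ipy.const_mul _).sub (ip.const_mul _)) (iq.const_mul _),
        integral_sub (ipy.const_mul _) (ip.const_mul _),
        integral_sub (intervalIntegrable_const.sub (igy.const_mul _)) (iθ.const_mul _),
        integral_sub intervalIntegrable_const (igy.const_mul _),
        intervalIntegral.integral_const] at hmono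
      simp only [intervalIntegral.integral_const_mul, hparts] at hmono
      have e1 : ((∫ x in 0..ℓ, py x y * (x * (ℓ - x)) ^ 2) * s - D y * 1) / s ^ 2
          = s⁻¹ * (∫ x in 0..ℓ, py x y * (x * (ℓ - x)) ^ 2) - (s ^ 2)⁻¹ * D y := by
        field_simp
      rw [e1]
      simp only [smul_eq_mul, mul_zero, sub_zero] at hmono
      have e2 : κ * (1 / s) = √c * s⁻¹ * ∫ x in 0..ℓ, x * (ℓ - x) := by
        rw [hκ]; ring
      rw [e2]
      have e3 : (s ^ 2)⁻¹ * D y = (s ^ 2)⁻¹ * ∫ x in 0..ℓ, p x y * (x * (ℓ - x)) ^ 2 := rfl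
      rw [e3]
      linarith
  have hend := hanti (left_mem_Icc.2 hη₁0.le) (right_mem_Icc.2 hη₁0.le) hη₁0.le
  simp only [hΨ, zero_add, mul_zero, sub_zero] at hend
  have hDδ : D 0 / δ = 1 := by rw [show D 0 = δ from rfl]; exact div_self hδ0.ne'
  rw [hDδ] at hend
  have g0 := abs_le.1 (hΓb 0 (hIoo 0 (left_mem_Icc.2 hη₁0.le)))
  have g1 := abs_le.1 (hΓb η₁ (hIoo η₁ (right_mem_Icc.2 hη₁0.le)))
  have hDη : 0 ≤ D η₁ / (η₁ + δ) :=
    div_nonneg (hD0 η₁ (hIoo η₁ (right_mem_Icc.2 hη₁0.le))) (by positivity)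
  have hlog : Real.log η₁ ≤ Real.log (η₁ + δ) := Real.log_le_log hη₁0 (by linarith)
  have habs := neg_abs_le (Real.log η₁)
  have hη₁1 : η₁ ≤ 1 := by nlinarith
  have hmain : κ * (-Real.log δ) ≤ 1 + 3 * C₁ * ℓ * T + κ * |Real.log η₁| := by
    have k1 : κ * (-|Real.log η₁|) ≤ κ * Real.log (η₁ + δ) :=
      mul_le_mul_of_nonneg_left (habs.trans hlog) hκ0.le
    have k2 : C₁ * Γ 0 ≤ C₁ * (T * ℓ) := mul_le_mul_of_nonneg_left g0.2 hC₁0.le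
    have k3 : C₁ * (-(T * ℓ)) ≤ C₁ * Γ η₁ := mul_le_mul_of_nonneg_left g1.1 hC₁0.le
    have k4 : C₁ * ℓ * T * η₁ ≤ C₁ * ℓ * T * 1 := by gcongr
    linarith
  have hfin : -Real.log δ ≤ (1 + 3 * C₁ * ℓ * T + κ * |Real.log η₁|) / κ := by
    rw [le_div_iff₀ hκ0]; linarith
  refine hfin.trans ?_
  have hb : (1 + 3 * C₁ * ℓ * T + κ * |Real.log η₁|) / κ
      ≤ (1 + 3 * C₁ * ℓ + κ * |Real.log η₁|) * (1 + T) / κ := by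
    gcongr
    have : 0 ≤ κ * |Real.log η₁| * T := by positivity
    have : 0 ≤ C₁ * ℓ := by positivity
    nlinarith
  refine hb.trans ?_
  have : 0 ≤ |Real.log η₁| * (1 + T) := by positivity
  rw [mul_div_right_comm, add_mul |Real.log η₁|]
  linarith

end Sweep

/-! ### The derivative of the Codazzi tensor as a cubic form -/

section Cubic

/-- A cubic form that is apolar to a positive quadratic form `b` is controlled by its trace with
respect to a second quadratic form `g`. -/
theorem cubic_form_bound {b0 b1 b2 g0 g1 g2 x y c e B p0 p1 S v w : ℝ} (hb : 0 < b0)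
    (hd : 0 < b0 * b2 - b1 * b1) (hg : g0 * g2 - g1 * g1 = 4 * (b0 * b2 - b1 * b1))
    (htr : g2 * b0 - 2 * (g1 * b1) + g0 * b2 = B * (g0 * g2 - g1 * g1))
    (a0 : b2 * x - 2 * (b1 * y) + b0 * c = 0) (a1 : b2 * y - 2 * (b1 * c) + b0 * e = 0)
    (h0 : p0 * (g0 * g2 - g1 * g1) = g2 * x - 2 * (g1 * y) + g0 * c)
    (h1 : p1 * (g0 * g2 - g1 * g1) = g2 * y - 2 * (g1 * c) + g0 * e)
    (hS : S * (b0 * b2 - b1 * b1) = b2 * (p0 * p0) - 2 * (b1 * (p0 * p1)) + b0 * (p1 * p1)) :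
    (B ^ 2 - 1) * (x * v ^ 3 + 3 * (y * (v ^ 2 * w)) + 3 * (c * (v * w ^ 2)) + e * w ^ 3) ^ 2
      ≤ S * (b0 * (v * v) + 2 * (b1 * (v * w)) + b2 * (w * w)) ^ 3 := by
  set d := b0 * b2 - b1 * b1 with hdd
  set Y := b0 * y - b1 * x with hY
  set m := b0 * v + b1 * w with hm
  set Q := b0 * (v * v) + 2 * (b1 * (v * w)) + b2 * (w * w) with hQ
  set T := x * v ^ 3 + 3 * (y * (v ^ 2 * w)) + 3 * (c * (v * w ^ 2)) + e * w ^ 3 with hT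
  have hc : b0 ^ 2 * c = 2 * b1 * Y + (b1 ^ 2 - d) * x := by
    rw [hY, hdd]; linear_combination b0 * a0
  have he : b0 ^ 3 * e = b1 ^ 3 * x + 3 * b1 ^ 2 * Y - 3 * b1 * d * x - d * Y := by
    rw [hY, hdd]; linear_combination b0 ^ 2 * a1 + 2 * b1 * b0 * a0
  have hTm : b0 ^ 3 * T = m ^ 3 * x + 3 * m ^ 2 * w * Y - 3 * m * w ^ 2 * d * x - w ^ 3 * d * Y := by
    rw [hT, hm]
    linear_combination (norm := skip) w ^ 3 * he + 3 * b0 * v * w ^ 2 * hc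
    rw [hY]; ring
  have hQm : b0 * Q = m ^ 2 + d * w ^ 2 := by rw [hQ, hm, hdd]; ring
  have hT2 : d * (b0 ^ 3 * T) ^ 2 ≤ (d * x ^ 2 + Y ^ 2) * (b0 * Q) ^ 3 := by
    rw [hTm, hQm]
    have : (d * x ^ 2 + Y ^ 2) * (m ^ 2 + d * w ^ 2) ^ 3
        - d * (m ^ 3 * x + 3 * m ^ 2 * w * Y - 3 * m * w ^ 2 * d * x - w ^ 3 * d * Y) ^ 2
        = (d * x * (3 * m ^ 2 * w - d * w ^ 3) - Y * (m ^ 3 - 3 * m * d * w ^ 2)) ^ 2 := by ring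
    exact sub_nonneg.1 (this ▸ sq_nonneg _)
  -- the trace in the adapted basis
  set q := b0 * g1 - b1 * g0 with hq
  set r := b0 ^ 2 * g2 - 2 * b0 * b1 * g1 + b1 ^ 2 * g0 with hr
  have hP0 : 4 * d * b0 ^ 2 * p0 = (r - d * g0) * x - 2 * q * Y := by
    rw [hg] at h0
    linear_combination (norm := skip) b0 ^ 2 * h0 + g0 * hc
    rw [hr, hq, hY]; ring
  have hP1 : 4 * d * b0 ^ 2 * (b0 * p1 - b1 * p0) = (r - d * g0) * Y + 2 * q * d * x := by
    rw [hg] at h0 h1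
    linear_combination (norm := skip) b0 ^ 3 * h1 - b1 * b0 ^ 2 * h0 + g0 * he
      - (2 * b0 * g1 + b1 * g0) * hc
    rw [hr, hq, hY]; ring
  have hrg : r + d * g0 = 4 * d * b0 * B := by
    rw [hg] at htr
    linear_combination (norm := skip) b0 * htr
    rw [hr, hdd]; ring
  have hrq : r * g0 - q ^ 2 = 4 * d * b0 ^ 2 := by
    linear_combination (norm := skip) b0 ^ 2 * hg
    rw [hr, hq]; ring
  have hSp : S * d * b0 = d * p0 ^ 2 + (b0 * p1 - b1 * p0) ^ 2 := by
    linear_combination (norm := skip) b0 * hS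
    rw [hdd]; ring
  have hkey : (4 * d * b0 ^ 2) ^ 2 * (S * d * b0)
      = 16 * d ^ 2 * b0 ^ 2 * (B ^ 2 - 1) * (d * x ^ 2 + Y ^ 2) := by
    have e1 : (4 * d * b0 ^ 2) ^ 2 * (S * d * b0)
        = d * (4 * d * b0 ^ 2 * p0) ^ 2 + (4 * d * b0 ^ 2 * (b0 * p1 - b1 * p0)) ^ 2 := by
      rw [hSp]; ring
    rw [e1, hP0, hP1]
    have e2 : d * ((r - d * g0) * x - 2 * q * Y) ^ 2 + ((r - d * g0) * Y + 2 * q * d * x) ^ 2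
        = ((r + d * g0) ^ 2 - 4 * d * (r * g0 - q ^ 2)) * (d * x ^ 2 + Y ^ 2) := by ring
    rw [e2, hrg, hrq]; ring
  have hS3 : S * d * b0 ^ 3 = (B ^ 2 - 1) * (d * x ^ 2 + Y ^ 2) := by
    have : 16 * d ^ 2 * b0 ^ 2 ≠ 0 := by positivity
    apply mul_left_cancel₀ this
    linear_combination hkey
  by_cases hB : 0 ≤ B ^ 2 - 1
  · have h2 := mul_le_mul_of_nonneg_left hT2 hB
    have h3 : d * b0 ^ 6 * ((B ^ 2 - 1) * T ^ 2) ≤ d * b0 ^ 6 * (S * Q ^ 3) := by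
      calc d * b0 ^ 6 * ((B ^ 2 - 1) * T ^ 2) = (B ^ 2 - 1) * (d * (b0 ^ 3 * T) ^ 2) := by ring
        _ ≤ _ := h2
        _ = (S * d * b0 ^ 3) * (b0 * Q) ^ 3 := by rw [hS3]; ring
        _ = _ := by ring
    exact le_of_mul_le_mul_left h3 (by positivity)
  · exfalso
    have h4 : 4 * d * b0 ^ 2 * 4 * d * (B ^ 2 - 1) = (r - d * g0) ^ 2 + 4 * d * q ^ 2 := by
      linear_combination (norm := skip) (-(r + d * g0) - 4 * d * b0 * B) * hrg + 4 * d * hrq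
      ring
    have h5 : 0 ≤ (r - d * g0) ^ 2 + 4 * d * q ^ 2 := by positivity
    push Not at hB
    have h6 : 0 < 4 * d * b0 ^ 2 * 4 * d := by positivity
    have h7 := mul_neg_of_pos_of_neg h6 hB
    rw [h4] at h7
    exact absurd h7 (not_lt.2 h5)

variable {U : Set Plane} {G Z : Plane → Matrix (Fin 2) (Fin 2) ℝ} {f : Plane → ℝ} {p : Plane}

theorem pd_eq_covDeriv_add (G T : Plane → Matrix (Fin 2) (Fin 2) ℝ) (i j k : Fin 2) (p : Plane) :
    pd k (fun q => T q i j) p = covDeriv G T i j k p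
      + ((christoffel G 0 k i p * T p 0 j + christoffel G 0 k j p * T p i 0)
      + (christoffel G 1 k i p * T p 1 j + christoffel G 1 k j p * T p i 1)) := by
  unfold covDeriv
  simp only [Fin.sum_univ_two]
  ring

/-- The derivative of the Codazzi tensor is apolar to it. -/
theorem IsLocalSolution.apolar (h : IsLocalSolution U G Z f) (hp : p ∈ U) (k : Fin 2) :
    codazziTensor G Z f p 1 1 * covDeriv G (codazziTensor G Z f) 0 0 k p
      - 2 * (codazziTensor G Z f p 0 1 * covDeriv G (codazziTensor G Z f) 0 1 k p)
      + codazziTensor G Z f p 0 0 * covDeriv G (codazziTensor G Z f) 1 1 k p = 0 := by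
  have hU := h.isOpen
  have hG := h.metric
  have hdet := h.det_codazziTensor hp
  have hs := h.codazziTensor_symm hp 1 0
  have hb := fun i j => pd_eq_covDeriv_add G (codazziTensor G Z f) i j k p
  have db := fun i j => diffAt_of_contDiffOn (h.contDiffOn_codazziTensor i j) hU hp
  have dG := fun i j => hG.diffAt hp i j
  have e := pd_congr_on hU (fun q hq => h.det_codazziTensor hq) hp k
  simp only [div_eq_inv_mul] at e
  rw [pd_sub ((db 0 0).fun_mul (db 1 1)) ((db 0 1).fun_mul (db 0 1)), pd_mul (db 0 0) (db 1 1),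
    pd_mul (db 0 1) (db 0 1), pd_const_mul (((dG 0 0).fun_mul (dG 1 1)).fun_sub
      ((dG 0 1).fun_mul (dG 0 1))), pd_sub ((dG 0 0).fun_mul (dG 1 1)) ((dG 0 1).fun_mul (dG 0 1)),
    pd_mul (dG 0 0) (dG 1 1), pd_mul (dG 0 1) (dG 0 1), hb, hb, hb, hG.pd_metric hp,
    hG.pd_metric hp, hG.pd_metric hp, hG.symm p hp 1 0, hs] at e
  linear_combination e - 2 * (christoffel G 0 k 0 p + christoffel G 1 k 1 p) * hdet

theorem IsLocalSolution.pd_nonlinearTerm (h : IsLocalSolution U G Z f) (hp : p ∈ U) (k : Fin 2) :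
    pd k (nonlinearTerm G Z f) p * (G p 0 0 * G p 1 1 - G p 0 1 * G p 0 1)
      = G p 1 1 * covDeriv G (codazziTensor G Z f) 0 0 k p
      - 2 * (G p 0 1 * covDeriv G (codazziTensor G Z f) 0 1 k p)
      + G p 0 0 * covDeriv G (codazziTensor G Z f) 1 1 k p := by
  have hU := h.isOpen
  have hG := h.metric
  have htr := h.trace_codazziTensor hp
  have hs := h.codazziTensor_symm hp 1 0
  have hb := fun i j => pd_eq_covDeriv_add G (codazziTensor G Z f) i j k p
  have db := fun i j => diffAt_of_contDiffOn (h.contDiffOn_codazziTensor i j) hU hp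
  have dB := diffAt_of_contDiffOn h.contDiffOn_nonlinearTerm hU hp
  have dG := fun i j => hG.diffAt hp i j
  have e := pd_congr_on hU (fun q hq => h.trace_codazziTensor hq) hp k
  have d01 := (dG 0 1).fun_mul (db 0 1)
  have dd := ((dG 0 0).fun_mul (dG 1 1)).fun_sub ((dG 0 1).fun_mul (dG 0 1))
  rw [pd_add (((dG 1 1).fun_mul (db 0 0)).fun_sub (d01.const_mul 2)) ((dG 0 0).fun_mul (db 1 1)),
    pd_sub ((dG 1 1).fun_mul (db 0 0)) (d01.const_mul 2), pd_const_mul d01,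
    pd_mul (dG 1 1) (db 0 0), pd_mul (dG 0 1) (db 0 1), pd_mul (dG 0 0) (db 1 1),
    pd_mul dB dd, pd_sub ((dG 0 0).fun_mul (dG 1 1)) ((dG 0 1).fun_mul (dG 0 1)),
    pd_mul (dG 0 0) (dG 1 1), pd_mul (dG 0 1) (dG 0 1), hb, hb, hb, hG.pd_metric hp,
    hG.pd_metric hp, hG.pd_metric hp, hG.symm p hp 1 0, hs] at e
  linear_combination 2 * (christoffel G 0 k 0 p + christoffel G 1 k 1 p) * htr - e

/-- The value of a bilinear form. -/
def bil (T : Matrix (Fin 2) (Fin 2) ℝ) (v w : Plane) : ℝ :=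
  T 0 0 * (v 0 * w 0) + T 0 1 * (v 0 * w 1) + T 1 0 * (v 1 * w 0) + T 1 1 * (v 1 * w 1)

/-- The value of the covariant derivative `(∇_u T)(v, w)`. -/
def covBil (G T : Plane → Matrix (Fin 2) (Fin 2) ℝ) (p v w u : Plane) : ℝ :=
  u 0 * bil (Matrix.of fun i j => covDeriv G T i j 0 p) v w
    + u 1 * bil (Matrix.of fun i j => covDeriv G T i j 1 p) v w

theorem IsLocalSolution.covDeriv_symm (h : IsLocalSolution U G Z f) (hp : p ∈ U) (k : Fin 2) :
    covDeriv G (codazziTensor G Z f) 1 0 k p = covDeriv G (codazziTensor G Z f) 0 1 k p := by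
  have h1 : pd k (fun q => codazziTensor G Z f q 1 0) p = pd k (fun q => codazziTensor G Z f q 0 1) p :=
    pd_congr_on h.isOpen (fun q hq => h.codazziTensor_symm hq 1 0) hp k
  unfold covDeriv
  rw [h1]
  simp only [Fin.sum_univ_two, h.codazziTensor_symm hp 1 0]
  ring

theorem IsLocalSolution.covBil_sq_le (h : IsLocalSolution U G Z f) (hp : p ∈ U) (v : Plane) :
    (nonlinearTerm G Z f p ^ 2 - 1) * covBil G (codazziTensor G Z f) p v v v ^ 2
      ≤ gradSq (codazziTensor G Z f) (nonlinearTerm G Z f) p * bil (codazziTensor G Z f p) v v ^ 3 := by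
  have hm := h.isMetricOn_codazziTensor
  have hC := h.covDeriv_codazziTensor hp
  have hs := h.covDeriv_symm hp
  have hdet := h.det_codazziTensor hp
  have ap1 := h.apolar hp 1
  have tr1 := h.pd_nonlinearTerm hp 1
  have hC1 := hC 1
  rw [hs 1] at hC1
  rw [hC 0, hC1] at ap1 tr1
  have key := cubic_form_bound (v := v 0) (w := v 1) (hm.pos p hp) (hm.det_pos p hp)
    (by rw [hdet]; ring)
    (h.trace_codazziTensor hp) (h.apolar hp 0)
    ap1 (h.pd_nonlinearTerm hp 0) tr1 (hm.gradSq_mul_det hp)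
  have e1 : covBil G (codazziTensor G Z f) p v v v
      = covDeriv G (codazziTensor G Z f) 0 0 0 p * v 0 ^ 3
        + 3 * (covDeriv G (codazziTensor G Z f) 0 1 0 p * (v 0 ^ 2 * v 1))
        + 3 * (covDeriv G (codazziTensor G Z f) 1 1 0 p * (v 0 * v 1 ^ 2))
        + covDeriv G (codazziTensor G Z f) 1 1 1 p * v 1 ^ 3 := by
    simp only [covBil, bil, Matrix.of_apply]
    rw [hs 0, hs 1, hC 0, hC1]
    ring
  have e2 : bil (codazziTensor G Z f p) v v = codazziTensor G Z f p 0 0 * (v 0 * v 0)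
      + 2 * (codazziTensor G Z f p 0 1 * (v 0 * v 1)) + codazziTensor G Z f p 1 1 * (v 1 * v 1) := by
    simp only [bil]
    rw [h.codazziTensor_symm hp 1 0]
    ring
  rw [e1, e2]
  exact key

theorem IsLocalSolution.bil_symm (h : IsLocalSolution U G Z f) (hp : p ∈ U) (v w : Plane) :
    bil (codazziTensor G Z f p) v w = bil (codazziTensor G Z f p) w v := by
  simp only [bil]
  rw [h.codazziTensor_symm hp 1 0]
  ring

theorem IsLocalSolution.bil_nonneg (h : IsLocalSolution U G Z f) (hp : p ∈ U) (v : Plane) :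
    0 ≤ bil (codazziTensor G Z f p) v v := by
  have := h.codazziTensor_form_nonneg hp (v 0) (v 1)
  simp only [bil]
  rw [h.codazziTensor_symm hp 1 0]
  linarith

theorem IsLocalSolution.bil_metric_le (h : IsLocalSolution U G Z f) (hp : p ∈ U) (v : Plane) :
    bil (G p) v v ≤ 4 * nonlinearTerm G Z f p * bil (codazziTensor G Z f p) v v := by
  have hd := h.metric.det_pos p hp
  have htr := h.trace_codazziTensor hp
  have hdet := h.det_codazziTensor hp
  have hB : 1 ≤ nonlinearTerm G Z f p := one_le_nonlinearTerm
  set B := nonlinearTerm G Z f p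
  have hpos := form_nonneg_of_trace_of_det (h.metric.pos p hp) hd
    (x := 4 * B * codazziTensor G Z f p 0 0 - G p 0 0)
    (y := 4 * B * codazziTensor G Z f p 0 1 - G p 0 1)
    (z := 4 * B * codazziTensor G Z f p 1 1 - G p 1 1) (by
      have : G p 1 1 * (4 * B * codazziTensor G Z f p 0 0 - G p 0 0)
          - 2 * (G p 0 1 * (4 * B * codazziTensor G Z f p 0 1 - G p 0 1))
          + G p 0 0 * (4 * B * codazziTensor G Z f p 1 1 - G p 1 1)
          = (4 * B ^ 2 - 2) * (G p 0 0 * G p 1 1 - G p 0 1 * G p 0 1) := by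
        linear_combination 4 * B * htr
      rw [this]
      exact mul_nonneg (by nlinarith) hd.le) (by
      have : (4 * B * codazziTensor G Z f p 0 0 - G p 0 0)
          * (4 * B * codazziTensor G Z f p 1 1 - G p 1 1)
          - (4 * B * codazziTensor G Z f p 0 1 - G p 0 1)
          * (4 * B * codazziTensor G Z f p 0 1 - G p 0 1)
          = G p 0 0 * G p 1 1 - G p 0 1 * G p 0 1 := by
        linear_combination 16 * B ^ 2 * hdet - 4 * B * htr
      rw [this]
      exact hd.le) (v 0) (v 1)
  simp only [bil]
  rw [h.codazziTensor_symm hp 1 0, h.metric.symm p hp 1 0]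
  linarith

theorem IsLocalSolution.exists_bil_le (h : IsLocalSolution U G Z f) (hp : p ∈ U) :
    ∃ v : Plane, v ≠ 0 ∧
      2 * nonlinearTerm G Z f p * bil (codazziTensor G Z f p) v v ≤ bil (G p) v v := by
  have hd := h.metric.det_pos p hp
  have htr := h.trace_codazziTensor hp
  have hdet := h.det_codazziTensor hp
  have hB : 1 ≤ nonlinearTerm G Z f p := one_le_nonlinearTerm
  have hs := h.codazziTensor_symm hp 1 0
  have hsG := h.metric.symm p hp 1 0
  set B := nonlinearTerm G Z f p
  by_cases h0 : 2 * B * codazziTensor G Z f p 0 0 - G p 0 0 ≤ 0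
  · refine ⟨!₂[1, 0], fun hv => ?_, ?_⟩
    · have := congrFun (congrArg WithLp.ofLp hv) 0
      simp at this
    · simp [bil]; linarith
  · push Not at h0
    refine ⟨!₂[-(2 * B * codazziTensor G Z f p 0 1 - G p 0 1),
      2 * B * codazziTensor G Z f p 0 0 - G p 0 0], fun hv => ?_, ?_⟩
    · have := congrFun (congrArg WithLp.ofLp hv) 1
      simp at this
      linarith
    · have hd2 : (2 * B * codazziTensor G Z f p 0 0 - G p 0 0)
          * (2 * B * codazziTensor G Z f p 1 1 - G p 1 1)
          - (2 * B * codazziTensor G Z f p 0 1 - G p 0 1)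
          * (2 * B * codazziTensor G Z f p 0 1 - G p 0 1) ≤ 0 := by
        have : (2 * B * codazziTensor G Z f p 0 0 - G p 0 0)
          * (2 * B * codazziTensor G Z f p 1 1 - G p 1 1)
          - (2 * B * codazziTensor G Z f p 0 1 - G p 0 1)
          * (2 * B * codazziTensor G Z f p 0 1 - G p 0 1)
          = (1 - B ^ 2) * (G p 0 0 * G p 1 1 - G p 0 1 * G p 0 1) := by
          linear_combination 4 * B ^ 2 * hdet - 2 * B * htr
        rw [this]
        exact mul_nonpos_of_nonpos_of_nonneg (by nlinarith) hd.le
      have h3 := mul_nonpos_of_nonneg_of_nonpos h0.le hd2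
      simp only [bil, Matrix.cons_val_zero, Matrix.cons_val_one]
      rw [hs, hsG]
      linarith

/-- The quadratic vector expression `Γ^k_{ij} v^i w^j`. -/
def gam (G : Plane → Matrix (Fin 2) (Fin 2) ℝ) (p v w : Plane) : Plane :=
  !₂[bil (Matrix.of fun i j => christoffel G 0 i j p) v w,
    bil (Matrix.of fun i j => christoffel G 1 i j p) v w]

theorem hasDerivAt_apply {V : ℝ → Plane} {V' : Plane} {x : ℝ} (h : HasDerivAt V V' x) (i : Fin 2) :
    HasDerivAt (fun x => V x i) (V' i) x :=
  (EuclideanSpace.proj i : Plane →L[ℝ] ℝ).hasFDerivAt.comp_hasDerivAt x h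

/-- The derivative of a bilinear form along a curve, in terms of covariant derivatives. -/
theorem hasDerivAt_bil {T : Plane → Matrix (Fin 2) (Fin 2) ℝ} {P V W : ℝ → Plane}
    {P' V' W' : Plane} {x : ℝ} (hT : ∀ i j, DifferentiableAt ℝ (fun q => T q i j) (P x))
    (hP : HasDerivAt P P' x) (hV : HasDerivAt V V' x) (hW : HasDerivAt W W' x) :
    HasDerivAt (fun x => bil (T (P x)) (V x) (W x))
      (covBil G T (P x) (V x) (W x) P' + bil (T (P x)) (V' + gam G (P x) P' (V x)) (W x)
        + bil (T (P x)) (V x) (W' + gam G (P x) P' (W x))) x := by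
  have t := fun i j => hasDerivAt_comp_curve (hT i j) hP
  have v := hasDerivAt_apply hV
  have w := hasDerivAt_apply hW
  have m := fun i j => (t i j).fun_mul ((v i).fun_mul (w j))
  refine (((m 0 0).fun_add (m 0 1)).fun_add (m 1 0) |>.fun_add (m 1 1)).congr_deriv ?_
  simp only [pd_eq_covDeriv_add G T]
  simp only [bil, covBil, gam, PiLp.add_apply, Matrix.of_apply, Matrix.cons_val_zero,
    Matrix.cons_val_one]
  ring

theorem IsLocalSolution.covBil_comm (h : IsLocalSolution U G Z f) (hp : p ∈ U) (v w u : Plane) :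
    covBil G (codazziTensor G Z f) p v w u = covBil G (codazziTensor G Z f) p v u w := by
  have hC := h.covDeriv_codazziTensor hp
  simp only [covBil, bil, Matrix.of_apply]
  rw [hC 0, hC 1]
  ring

theorem IsMetricOn.gam_symm (hG : IsMetricOn U G) (hp : p ∈ U) (v w : Plane) :
    gam G p v w = gam G p w v := by
  ext i
  fin_cases i <;>
  · simp [gam, bil, hG.christoffel_symm hp _ 1 0]
    ring

end Cubic

/-! ### Bounded geometry and geodesics in a coordinate ball -/

section Geodesic

open Set Metric

variable {U : Set Plane} {G : Plane → Matrix (Fin 2) (Fin 2) ℝ} {p₀ : Plane}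

theorem norm_sq_plane (v : Plane) : ‖v‖ ^ 2 = v 0 ^ 2 + v 1 ^ 2 := by
  rw [EuclideanSpace.real_norm_sq_eq, Fin.sum_univ_two]

theorem abs_apply_le_norm (v : Plane) (i : Fin 2) : |v i| ≤ ‖v‖ := by
  simpa using PiLp.norm_apply_le v i

theorem norm_le_abs_add_abs (v : Plane) : ‖v‖ ≤ |v 0| + |v 1| := by
  refine abs_le_of_sq_le_sq' ?_ (by positivity) |>.2
  rw [norm_sq_plane, ← sq_abs (v 0), ← sq_abs (v 1)]
  nlinarith [abs_nonneg (v 0), abs_nonneg (v 1)]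

theorem abs_bil_le {T : Matrix (Fin 2) (Fin 2) ℝ} {L : ℝ} (hT : ∀ i j, |T i j| ≤ L) (v w : Plane) :
    |bil T v w| ≤ 4 * L * ‖v‖ * ‖w‖ := by
  have hL : 0 ≤ L := (abs_nonneg _).trans (hT 0 0)
  have h : ∀ i j, |T i j * (v i * w j)| ≤ L * (‖v‖ * ‖w‖) := fun i j => by
    rw [abs_mul, abs_mul]
    have := hT i j
    have := abs_apply_le_norm v i
    have := abs_apply_le_norm w j
    gcongr
  unfold bil
  refine (abs_add_le _ _).trans ((add_le_add ((abs_add_le _ _).trans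
    (add_le_add ((abs_add_le _ _).trans (add_le_add (h 0 0) (h 0 1))) (h 1 0))) (h 1 1)).trans ?_)
  linarith

/-- Uniform control of the metric, the connection, and its modulus of continuity. -/
structure IsTameOn (W : Set Plane) (G : Plane → Matrix (Fin 2) (Fin 2) ℝ) (Λ : ℝ) : Prop where
  one_le : 1 ≤ Λ
  lower : ∀ P ∈ W, ∀ v, ‖v‖ ^ 2 ≤ Λ * bil (G P) v v
  upper : ∀ P ∈ W, ∀ v, bil (G P) v v ≤ Λ * ‖v‖ ^ 2
  gam_le : ∀ P ∈ W, ∀ v w, ‖gam G P v w‖ ≤ Λ * ‖v‖ * ‖w‖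
  gam_lip : ∀ P ∈ W, ∀ Q ∈ W, ∀ v w,
    ‖gam G P v w - gam G Q v w‖ ≤ Λ * ‖P - Q‖ * ‖v‖ * ‖w‖

theorem IsMetricOn.exists_isTameOn (hG : IsMetricOn U G) (hp : p₀ ∈ U) :
    ∃ R > 0, closedBall p₀ R ⊆ U ∧ ∃ Λ, IsTameOn (closedBall p₀ R) G Λ := by
  set Γ : Plane → (Fin 2 → Fin 2 → Fin 2 → ℝ) := fun P k i j => christoffel G k i j P with hΓ
  have hΓs : ContDiffOn ℝ ∞ Γ U := contDiffOn_pi.2 fun k => contDiffOn_pi.2 fun i =>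
    contDiffOn_pi.2 fun j => hG.contDiffOn_christoffel k i j
  obtain ⟨K, s, hs, hK⟩ := ((hΓs.contDiffAt (hG.isOpen.mem_nhds hp)).of_le
    (by exact_mod_cast le_top : (1 : WithTop ℕ∞) ≤ ∞)).exists_lipschitzOnWith
  obtain ⟨R, hR, hRs⟩ := nhds_basis_closedBall.mem_iff.1
    (Filter.inter_mem hs (hG.isOpen.mem_nhds hp))
  have hRU : closedBall p₀ R ⊆ U := hRs.trans inter_subset_right
  have hcomp : IsCompact (closedBall p₀ R) := isCompact_closedBall p₀ R
  obtain ⟨LΓ, hLΓ⟩ := hcomp.exists_bound_of_continuousOn (hΓs.continuousOn.mono hRU)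
  set g : Plane → (Fin 2 → Fin 2 → ℝ) := fun P i j => G P i j with hg
  have hgs : ContinuousOn g U := continuousOn_pi.2 fun i => continuousOn_pi.2 fun j =>
    (hG.smooth i j).continuousOn
  obtain ⟨Lg, hLg⟩ := hcomp.exists_bound_of_continuousOn (hgs.mono hRU)
  have hne : (closedBall p₀ R).Nonempty := ⟨p₀, mem_closedBall_self hR.le⟩
  have hdc : ContinuousOn (fun P => G P 0 0 * G P 1 1 - G P 0 1 * G P 0 1) U :=
    ((hG.smooth 0 0).continuousOn.mul (hG.smooth 1 1).continuousOn).sub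
      ((hG.smooth 0 1).continuousOn.mul (hG.smooth 0 1).continuousOn)
  obtain ⟨P₁, hP₁, hmin⟩ := hcomp.exists_isMinOn hne (hdc.mono hRU)
  set m := G P₁ 0 0 * G P₁ 1 1 - G P₁ 0 1 * G P₁ 0 1 with hm
  have hm0 : 0 < m := hG.det_pos P₁ (hRU hP₁)
  have cΓ : ∀ P ∈ closedBall p₀ R, ∀ k i j, |christoffel G k i j P| ≤ LΓ := fun P hP k i j =>
    (norm_le_pi_norm (Γ P k i) j).trans ((norm_le_pi_norm (Γ P k) i).trans
      ((norm_le_pi_norm (Γ P) k).trans (hLΓ P hP)))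
  have cG : ∀ P ∈ closedBall p₀ R, ∀ i j, |G P i j| ≤ Lg := fun P hP i j =>
    (norm_le_pi_norm (g P i) j).trans ((norm_le_pi_norm (g P) i).trans (hLg P hP))
  have cK : ∀ P ∈ closedBall p₀ R, ∀ Q ∈ closedBall p₀ R, ∀ k i j,
      |christoffel G k i j P - christoffel G k i j Q| ≤ K * ‖P - Q‖ := by
    intro P hP Q hQ k i j
    have h1 := hK.norm_sub_le (hRs hP).1 (hRs hQ).1
    exact (norm_le_pi_norm ((Γ P - Γ Q) k i) j).trans ((norm_le_pi_norm ((Γ P - Γ Q) k) i).trans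
      ((norm_le_pi_norm (Γ P - Γ Q) k).trans h1))
  have hLΓ0 : 0 ≤ LΓ := (abs_nonneg _).trans (cΓ p₀ (mem_closedBall_self hR.le) 0 0 0)
  have hLg0 : 0 ≤ Lg := (abs_nonneg _).trans (cG p₀ (mem_closedBall_self hR.le) 0 0)
  refine ⟨R, hR, hRU, 1 + 2 * Lg / m + 4 * Lg + 8 * LΓ + 8 * K, ?_, ?_, ?_, ?_, ?_⟩
  · have : 0 ≤ 2 * Lg / m := by positivity
    have : (0 : ℝ) ≤ 8 * K := by positivity
    linarith
  · intro P hP v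
    have hd : m ≤ G P 0 0 * G P 1 1 - G P 0 1 * G P 0 1 := hmin hP
    have hs := hG.symm P (hRU hP) 1 0
    have h0 : 0 ≤ bil (G P) v v := by
      have := form_nonneg_of_coeff (hG.pos P (hRU hP)) (hm0.le.trans hd) (v 0) (v 1)
      simp only [bil]; rw [hs]; linarith
    have h1 : m * ‖v‖ ^ 2 ≤ 2 * Lg * bil (G P) v v := by
      calc m * ‖v‖ ^ 2 ≤ (G P 0 0 * G P 1 1 - G P 0 1 * G P 0 1) * ‖v‖ ^ 2 := by gcongr
        _ ≤ (G P 0 0 + G P 1 1) * bil (G P) v v := by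
          rw [norm_sq_plane, ← sub_nonneg]
          simp only [bil]; rw [hs]
          have : 0 ≤ (G P 0 0 * v 0 + G P 0 1 * v 1) ^ 2 + (G P 0 1 * v 0 + G P 1 1 * v 1) ^ 2 := by
            positivity
          linarith
        _ ≤ 2 * Lg * bil (G P) v v := by
          have := (le_abs_self _).trans (cG P hP 0 0)
          have := (le_abs_self _).trans (cG P hP 1 1)
          gcongr; linarith
    have h2 : ‖v‖ ^ 2 ≤ 2 * Lg / m * bil (G P) v v := by
      rw [div_mul_eq_mul_div, le_div_iff₀ hm0]; linarith
    have h3 : 0 ≤ (1 + 4 * Lg + 8 * LΓ + 8 * K) * bil (G P) v v := by positivity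
    linarith
  · intro P hP v
    have h1 := (le_abs_self _).trans (abs_bil_le (cG P hP) v v)
    have : 0 ≤ (1 + 2 * Lg / m + 8 * LΓ + 8 * K) * ‖v‖ ^ 2 := by positivity
    nlinarith
  · intro P hP v w
    have h1 := fun k => abs_bil_le (T := Matrix.of fun i j => christoffel G k i j P)
      (fun i j => cΓ P hP k i j) v w
    have h2 : ‖gam G P v w‖ ≤ 4 * LΓ * ‖v‖ * ‖w‖ + 4 * LΓ * ‖v‖ * ‖w‖ :=
      (norm_le_abs_add_abs _).trans (add_le_add (h1 0) (h1 1))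
    have : 0 ≤ (1 + 2 * Lg / m + 4 * Lg + 8 * K) * (‖v‖ * ‖w‖) := by positivity
    linarith
  · intro P hP Q hQ v w
    have h1 := fun k => abs_bil_le
      (T := Matrix.of fun i j => christoffel G k i j P - christoffel G k i j Q)
      (fun i j => cK P hP Q hQ k i j) v w
    have h2 : ∀ k, (gam G P v w - gam G Q v w) k
        = bil (Matrix.of fun i j => christoffel G k i j P - christoffel G k i j Q) v w := by
      intro k
      fin_cases k <;> simp [gam, bil] <;> ring
    have h3 : ‖gam G P v w - gam G Q v w‖
        ≤ 4 * (K * ‖P - Q‖) * ‖v‖ * ‖w‖ + 4 * (K * ‖P - Q‖) * ‖v‖ * ‖w‖ := by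
      refine (norm_le_abs_add_abs _).trans (add_le_add ?_ ?_)
      · rw [h2]; exact h1 0
      · rw [h2]; exact h1 1
    have : 0 ≤ (1 + 2 * Lg / m + 4 * Lg + 8 * LΓ) * (‖P - Q‖ * ‖v‖ * ‖w‖) := by positivity
    linarith

theorem contDiffOn_gam (hG : IsMetricOn U G) :
    ContDiffOn ℝ ∞ (fun z : Plane × Plane => gam G z.1 z.2 z.2) (U ×ˢ univ) := by
  rw [contDiffOn_euclidean]
  have hc : ∀ k i j, ContDiffOn ℝ ∞ (fun z : Plane × Plane => christoffel G k i j z.1)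
      (U ×ˢ univ) := fun k i j =>
    (hG.contDiffOn_christoffel k i j).comp contDiffOn_fst fun z hz => hz.1
  have hv : ∀ i, ContDiffOn ℝ ∞ (fun z : Plane × Plane => z.2 i) (U ×ˢ univ) := fun i =>
    (EuclideanSpace.proj i : Plane →L[ℝ] ℝ).contDiff.comp_contDiffOn contDiffOn_snd
  have hb : ∀ k, ContDiffOn ℝ ∞ (fun z : Plane × Plane =>
      bil (Matrix.of fun i j => christoffel G k i j z.1) z.2 z.2) (U ×ˢ univ) := by
    intro k
    have m := fun i j => (hc k i j).mul ((hv i).mul (hv j))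
    exact (((m 0 0).add (m 0 1)).add (m 1 0)).add (m 1 1)
  intro k
  fin_cases k
  · exact hb 0
  · exact hb 1

/-- Geodesics of a fixed small speed exist for a uniform time. -/
theorem IsMetricOn.exists_geodesics (hG : IsMetricOn U G) {R Λ : ℝ} (hR : 0 < R)
    (hRU : closedBall p₀ R ⊆ U) (ht : IsTameOn (closedBall p₀ R) G Λ) :
    ∃ r > 0, r ≤ 1 ∧ ∃ ℓ > 0, ∀ p ∈ closedBall p₀ r, ∀ v : Plane, ‖v‖ = r →
      ∃ γ w : ℝ → Plane, γ 0 = p ∧ w 0 = v ∧ ∀ t ∈ Icc 0 ℓ, HasDerivAt γ (w t) t ∧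
        HasDerivAt w (-gam G (γ t) (w t) (w t)) t ∧ γ t ∈ closedBall p₀ (R / 2) ∧
        ‖w t - v‖ ≤ r / 4 := by
  set X : Plane × Plane → Plane × Plane := fun z => (z.2, -gam G z.1 z.2 z.2) with hX
  have hp : p₀ ∈ U := hRU (mem_closedBall_self hR.le)
  have hXs : ContDiffAt ℝ 1 X (p₀, 0) := by
    have h1 : ContDiffOn ℝ ∞ X (U ×ˢ univ) := contDiffOn_snd.prodMk (contDiffOn_gam hG).neg
    exact (h1.contDiffAt ((hG.isOpen.prod isOpen_univ).mem_nhds ⟨hp, mem_univ _⟩)).of_le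
      (by exact_mod_cast le_top)
  obtain ⟨ε, hε, a, r₁, L, K, hr₁, hpl⟩ := IsPicardLindelof.of_contDiffAt_one hXs
  obtain ⟨α, hα, hαc⟩ := (hpl 0).exists_forall_mem_closedBall_eq_hasDerivWithinAt_continuousOn
  simp only [zero_sub, zero_add] at hα hαc
  have hα0 : α ((p₀, 0), 0) = (p₀, 0) := (hα _ (mem_closedBall_self (by positivity))).1
  have hcw := hαc ((p₀, 0), 0) ⟨mem_closedBall_self (by positivity), by constructor <;> linarith⟩
  rw [Metric.continuousWithinAt_iff] at hcw
  obtain ⟨δ, hδ, hcw⟩ := hcw (min (R / 2) 1) (by positivity)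
  rw [hα0] at hcw
  have hΛ := ht.one_le
  set r := min (min (r₁ : ℝ) 1) (δ / 2) with hr
  have hr0 : 0 < r := by positivity
  have hr₁' : r ≤ r₁ := (min_le_left _ _).trans (min_le_left _ _)
  have hrδ : r < δ := (min_le_right _ _).trans_lt (by linarith)
  set ℓ := min (min (ε / 2) (δ / 2)) (r / (4 * Λ)) with hℓ
  have hℓ0 : 0 < ℓ := by positivity
  have hℓε : ℓ < ε := ((min_le_left _ _).trans (min_le_left _ _)).trans_lt (by linarith)
  have hℓδ : ℓ < δ := ((min_le_left _ _).trans (min_le_right _ _)).trans_lt (by linarith)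
  have hℓΛ : Λ * ℓ ≤ r / 4 := by
    have : ℓ ≤ r / (4 * Λ) := min_le_right _ _
    rw [le_div_iff₀ (by positivity)] at this
    linarith
  refine ⟨r, hr0, (min_le_left _ _).trans (min_le_right _ _), ℓ, hℓ0, ?_⟩
  intro p hpr v hv
  have hx : ((p, v) : Plane × Plane) ∈ closedBall (p₀, 0) r := by
    rw [mem_closedBall, Prod.dist_eq]
    simp only [dist_zero_right, hv, sup_le_iff]
    exact ⟨hpr, le_rfl⟩
  have hx₁ := closedBall_subset_closedBall hr₁' hx
  obtain ⟨hi, hd⟩ := hα _ hx₁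
  have hin : ∀ t ∈ Icc 0 ℓ, dist (α ((p, v), t)) (p₀, 0) < min (R / 2) 1 := by
    intro t ht
    refine hcw ⟨hx₁, by constructor <;> linarith [ht.1, ht.2]⟩ ?_
    rw [Prod.dist_eq, sup_lt_iff]
    refine ⟨hx.trans_lt hrδ, ?_⟩
    rw [Real.dist_eq, sub_zero, abs_of_nonneg ht.1]
    linarith [ht.2]
  have hder : ∀ t ∈ Icc 0 ℓ, HasDerivAt (fun t => α ((p, v), t)) (X (α ((p, v), t))) t := by
    intro t ht
    exact (hd t (by constructor <;> linarith [ht.1, ht.2])).hasDerivAt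
      (Icc_mem_nhds (by linarith [ht.1]) (by linarith [ht.2]))
  have hγ : ∀ t ∈ Icc 0 ℓ, (α ((p, v), t)).1 ∈ closedBall p₀ (R / 2) := by
    intro t ht
    have := (hin t ht).le.trans (min_le_left _ _)
    rw [Prod.dist_eq, sup_le_iff] at this
    exact this.1
  have hw : ∀ t ∈ Icc 0 ℓ, ‖(α ((p, v), t)).2‖ ≤ 1 := by
    intro t ht
    have := (hin t ht).le.trans (min_le_right _ _)
    rw [Prod.dist_eq, sup_le_iff] at this
    simpa using this.2
  have h1 : ∀ t ∈ Icc 0 ℓ, HasDerivAt (fun t => (α ((p, v), t)).1) ((α ((p, v), t)).2) t :=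
    fun t ht => (ContinuousLinearMap.fst ℝ Plane Plane).hasFDerivAt.comp_hasDerivAt t (hder t ht)
  have h2 : ∀ t ∈ Icc 0 ℓ, HasDerivAt (fun t => (α ((p, v), t)).2)
      (-gam G (α ((p, v), t)).1 (α ((p, v), t)).2 (α ((p, v), t)).2) t :=
    fun t ht => (ContinuousLinearMap.snd ℝ Plane Plane).hasFDerivAt.comp_hasDerivAt t (hder t ht)
  refine ⟨fun t => (α ((p, v), t)).1, fun t => (α ((p, v), t)).2, ?_, ?_, ?_⟩
  · exact congrArg Prod.fst hi
  · exact congrArg Prod.snd hi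
  · intro t htt
    refine ⟨h1 t htt, h2 t htt, hγ t htt, ?_⟩
    have hb := norm_image_sub_le_of_norm_deriv_le_segment' (C := Λ)
      (fun t ht => (h2 t ht).hasDerivWithinAt (s := Icc 0 ℓ)) (fun t ht' => by
        have ht'' := Ico_subset_Icc_self ht'
        rw [norm_neg]
        refine (ht.gam_le _ (closedBall_subset_closedBall (by linarith) (hγ t ht'')) _ _).trans ?_
        have := hw t ht''
        calc Λ * ‖(α ((p, v), t)).2‖ * ‖(α ((p, v), t)).2‖ ≤ Λ * 1 * 1 := by gcongr
          _ = Λ := by ring) t htt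
    have hi2 : (α ((p, v), 0)).2 = v := congrArg Prod.snd hi
    rw [hi2, sub_zero] at hb
    refine hb.trans ((mul_le_mul_of_nonneg_left htt.2 (by linarith)).trans hℓΛ)

end Geodesic

/-! ### Sweeping out a neighbourhood of a geodesic -/

section SweepGeodesic

open Set Metric

variable {X : Type*} [TopologicalSpace X] {S : Set X}

theorem continuousOn_bil {T : X → Matrix (Fin 2) (Fin 2) ℝ} {v w : X → Plane}
    (hT : ∀ i j, ContinuousOn (fun z => T z i j) S) (hv : ContinuousOn v S)
    (hw : ContinuousOn w S) : ContinuousOn (fun z => bil (T z) (v z) (w z)) S := by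
  have cv : ∀ i, ContinuousOn (fun z => v z i) S := fun i =>
    (EuclideanSpace.proj i : Plane →L[ℝ] ℝ).continuous.comp_continuousOn hv
  have cw : ∀ i, ContinuousOn (fun z => w z i) S := fun i =>
    (EuclideanSpace.proj i : Plane →L[ℝ] ℝ).continuous.comp_continuousOn hw
  have m := fun i j => (hT i j).mul ((cv i).mul (cw j))
  exact (((m 0 0).add (m 0 1)).add (m 1 0)).add (m 1 1)

theorem continuousOn_gam {G : Plane → Matrix (Fin 2) (Fin 2) ℝ} {P v w : X → Plane}
    (hΓ : ∀ k i j, ContinuousOn (fun z => christoffel G k i j (P z)) S) (hv : ContinuousOn v S)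
    (hw : ContinuousOn w S) : ContinuousOn (fun z => gam G (P z) (v z) (w z)) S := by
  have h : ContinuousOn (fun z => ![bil (Matrix.of fun i j => christoffel G 0 i j (P z)) (v z) (w z),
      bil (Matrix.of fun i j => christoffel G 1 i j (P z)) (v z) (w z)]) S := by
    rw [continuousOn_pi]
    intro k
    fin_cases k
    · exact continuousOn_bil (fun i j => hΓ 0 i j) hv hw
    · exact continuousOn_bil (fun i j => hΓ 1 i j) hv hw
  exact (PiLp.continuous_toLp 2 (fun _ : Fin 2 => ℝ)).comp_continuousOn h

theorem continuousOn_covBil {G T : Plane → Matrix (Fin 2) (Fin 2) ℝ} {P v w u : X → Plane}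
    (hT : ∀ i j k, ContinuousOn (fun z => covDeriv G T i j k (P z)) S) (hv : ContinuousOn v S)
    (hw : ContinuousOn w S) (hu : ContinuousOn u S) :
    ContinuousOn (fun z => covBil G T (P z) (v z) (w z) (u z)) S := by
  have cu : ∀ i, ContinuousOn (fun z => u z i) S := fun i =>
    (EuclideanSpace.proj i : Plane →L[ℝ] ℝ).continuous.comp_continuousOn hu
  exact ((cu 0).mul (continuousOn_bil (fun i j => hT i j 0) hv hw)).add
    ((cu 1).mul (continuousOn_bil (fun i j => hT i j 1) hv hw))

variable {U : Set Plane} {G Z : Plane → Matrix (Fin 2) (Fin 2) ℝ} {f : Plane → ℝ} {p₀ P : Plane}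
  {R Λ : ℝ}

theorem bil_metric_symm (hG : IsMetricOn U G) (hP : P ∈ U) (v : Plane) :
    bil (G P) v v = G P 0 0 * (v 0 * v 0) + 2 * (G P 0 1 * (v 0 * v 1)) + G P 1 1 * (v 1 * v 1) := by
  simp only [bil]; rw [hG.symm P hP 1 0]; ring

theorem IsTameOn.one_le_det {W : Set Plane} (ht : IsTameOn W G Λ) (hG : IsMetricOn U G)
    (hP : P ∈ W) (hPU : P ∈ U) : 1 ≤ Λ ^ 2 * (G P 0 0 * G P 1 1 - G P 0 1 * G P 0 1) := by
  have hΛ := ht.one_le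
  have h0 := hG.pos P hPU
  have e0 := ht.lower P hP !₂[1, 0]
  have e1 := ht.lower P hP !₂[-G P 0 1, G P 0 0]
  rw [bil_metric_symm hG hPU, norm_sq_plane] at e0 e1
  simp only [Matrix.cons_val_zero, Matrix.cons_val_one] at e0 e1
  have h1 : G P 0 0 * G P 0 0 ≤ G P 0 0 * (Λ * (G P 0 0 * G P 1 1 - G P 0 1 * G P 0 1)) := by
    nlinarith [sq_nonneg (G P 0 1)]
  have h2 := le_of_mul_le_mul_left h1 h0
  calc (1 : ℝ) ≤ Λ * G P 0 0 := by linarith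
    _ ≤ Λ * (Λ * (G P 0 0 * G P 1 1 - G P 0 1 * G P 0 1)) := by gcongr
    _ = _ := by ring

theorem IsTameOn.abs_pd_le {W : Set Plane} (ht : IsTameOn W G Λ) (hG : IsMetricOn U G)
    (hP : P ∈ W) (hPU : P ∈ U) {D : ℝ} (hD : 0 ≤ D) (hf : gradSq G f P ≤ D ^ 2) (i : Fin 2) :
    |pd i f P| ≤ Λ ^ 2 * D := by
  have hΛ := ht.one_le
  have h1 := hG.gradSq_mul_det (f := f) hPU
  have hd := hG.det_pos P hPU
  have e1 := ht.lower P hP !₂[pd 1 f P, -pd 0 f P]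
  have u0 := ht.upper P hP !₂[1, 0]
  have u1 := ht.upper P hP !₂[0, 1]
  rw [bil_metric_symm hG hPU, norm_sq_plane] at e1 u0 u1
  simp only [Matrix.cons_val_zero, Matrix.cons_val_one] at e1 u0 u1
  have hdet : G P 0 0 * G P 1 1 - G P 0 1 * G P 0 1 ≤ Λ ^ 2 := by
    have : G P 0 0 * G P 1 1 ≤ Λ * Λ := by
      have := (hG.pos P hPU).le
      have h11 : 0 ≤ G P 1 1 := by nlinarith [sq_nonneg (G P 0 1), hG.pos P hPU]
      have : G P 0 0 ≤ Λ := by linarith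
      have : G P 1 1 ≤ Λ := by linarith
      gcongr
    nlinarith [sq_nonneg (G P 0 1)]
  have h2 : gradSq G f P * (G P 0 0 * G P 1 1 - G P 0 1 * G P 0 1) ≤ D ^ 2 * Λ ^ 2 := by
    calc gradSq G f P * (G P 0 0 * G P 1 1 - G P 0 1 * G P 0 1)
        ≤ D ^ 2 * (G P 0 0 * G P 1 1 - G P 0 1 * G P 0 1) := by gcongr
      _ ≤ _ := by gcongr
  have h3 : pd 0 f P ^ 2 + pd 1 f P ^ 2 ≤ (Λ ^ 2 * D) ^ 2 := by
    calc pd 0 f P ^ 2 + pd 1 f P ^ 2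
        ≤ Λ * (gradSq G f P * (G P 0 0 * G P 1 1 - G P 0 1 * G P 0 1)) := by rw [h1]; linarith
      _ ≤ Λ * (D ^ 2 * Λ ^ 2) := by gcongr
      _ ≤ Λ ^ 2 * (D ^ 2 * Λ ^ 2) := by gcongr; nlinarith
      _ = _ := by ring
  refine abs_le_of_sq_le_sq ?_ (by positivity)
  fin_cases i
  · exact (le_add_of_nonneg_right (sq_nonneg _)).trans h3
  · exact (le_add_of_nonneg_left (sq_nonneg _)).trans h3

/-- The second derivative of the solution in a direction controls the Codazzi tensor. -/
theorem IsLocalSolution.bil_codazziTensor_le (h : IsLocalSolution U G Z f) {W : Set Plane}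
    (ht : IsTameOn W G Λ) (hP : P ∈ W) (hPU : P ∈ U) {s : ℝ} (hs : 0 ≤ s)
    (hZ : tensorNorm G P (Z P) ≤ s) (hgrad : gradSq G f P ≤ (3 * (1 + s)) ^ 2)
    (hf : f P ≤ 1 + 2 * s) {n : Plane} (hn : ‖n‖ ≤ 1) :
    bil (codazziTensor G Z f P) n n
      ≤ -(n 0 * (n 0 * pd 0 (pd 0 f) P + n 1 * pd 1 (pd 0 f) P)
        + n 1 * (n 0 * pd 0 (pd 1 f) P + n 1 * pd 1 (pd 1 f) P)) + 8 * Λ ^ 3 * (1 + s) := by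
  have hΛ := ht.one_le
  have hG := h.metric
  have e : bil (codazziTensor G Z f P) n n
      = -(n 0 * (n 0 * pd 0 (pd 0 f) P + n 1 * pd 1 (pd 0 f) P)
        + n 1 * (n 0 * pd 0 (pd 1 f) P + n 1 * pd 1 (pd 1 f) P))
        + (bil (Z P) n n + (gam G P n n 0 * pd 0 f P + gam G P n n 1 * pd 1 f P)
        + 1 / 2 * (f P * bil (G P) n n)) := by
    simp only [bil, codazziTensor, hess, gam, Matrix.of_apply, Fin.sum_univ_two,
      Matrix.cons_val_zero, Matrix.cons_val_one]
    ring
  have hGn0 : 0 ≤ bil (G P) n n := by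
    have := ht.lower P hP n
    have h2 : 0 ≤ Λ * bil (G P) n n := (sq_nonneg _).trans this
    exact nonneg_of_mul_nonneg_right h2 (by linarith)
  have hn2 : ‖n‖ ^ 2 ≤ 1 := pow_le_one₀ (norm_nonneg _) hn
  have hGn : bil (G P) n n ≤ Λ := by
    refine (ht.upper P hP n).trans ?_
    nlinarith
  have hZn : bil (Z P) n n ≤ s * Λ := by
    have h1 := hG.form_le_tensorNorm hPU (T := Z P) (h.tensor_symm P hPU 1 0) (n 0) (n 1)
    rw [← bil_metric_symm hG hPU] at h1
    have h2 : bil (Z P) n n ≤ tensorNorm G P (Z P) * bil (G P) n n := by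
      refine le_of_eq_of_le ?_ h1
      simp only [bil]; rw [h.tensor_symm P hPU 1 0]; ring
    refine h2.trans ?_
    gcongr
  have hfn : 1 / 2 * (f P * bil (G P) n n) ≤ 1 / 2 * ((1 + 2 * s) * Λ) := by
    have : f P * bil (G P) n n ≤ (1 + 2 * s) * Λ := by
      calc f P * bil (G P) n n ≤ (1 + 2 * s) * bil (G P) n n := by gcongr
        _ ≤ _ := by gcongr
    linarith
  have hpd := ht.abs_pd_le hG hP hPU (D := 3 * (1 + s)) (by positivity) hgrad
  have hgam : ∀ k, |gam G P n n k| ≤ Λ := fun k => by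
    refine (abs_apply_le_norm _ k).trans ((ht.gam_le P hP n n).trans ?_)
    calc Λ * ‖n‖ * ‖n‖ ≤ Λ * 1 * 1 := by gcongr
      _ = Λ := by ring
  have hk : ∀ k, gam G P n n k * pd k f P ≤ Λ * (Λ ^ 2 * (3 * (1 + s))) := fun k => by
    refine (le_abs_self _).trans ?_
    rw [abs_mul]
    have := hgam k
    have := hpd k
    gcongr
  have := hk 0
  have := hk 1
  rw [e]
  have hΛ3 : Λ * (1 + s) ≤ Λ ^ 3 * (1 + s) := by
    gcongr; nlinarith [sq_nonneg (Λ - 1)]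
  have hsΛ : 0 ≤ s * Λ := by positivity
  nlinarith

/-- Expansion of a vector in a frame that is close to orthogonal. -/
theorem abs_bil_le_of_frame {T : Matrix (Fin 2) (Fin 2) ℝ} {n w Y : Plane} {r : ℝ} (hr : 0 < r)
    (hn : ‖n‖ = r) (hw : ‖w‖ ≤ 5 / 4 * r) (hd : 3 / 4 * r ^ 2 ≤ w 0 * n 1 - w 1 * n 0) (z : Plane) :
    |bil T Y z| ≤ 4 * ‖Y‖ / r * (|bil T w z| + |bil T n z|) := by
  have hd0 : 0 < w 0 * n 1 - w 1 * n 0 := lt_of_lt_of_le (by positivity) hd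
  set d := w 0 * n 1 - w 1 * n 0 with hdd
  have e : d * bil T Y z = (Y 0 * n 1 - Y 1 * n 0) * bil T w z
      + (w 0 * Y 1 - w 1 * Y 0) * bil T n z := by
    rw [hdd]; simp only [bil]; ring
  have hb : ∀ u x : Plane, |u 0 * x 1 - u 1 * x 0| ≤ 2 * (‖u‖ * ‖x‖) := by
    intro u x
    have h0 : |u 0 * x 1| ≤ ‖u‖ * ‖x‖ := by
      rw [abs_mul]; have := abs_apply_le_norm u 0; have := abs_apply_le_norm x 1; gcongr
    have h1 : |u 1 * x 0| ≤ ‖u‖ * ‖x‖ := by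
      rw [abs_mul]; have := abs_apply_le_norm u 1; have := abs_apply_le_norm x 0; gcongr
    have := abs_sub (u 0 * x 1) (u 1 * x 0)
    linarith
  have h1 : |Y 0 * n 1 - Y 1 * n 0| ≤ 3 * r * ‖Y‖ := by
    have := hb Y n
    rw [hn] at this
    nlinarith [norm_nonneg Y]
  have h2 : |w 0 * Y 1 - w 1 * Y 0| ≤ 3 * r * ‖Y‖ := by
    have := hb w Y
    have h3 : ‖w‖ * ‖Y‖ ≤ 5 / 4 * r * ‖Y‖ := by gcongr
    nlinarith [norm_nonneg Y]
  have h3 : d * |bil T Y z| ≤ 3 * r * ‖Y‖ * (|bil T w z| + |bil T n z|) := by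
    rw [← abs_of_pos hd0, ← abs_mul, e, mul_add]
    refine (abs_add_le _ _).trans ?_
    rw [abs_mul, abs_mul]
    gcongr
  have h4 : 3 / 4 * r ^ 2 * |bil T Y z| ≤ 3 * r * ‖Y‖ * (|bil T w z| + |bil T n z|) :=
    (mul_le_mul_of_nonneg_right hd (abs_nonneg _)).trans h3
  rw [div_mul_eq_mul_div, le_div_iff₀ hr]
  have h5 : 3 / 4 * r * (|bil T Y z| * r) ≤ 3 / 4 * r * (4 * ‖Y‖ * (|bil T w z| + |bil T n z|)) := by
    linarith
  exact le_of_mul_le_mul_left h5 (by positivity)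

end SweepGeodesic

section SweepGeodesic

open Set Metric

variable {U : Set Plane} {G Z : Plane → Matrix (Fin 2) (Fin 2) ℝ} {f : Plane → ℝ} {p₀ : Plane}
  {R Λ r ℓ s : ℝ} {v : Plane} {γ w : ℝ → Plane}

/-- Translating a geodesic in a fixed transversal direction gives a sweep. -/
theorem IsLocalSolution.exists_isSweep (h : IsLocalSolution U G Z f) (hR : 0 < R)
    (hRU : closedBall p₀ R ⊆ U) (ht : IsTameOn (closedBall p₀ R) G Λ) (hr : 0 < r) (hr1 : r ≤ 1)
    (hs : 0 ≤ s)
    (hbd : ∀ P ∈ U, tensorNorm G P (Z P) ≤ s ∧ gradSq G f P ≤ (3 * (1 + s)) ^ 2 ∧ f P ≤ 1 + 2 * s)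
    (hv : ‖v‖ = r)
    (hgeo : ∀ t ∈ Icc 0 ℓ, HasDerivAt γ (w t) t ∧ HasDerivAt w (-gam G (γ t) (w t) (w t)) t ∧
      γ t ∈ closedBall p₀ (R / 2) ∧ ‖w t - v‖ ≤ r / 4) :
    ∃ q t g py qx gy, IsSweep ℓ (R / 2) (1 / (4 * Λ ^ 2) * (3 / 4 * r ^ 2) ^ 2) (8 * Λ)
      (8 * Λ ^ 3 * (1 + s))
      (fun x y => bil (codazziTensor G Z f (γ x + y • !₂[-v 1, v 0])) (w x) (w x))
      q t g py qx gy := by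
  have hΛ := ht.one_le
  have hG := h.metric
  have hU := h.isOpen
  set n : Plane := !₂[-v 1, v 0] with hndef
  set b := codazziTensor G Z f with hb
  have hn : ‖n‖ = r := by
    have h1 : ‖n‖ ^ 2 = ‖v‖ ^ 2 := by
      rw [norm_sq_plane, norm_sq_plane]
      simp only [hndef, Matrix.cons_val_zero, Matrix.cons_val_one]; ring
    rw [← hv]
    exact (pow_left_inj₀ (norm_nonneg _) (norm_nonneg _) two_ne_zero).1 h1
  have hmemR : ∀ x ∈ Icc 0 ℓ, ∀ y ∈ Icc (-(R / 2)) (R / 2), γ x + y • n ∈ closedBall p₀ R := by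
    intro x hx y hy
    have h1 := (hgeo x hx).2.2.1
    rw [mem_closedBall, dist_eq_norm] at h1 ⊢
    have h2 : ‖y • n‖ ≤ R / 2 := by
      rw [norm_smul, hn, Real.norm_eq_abs]
      have := abs_le.2 hy
      calc |y| * r ≤ R / 2 * 1 := by gcongr
        _ = _ := by ring
    calc ‖γ x + y • n - p₀‖ = ‖(γ x - p₀) + y • n‖ := by congr 1; abel
      _ ≤ ‖γ x - p₀‖ + ‖y • n‖ := norm_add_le _ _
      _ ≤ R := by linarith
  have hmem : ∀ x ∈ Icc 0 ℓ, ∀ y ∈ Icc (-(R / 2)) (R / 2), γ x + y • n ∈ U :=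
    fun x hx y hy => hRU (hmemR x hx y hy)
  have hγR : ∀ x ∈ Icc 0 ℓ, γ x ∈ closedBall p₀ R := fun x hx =>
    closedBall_subset_closedBall (by linarith) (hgeo x hx).2.2.1
  have hwn : ∀ x ∈ Icc 0 ℓ, ‖w x‖ ≤ 5 / 4 * r := by
    intro x hx
    have h1 := (hgeo x hx).2.2.2
    have h2 : ‖w x‖ ≤ ‖w x - v‖ + ‖v‖ := by
      simpa using norm_add_le (w x - v) v
    linarith
  have hdet : ∀ x ∈ Icc 0 ℓ, 3 / 4 * r ^ 2 ≤ w x 0 * n 1 - w x 1 * n 0 := by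
    intro x hx
    have h1 := (hgeo x hx).2.2.2
    have hvv := norm_sq_plane v
    rw [hv] at hvv
    have hin : |inner ℝ (w x - v) v| ≤ r / 4 * r := by
      refine (abs_real_inner_le_norm _ _).trans ?_
      rw [hv]
      gcongr
    have hie : inner ℝ (w x - v) v = (w x 0 - v 0) * v 0 + (w x 1 - v 1) * v 1 := by
      simp [PiLp.inner_apply, Fin.sum_univ_two]; ring
    rw [hie] at hin
    have := (abs_le.1 hin).1
    simp only [hndef, Matrix.cons_val_zero, Matrix.cons_val_one]
    nlinarith
  -- continuity
  have cγ : ContinuousOn γ (Icc 0 ℓ) := fun x hx => (hgeo x hx).1.continuousAt.continuousWithinAt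
  have cw : ContinuousOn w (Icc 0 ℓ) := fun x hx => (hgeo x hx).2.1.continuousAt.continuousWithinAt
  set S := Icc (0 : ℝ) ℓ ×ˢ Icc (-(R / 2)) (R / 2) with hS
  have cw' : ContinuousOn (fun z : ℝ × ℝ => w z.1) S :=
    cw.comp continuousOn_fst fun z hz => hz.1
  have cγ' : ContinuousOn (fun z : ℝ × ℝ => γ z.1) S :=
    cγ.comp continuousOn_fst fun z hz => hz.1
  have cP : ContinuousOn (fun z : ℝ × ℝ => γ z.1 + z.2 • n) S :=
    cγ'.add (continuousOn_snd.smul continuousOn_const)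
  have mP : MapsTo (fun z : ℝ × ℝ => γ z.1 + z.2 • n) S U := fun z hz => hmem z.1 hz.1 z.2 hz.2
  have mγ : MapsTo (fun z : ℝ × ℝ => γ z.1) S U := fun z hz => hRU (hγR z.1 hz.1)
  have cn : ContinuousOn (fun _ : ℝ × ℝ => n) S := continuousOn_const
  have sb := h.contDiffOn_codazziTensor
  have cb : ∀ i j, ContinuousOn (fun z : ℝ × ℝ => b (γ z.1 + z.2 • n) i j) S := fun i j =>
    (sb i j).continuousOn.comp cP mP
  have cΓ : ∀ k i j, ContinuousOn (fun z : ℝ × ℝ => christoffel G k i j (γ z.1 + z.2 • n)) S :=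
    fun k i j => (hG.contDiffOn_christoffel k i j).continuousOn.comp cP mP
  have cΓγ : ∀ k i j, ContinuousOn (fun z : ℝ × ℝ => christoffel G k i j (γ z.1)) S :=
    fun k i j => (hG.contDiffOn_christoffel k i j).continuousOn.comp cγ' mγ
  have ccov : ∀ i j k, ContinuousOn (covDeriv G b i j k) U := by
    intro i j k
    unfold covDeriv
    simp only [Fin.sum_univ_two]
    have hc := fun k i j => (hG.contDiffOn_christoffel k i j).continuousOn
    have hbc := fun i j => (sb i j).continuousOn
    exact (contDiffOn_pd (sb i j) hU k).continuousOn.sub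
      ((((hc 0 k i).mul (hbc 0 j)).add ((hc 0 k j).mul (hbc i 0))).add
        (((hc 1 k i).mul (hbc 1 j)).add ((hc 1 k j).mul (hbc i 1))))
  have ccov' : ∀ i j k, ContinuousOn (fun z : ℝ × ℝ => covDeriv G b i j k (γ z.1 + z.2 • n)) S :=
    fun i j k => (ccov i j k).comp cP mP
  have d1 := fun i => contDiffOn_pd h.smooth hU i
  have d2 := fun i j => contDiffOn_pd (d1 j) hU i
  have cd1 : ∀ i, ContinuousOn (fun z : ℝ × ℝ => pd i f (γ z.1 + z.2 • n)) S := fun i =>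
    (d1 i).continuousOn.comp cP mP
  have cd2 : ∀ i j, ContinuousOn (fun z : ℝ × ℝ => pd i (pd j f) (γ z.1 + z.2 • n)) S := fun i j =>
    (d2 i j).continuousOn.comp cP mP
  have cc : ∀ a : ℝ, ContinuousOn (fun _ : ℝ × ℝ => a) S := fun a => continuousOn_const
  -- derivatives
  have dPy : ∀ x y, HasDerivAt (fun y : ℝ => γ x + y • n) n y := fun x y => by
    simpa using ((hasDerivAt_id y).smul_const n).const_add (γ x)
  have dPx : ∀ x ∈ Icc 0 ℓ, ∀ y : ℝ, HasDerivAt (fun x => γ x + y • n) (w x) x := fun x hx y =>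
    (hgeo x hx).1.add_const _
  have db : ∀ P ∈ U, ∀ i j, DifferentiableAt ℝ (fun q => b q i j) P := fun P hP i j =>
    diffAt_of_contDiffOn (sb i j) hU hP
  have hdisc : ∀ x ∈ Icc 0 ℓ, ∀ y ∈ Ioo (-(R / 2)) (R / 2),
      1 / (4 * Λ ^ 2) * (3 / 4 * r ^ 2) ^ 2
        ≤ bil (b (γ x + y • n)) (w x) (w x) * bil (b (γ x + y • n)) n n
          - bil (b (γ x + y • n)) (w x) n ^ 2 := by
    intro x hx y hy
    have hy' := Ioo_subset_Icc_self hy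
    have hPU := hmem x hx y hy'
    have h1 := ht.one_le_det hG (hmemR x hx y hy') hPU
    have h2 := h.det_codazziTensor hPU
    have h3 := h.codazziTensor_symm hPU 1 0
    rw [← hb] at h2 h3
    have e : bil (b (γ x + y • n)) (w x) (w x) * bil (b (γ x + y • n)) n n
          - bil (b (γ x + y • n)) (w x) n ^ 2
        = (b (γ x + y • n) 0 0 * b (γ x + y • n) 1 1 - b (γ x + y • n) 0 1 * b (γ x + y • n) 0 1)
          * (w x 0 * n 1 - w x 1 * n 0) ^ 2 := by
      simp only [bil]; rw [h3]; ring
    rw [e, h2]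
    have h4 : 1 / (4 * Λ ^ 2) ≤ (G (γ x + y • n) 0 0 * G (γ x + y • n) 1 1
        - G (γ x + y • n) 0 1 * G (γ x + y • n) 0 1) / 4 := by
      rw [div_le_div_iff₀ (by positivity) (by norm_num)]
      linarith
    have h5 := hdet x hx
    have h6 := le_trans (by positivity : 0 ≤ 1 / (4 * Λ ^ 2)) h4
    gcongr
  have hnonneg : ∀ x ∈ Icc 0 ℓ, ∀ y ∈ Icc (-(R / 2)) (R / 2), ∀ u,
      0 ≤ bil (b (γ x + y • n)) u u := fun x hx y hy u => h.bil_nonneg (hmem x hx y hy) u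
  refine ⟨fun x y => bil (b (γ x + y • n)) (w x) n, fun x y => bil (b (γ x + y • n)) n n,
    fun x y => n 0 * pd 0 f (γ x + y • n) + n 1 * pd 1 f (γ x + y • n),
    fun x y => covBil G b (γ x + y • n) (w x) (w x) n
      + bil (b (γ x + y • n)) (0 + gam G (γ x + y • n) n (w x)) (w x)
      + bil (b (γ x + y • n)) (w x) (0 + gam G (γ x + y • n) n (w x)),
    fun x y => covBil G b (γ x + y • n) (w x) n (w x)
      + bil (b (γ x + y • n)) (-gam G (γ x) (w x) (w x) + gam G (γ x + y • n) (w x) (w x)) n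
      + bil (b (γ x + y • n)) (w x) (0 + gam G (γ x + y • n) (w x) n),
    fun x y => n 0 * (n 0 * pd 0 (pd 0 f) (γ x + y • n) + n 1 * pd 1 (pd 0 f) (γ x + y • n))
        + n 1 * (n 0 * pd 0 (pd 1 f) (γ x + y • n) + n 1 * pd 1 (pd 1 f) (γ x + y • n)), ?_⟩
  refine ⟨continuousOn_bil cb cw' cw', continuousOn_bil cb cw' cn, ?_, ?_, ?_, ?_, ?_, ?_, ?_, ?_,
    hdisc, ?_, ?_, ?_⟩
  · exact ((cc _).mul (cd1 0)).add ((cc _).mul (cd1 1))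
  · exact ((continuousOn_covBil ccov' cw' cw' cn).add
      (continuousOn_bil cb (continuousOn_const.add (continuousOn_gam cΓ cn cw')) cw')).add
      (continuousOn_bil cb cw' (continuousOn_const.add (continuousOn_gam cΓ cn cw')))
  · exact ((continuousOn_covBil ccov' cw' cn cw').add
      (continuousOn_bil cb ((continuousOn_gam cΓγ cw' cw').neg.add (continuousOn_gam cΓ cw' cw'))
        cn)).add (continuousOn_bil cb cw' (continuousOn_const.add (continuousOn_gam cΓ cw' cn)))
  · exact ((cc _).mul (((cc _).mul (cd2 0 0)).add ((cc _).mul (cd2 1 0)))).add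
      ((cc _).mul (((cc _).mul (cd2 0 1)).add ((cc _).mul (cd2 1 1))))
  · intro x hx y hy
    exact hasDerivAt_bil (G := G) (P := fun y => γ x + y • n) (V := fun _ => w x)
      (W := fun _ => w x) (db _ (hmem x hx y (Ioo_subset_Icc_self hy))) (dPy x y)
      (hasDerivAt_const _ _) (hasDerivAt_const _ _)
  · intro x hx y hy
    exact hasDerivAt_bil (G := G) (P := fun x => γ x + y • n) (V := w)
      (W := fun _ => n) (db _ (hmem x hx y (Ioo_subset_Icc_self hy))) (dPx x hx y)
      (hgeo x hx).2.1 (hasDerivAt_const _ _)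
  · intro x hx y hy
    have hPU := hmem x hx y (Ioo_subset_Icc_self hy)
    have e := fun i => hasDerivAt_comp_curve (diffAt_of_contDiffOn (d1 i) hU hPU) (dPy x y)
    exact ((e 0).const_mul (n 0)).fun_add ((e 1).const_mul (n 1))
  · intro x hx y hy
    have h1 := hdisc x hx y hy
    have h2 := hnonneg x hx y (Ioo_subset_Icc_self hy) (w x)
    have h3 : 0 < 1 / (4 * Λ ^ 2) * (3 / 4 * r ^ 2) ^ 2 := by positivity
    refine lt_of_le_of_ne h2 fun h0 => ?_
    rw [← h0] at h1
    nlinarith [sq_nonneg (bil (b (γ x + y • n)) (w x) n)]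
  · intro x hx y hy
    have hy' : y ∈ Icc (-(R / 2)) (R / 2) := ⟨by linarith [hy.1], hy.2.le⟩
    have hPU := hmem x hx y hy'
    have hPR := hmemR x hx y hy'
    set P := γ x + y • n with hP
    have hcomm := h.covBil_comm hPU (w x) (w x) n
    have hsym := h.bil_symm hPU
    rw [← hb] at hcomm hsym
    have e : (covBil G b P (w x) (w x) n + bil (b P) (0 + gam G P n (w x)) (w x)
        + bil (b P) (w x) (0 + gam G P n (w x)))
        - (covBil G b P (w x) n (w x)
          + bil (b P) (-gam G (γ x) (w x) (w x) + gam G P (w x) (w x)) n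
          + bil (b P) (w x) (0 + gam G P (w x) n))
        = bil (b P) (gam G P n (w x)) (w x)
          - bil (b P) (gam G P (w x) (w x) - gam G (γ x) (w x) (w x)) n := by
      rw [hcomm, zero_add, zero_add, hG.gam_symm hPU (w x) n, neg_add_eq_sub,
        hsym (w x) (gam G P n (w x))]
      ring
    have hq : bil (b P) n (w x) = bil (b P) (w x) n := hsym _ _
    have f1 := abs_bil_le_of_frame (T := b P) (Y := gam G P n (w x)) hr hn (hwn x hx) (hdet x hx) (w x)
    have f2 := abs_bil_le_of_frame (T := b P) (Y := gam G P (w x) (w x) - gam G (γ x) (w x) (w x))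
      hr hn (hwn x hx) (hdet x hx) n
    rw [hq, abs_of_nonneg (hnonneg x hx y hy' (w x))] at f1
    rw [abs_of_nonneg (hnonneg x hx y hy' n)] at f2
    have g1 : 4 * ‖gam G P n (w x)‖ / r ≤ 8 * Λ := by
      rw [div_le_iff₀ hr]
      have h1 := ht.gam_le P hPR n (w x)
      rw [hn] at h1
      have h2 : Λ * r * ‖w x‖ ≤ Λ * r * (5 / 4 * r) := by
        have := hwn x hx; gcongr
      have h3 : Λ * r * r ≤ Λ * r * 1 := by gcongr
      nlinarith
    have g2 : 4 * ‖gam G P (w x) (w x) - gam G (γ x) (w x) (w x)‖ / r ≤ 8 * Λ * y := by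
      rw [div_le_iff₀ hr]
      have h1 := ht.gam_lip P hPR (γ x) (hγR x hx) (w x) (w x)
      have h0 : ‖P - γ x‖ = y * r := by
        rw [hP, add_sub_cancel_left, norm_smul, hn, Real.norm_eq_abs, abs_of_nonneg hy.1]
      rw [h0] at h1
      have h2 : Λ * (y * r) * ‖w x‖ * ‖w x‖ ≤ Λ * (y * r) * (5 / 4) * (5 / 4) := by
        have h3 := hwn x hx
        have h4 : ‖w x‖ ≤ 5 / 4 := by linarith
        have := hy.1
        gcongr
      have h5 : 0 ≤ Λ * (y * r) := by have := hy.1; positivity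
      nlinarith
    show |_ - _| ≤ _
    rw [e]
    refine (abs_sub _ _).trans (add_le_add (f1.trans ?_) (f2.trans ?_))
    · have := hnonneg x hx y hy' (w x)
      gcongr
    · have := hnonneg x hx y hy' n
      gcongr
  · intro x hx y hy
    have hy' := Ioo_subset_Icc_self hy
    have hPU := hmem x hx y hy'
    obtain ⟨h1, h2, h3⟩ := hbd _ hPU
    exact h.bil_codazziTensor_le ht (hmemR x hx y hy') hPU hs h1 h2 h3 (by rw [hn]; exact hr1)
  · intro x hx y hy
    have hy' := Ioo_subset_Icc_self hy
    have hPU := hmem x hx y hy'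
    obtain ⟨h1, h2, h3⟩ := hbd _ hPU
    have hk : ∀ i, |n i * pd i f (γ x + y • n)| ≤ Λ ^ 2 * (3 * (1 + s)) := fun i => by
      rw [abs_mul]
      have k1 := ht.abs_pd_le hG (hmemR x hx y hy') hPU (by positivity) h2 i
      have k2 := (abs_apply_le_norm n i).trans (hn.le.trans hr1)
      calc |n i| * |pd i f (γ x + y • n)| ≤ 1 * (Λ ^ 2 * (3 * (1 + s))) := by gcongr
        _ = _ := by ring
    refine (abs_add_le _ _).trans ((add_le_add (hk 0) (hk 1)).trans ?_)
    have : Λ ^ 2 * (1 + s) ≤ Λ ^ 3 * (1 + s) := by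
      gcongr
      norm_num
    have : 0 ≤ Λ ^ 3 * (1 + s) := by positivity
    linarith

end SweepGeodesic

/-! ### The local bound for the maximum of the nonlinear term -/

section LocalBound

open Set Metric intervalIntegral

variable {U : Set Plane} {G Z : Plane → Matrix (Fin 2) (Fin 2) ℝ} {f : Plane → ℝ} {p₀ : Plane}
  {γ w : ℝ → Plane}

/-- A direction in which the Codazzi tensor is small stays so along a geodesic. -/
theorem IsLocalSolution.bil_le_along_geodesic (h : IsLocalSolution U G Z f) {g Y H L ℓ : ℝ}
    (hg : 0 < g) (hY : 0 < Y) (hH : 0 < H) (hgH : 16 * Y ≤ g * H) (hL : 0 < L)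
    (hL2 : 4096 * Y ^ 5 / g ^ 2 < L ^ 2) (hLℓ : L * ℓ ≤ Y)
    (hS : ∀ q ∈ U, gradSq (codazziTensor G Z f) (nonlinearTerm G Z f) q ≤ 6 * H ^ 3)
    (hgeo : ∀ t ∈ Icc 0 ℓ, HasDerivAt γ (w t) t ∧ HasDerivAt w (-gam G (γ t) (w t) (w t)) t ∧
      γ t ∈ U ∧ g ≤ bil (G (γ t)) (w t) (w t))
    (h0 : bil (codazziTensor G Z f (γ 0)) (w 0) (w 0) ≤ Y / H) :
    ∀ t ∈ Icc 0 ℓ, bil (codazziTensor G Z f (γ t)) (w t) (w t) ≤ 2 * Y / H := by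
  set β : ℝ → ℝ := fun t => bil (codazziTensor G Z f (γ t)) (w t) (w t) with hβ
  have hβd : ∀ t ∈ Icc 0 ℓ, HasDerivAt β
      (covBil G (codazziTensor G Z f) (γ t) (w t) (w t) (w t)) t := by
    intro t ht
    obtain ⟨h1, h2, h3, -⟩ := hgeo t ht
    refine (hasDerivAt_bil (G := G) (fun i j => diffAt_of_contDiffOn
      (h.contDiffOn_codazziTensor i j) h.isOpen h3) h1 h2 h2).congr_deriv ?_
    rw [neg_add_cancel]
    simp [bil]
  have hbnd : ∀ t ∈ Icc 0 ℓ, Y / H + L / H * t ≤ 2 * Y / H := by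
    intro t ht
    have : L * t ≤ Y := (mul_le_mul_of_nonneg_left ht.2 hL.le).trans hLℓ
    rw [div_mul_eq_mul_div, ← add_div]
    gcongr
    linarith
  intro t ht
  refine le_trans ?_ (hbnd t ht)
  refine image_le_of_deriv_right_lt_deriv_boundary' (f := β)
    (f' := fun t => covBil G (codazziTensor G Z f) (γ t) (w t) (w t) (w t))
    (B := fun t => Y / H + L / H * t) (B' := fun _ => L / H) (a := 0) (b := ℓ)
    (fun x hx => (hβd x hx).continuousAt.continuousWithinAt)
    (fun x hx => (hβd x (Ico_subset_Icc_self hx)).hasDerivWithinAt) (by simpa using h0)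
    (by fun_prop)
    (fun x _ => ?_) ?_ ht
  · have := ((hasDerivAt_id x).const_mul (L / H)).const_add (Y / H)
    simpa using this.hasDerivWithinAt
  · intro x hx hcontact
    have hx' := Ico_subset_Icc_self hx
    obtain ⟨-, -, hxU, hxg⟩ := hgeo x hx'
    have hβ2 : β x ≤ 2 * Y / H := hcontact.le.trans (hbnd x hx')
    have hβ0 : 0 ≤ β x := h.bil_nonneg hxU _
    have hBg := h.bil_metric_le hxU (w x)
    have hc := h.covBil_sq_le hxU (w x)
    have hSx := hS _ hxU
    set B := nonlinearTerm G Z f (γ x) with hB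
    have hB1 : 1 ≤ B := one_le_nonlinearTerm
    set C := covBil G (codazziTensor G Z f) (γ x) (w x) (w x) (w x) with hC
    have hβe : bil (codazziTensor G Z f (γ x)) (w x) (w x) = β x := rfl
    rw [hβe] at hBg hc
    have h1 : g * H ≤ 8 * Y * B := by
      have : g ≤ 4 * B * (2 * Y / H) := (hxg.trans hBg).trans (by gcongr)
      rw [mul_div_assoc', le_div_iff₀ hH] at this
      linarith
    have hB2 : 2 ≤ B := by nlinarith
    have h2 : 3 / 4 * (g * H) ^ 2 ≤ 64 * Y ^ 2 * (B ^ 2 - 1) := by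
      have h3 : (g * H) ^ 2 ≤ (8 * Y * B) ^ 2 := by gcongr
      have h4 : 3 / 4 * B ^ 2 ≤ B ^ 2 - 1 := by nlinarith
      have h5 : 64 * Y ^ 2 * (3 / 4 * B ^ 2) ≤ 64 * Y ^ 2 * (B ^ 2 - 1) := by gcongr
      nlinarith
    have h3 : (B ^ 2 - 1) * C ^ 2 ≤ 48 * Y ^ 3 := by
      have hβ3 : β x ^ 3 ≤ (2 * Y / H) ^ 3 := by gcongr
      have h4 : (6 : ℝ) * H ^ 3 * (2 * Y / H) ^ 3 = 48 * Y ^ 3 := by field_simp; ring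
      calc (B ^ 2 - 1) * C ^ 2 ≤ _ := hc
        _ ≤ 6 * H ^ 3 * β x ^ 3 := by gcongr
        _ ≤ 6 * H ^ 3 * (2 * Y / H) ^ 3 := by gcongr
        _ = _ := h4
    have h4 : (H * C) ^ 2 ≤ 4096 * Y ^ 5 / g ^ 2 := by
      rw [le_div_iff₀ (by positivity)]
      have h5 := mul_le_mul_of_nonneg_right h2 (sq_nonneg C)
      have h6 := mul_le_mul_of_nonneg_left h3 (by positivity : 0 ≤ 64 * Y ^ 2)
      nlinarith
    have h5 : H * C < L := by
      have := abs_lt_of_sq_lt_sq (h4.trans_lt hL2) hL.le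
      exact (abs_lt.1 this).2
    show C < L / H
    rw [lt_div_iff₀ hH]
    linarith

/-- Near every point the maximum of the nonlinear term is bounded exponentially. -/
theorem IsMetricOn.exists_local_bound (hG : IsMetricOn U G) (hp₀ : p₀ ∈ U) :
    ∃ r > 0, ∃ C > 0, ∀ (Z : Plane → Matrix (Fin 2) (Fin 2) ℝ) (f : Plane → ℝ) (s H : ℝ), 0 ≤ s →
      IsLocalSolution U G Z f →
      (∀ P ∈ U, tensorNorm G P (Z P) ≤ s ∧ gradSq G f P ≤ (3 * (1 + s)) ^ 2 ∧ f P ≤ 1 + 2 * s) →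
      (∀ q ∈ U, gradSq (codazziTensor G Z f) (nonlinearTerm G Z f) q ≤ 6 * H ^ 3) →
      ∀ p ∈ closedBall p₀ r, nonlinearTerm G Z f p = H → H ≤ Real.exp (C * (1 + s)) := by
  obtain ⟨R, hR, hRU, Λ, ht⟩ := hG.exists_isTameOn hp₀
  obtain ⟨r, hr, hr1, ℓ₁, hℓ₁, hgeo⟩ := hG.exists_geodesics hR hRU ht
  have hΛ := ht.one_le
  set g := r ^ 2 / (4 * Λ) with hg
  have hg0 : 0 < g := by positivity
  set Y := Λ * r ^ 2 / 2 with hY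
  have hY0 : 0 < Y := by positivity
  set L := 4096 * Y ^ 5 / g ^ 2 + 1 with hL
  have hL0 : 0 < L := by positivity
  have hL2 : 4096 * Y ^ 5 / g ^ 2 < L ^ 2 := by
    have : 0 ≤ 4096 * Y ^ 5 / g ^ 2 := by positivity
    nlinarith
  set ℓ := min ℓ₁ (Y / L) with hℓ
  have hℓ0 : 0 < ℓ := by positivity
  have hLℓ : L * ℓ ≤ Y := by
    have : ℓ ≤ Y / L := min_le_right _ _
    rw [le_div_iff₀ hL0] at this
    linarith
  obtain ⟨C₁, hC₁, hsweep⟩ := IsSweep.neg_log_le (ℓ := ℓ) (η := R / 2)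
    (c := 1 / (4 * Λ ^ 2) * (3 / 4 * r ^ 2) ^ 2) (A := 8 * Λ) hℓ0 (by positivity) (by positivity)
    (by positivity)
  set C₂ := |Real.log (2 * Y * (ℓ ^ 4 * ℓ))| + C₁ * (1 + 8 * Λ ^ 3) with hC₂
  set C₃ := |Real.log (16 * Y / g)| with hC₃
  have hΛ3 : 0 < 1 + 8 * Λ ^ 3 := by positivity
  refine ⟨min r R, by positivity, C₂ + C₃, by positivity, ?_⟩
  intro Z f s H hs h hbd hS p hp hpH
  have hpr : p ∈ closedBall p₀ r := closedBall_subset_closedBall (min_le_left _ _) hp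
  have hpR : p ∈ closedBall p₀ R := closedBall_subset_closedBall (min_le_right _ _) hp
  have hpU := hRU hpR
  have hH1 : 1 ≤ H := hpH ▸ one_le_nonlinearTerm
  have hH0 : 0 < H := by linarith
  rw [← Real.log_le_iff_le_exp hH0]
  have hC₂0 : 0 ≤ C₂ := by positivity
  have hC₃0 : 0 ≤ C₃ := abs_nonneg _
  by_cases hgH : g * H < 16 * Y
  · have h1 : H ≤ 16 * Y / g := by rw [le_div_iff₀ hg0]; linarith
    have h2 : Real.log H ≤ C₃ := (Real.log_le_log hH0 h1).trans (le_abs_self _)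
    nlinarith
  push Not at hgH
  obtain ⟨v₀, hv₀, hvb⟩ := h.exists_bil_le hpU
  have hv₀n : 0 < ‖v₀‖ := norm_pos_iff.2 hv₀
  set v : Plane := (r / ‖v₀‖) • v₀ with hv
  have hvn : ‖v‖ = r := by
    rw [hv, norm_smul, Real.norm_eq_abs, abs_of_pos (by positivity)]
    field_simp
  have hbs : ∀ T : Matrix (Fin 2) (Fin 2) ℝ, bil T v v = (r / ‖v₀‖) ^ 2 * bil T v₀ v₀ := by
    intro T
    simp only [hv, bil, PiLp.smul_apply, smul_eq_mul]; ring
  obtain ⟨γ, w, hγ0, hw0, hgeo'⟩ := hgeo p hpr v hvn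
  have hgeoℓ : ∀ t ∈ Icc 0 ℓ, HasDerivAt γ (w t) t ∧ HasDerivAt w (-gam G (γ t) (w t) (w t)) t ∧
      γ t ∈ closedBall p₀ (R / 2) ∧ ‖w t - v‖ ≤ r / 4 := fun t htt =>
    hgeo' t ⟨htt.1, htt.2.trans (min_le_left _ _)⟩
  have hbound := h.bil_le_along_geodesic (γ := γ) (w := w) hg0 hY0 hH0 hgH hL0 hL2 hLℓ hS
    (fun t htt => by
      obtain ⟨a1, a2, a3, a4⟩ := hgeoℓ t htt
      have hmR : γ t ∈ closedBall p₀ R := closedBall_subset_closedBall (by linarith) a3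
      refine ⟨a1, a2, hRU hmR, ?_⟩
      have h1 := ht.lower _ hmR (w t)
      have h2 : r / 2 ≤ ‖w t‖ := by
        have : ‖v‖ ≤ ‖w t‖ + ‖w t - v‖ := by
          rw [norm_sub_rev]
          simpa using norm_add_le (w t) (v - w t)
        linarith
      have h3 : (r / 2) ^ 2 ≤ ‖w t‖ ^ 2 := by gcongr
      rw [hg, div_le_iff₀ (by positivity)]
      linarith) (by
      rw [hγ0, hw0, le_div_iff₀ hH0, hbs]
      have h1 := ht.upper p hpR v
      rw [hbs, hvn] at h1
      rw [hpH] at hvb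
      have h2 : (r / ‖v₀‖) ^ 2 * (2 * H * bil (codazziTensor G Z f p) v₀ v₀)
          ≤ (r / ‖v₀‖) ^ 2 * bil (G p) v₀ v₀ := by gcongr
      rw [hY]
      linarith)
  obtain ⟨q, t, g', py, qx, gy, hsw⟩ := h.exists_isSweep hR hRU ht hr hr1 hs hbd hvn hgeoℓ
  have hlog := hsweep _ _ _ _ _ _ _ _ (by positivity) hsw
  simp only [zero_smul, add_zero] at hlog
  set δ := ∫ x in 0..ℓ, bil (codazziTensor G Z f (γ x)) (w x) (w x) * (x * (ℓ - x)) ^ 2 with hδ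
  have h0 : (0 : ℝ) ∈ Ioo (-(R / 2)) (R / 2) := ⟨by linarith, by linarith⟩
  have hcont : ContinuousOn (fun x => bil (codazziTensor G Z f (γ x)) (w x) (w x)
      * (x * (ℓ - x)) ^ 2) (Icc 0 ℓ) := by
    have := continuousOn_slice (F := fun x y => bil (codazziTensor G Z f (γ x + y • !₂[-v 1, v 0]))
      (w x) (w x)) hsw.cont_p (Ioo_subset_Icc_self h0)
    simp only [zero_smul, add_zero] at this
    exact this.mul (by fun_prop)
  have hδle : δ ≤ 2 * Y / H * (ℓ ^ 4 * ℓ) := by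
    have h1 : δ ≤ ∫ _ in (0 : ℝ)..ℓ, 2 * Y / H * ℓ ^ 4 := by
      refine integral_mono_on hℓ0.le (ContinuousOn.intervalIntegrable (by
        rw [uIcc_of_le hℓ0.le]; exact hcont)) intervalIntegrable_const ?_
      intro x hx
      have h2 := hbound x hx
      have h3 : (x * (ℓ - x)) ^ 2 ≤ ℓ ^ 4 := by
        have h4 : 0 ≤ x * (ℓ - x) := mul_nonneg hx.1 (by linarith [hx.2])
        have h5 : x * (ℓ - x) ≤ ℓ ^ 2 := by nlinarith [hx.1, hx.2]
        calc (x * (ℓ - x)) ^ 2 ≤ (ℓ ^ 2) ^ 2 := by gcongr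
          _ = ℓ ^ 4 := by ring
      gcongr
    rw [intervalIntegral.integral_const, smul_eq_mul, sub_zero] at h1
    linarith
  have hδ0 : 0 < δ := by
    refine intervalIntegral_pos_of_pos_on (ContinuousOn.intervalIntegrable (by
        rw [uIcc_of_le hℓ0.le]; exact hcont)) ?_ hℓ0
    intro x hx
    have h1 := hsw.pos x (Ioo_subset_Icc_self hx) 0 h0
    simp only [zero_smul, add_zero] at h1
    have : 0 < x * (ℓ - x) := mul_pos hx.1 (by linarith [hx.2])
    positivity
  have h1 : H ≤ 2 * Y * (ℓ ^ 4 * ℓ) / δ := by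
    rw [le_div_iff₀ hδ0]
    have := mul_le_mul_of_nonneg_left hδle hH0.le
    have e : H * (2 * Y / H * (ℓ ^ 4 * ℓ)) = 2 * Y * (ℓ ^ 4 * ℓ) := by field_simp
    linarith
  have h2 := Real.log_le_log hH0 h1
  rw [Real.log_div (by positivity) hδ0.ne'] at h2
  have h3 := le_abs_self (Real.log (2 * Y * (ℓ ^ 4 * ℓ)))
  have h4 : C₁ * (1 + 8 * Λ ^ 3 * (1 + s)) ≤ C₁ * (1 + 8 * Λ ^ 3) * (1 + s) := by
    have : C₁ * (1 + 8 * Λ ^ 3) * (1 + s) = C₁ * (1 + 8 * Λ ^ 3 * (1 + s)) + C₁ * s := by ring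
    rw [this]
    have : 0 ≤ C₁ * s := by positivity
    linarith
  have h5 : |Real.log (2 * Y * (ℓ ^ 4 * ℓ))| ≤ |Real.log (2 * Y * (ℓ ^ 4 * ℓ))| * (1 + s) :=
    le_mul_of_one_le_right (abs_nonneg _) (by linarith)
  have h6 : 0 ≤ C₃ * (1 + s) := by positivity
  have h7 : (C₂ + C₃) * (1 + s) = |Real.log (2 * Y * (ℓ ^ 4 * ℓ))| * (1 + s)
      + C₁ * (1 + 8 * Λ ^ 3) * (1 + s) + C₃ * (1 + s) := by rw [hC₂]; ring
  linarith

end LocalBound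

section HessianBound

variable {U : Set Plane} {G Z : Plane → Matrix (Fin 2) (Fin 2) ℝ} {f : Plane → ℝ} {p : Plane}

theorem IsMetricOn.tensorNorm_sub_sq_le (hG : IsMetricOn U G) (hp : p ∈ U)
    {S T : Matrix (Fin 2) (Fin 2) ℝ} (hS : S 1 0 = S 0 1) (hT : T 1 0 = T 0 1) :
    tensorNorm G p (S - T) ^ 2 ≤ 2 * tensorNorm G p S ^ 2 + 2 * tensorNorm G p T ^ 2 := by
  have hd := hG.det_pos p hp
  have h1 := hG.tensorNorm_sq hp hS
  have h2 := hG.tensorNorm_sq hp hT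
  have h3 := hG.tensorNorm_sq hp (T := S - T) (by simp [hS, hT])
  have h4 := hG.tensorNorm_sq hp (T := S + T) (by simp [hS, hT])
  have e1 : traceAt G p (S - T) = traceAt G p S - traceAt G p T := by
    simp only [traceAt, Fin.sum_univ_two, Matrix.sub_apply]; ring
  have e2 : traceAt G p (S + T) = traceAt G p S + traceAt G p T := by
    simp only [traceAt, Fin.sum_univ_two, Matrix.add_apply]; ring
  rw [e1] at h3
  rw [e2] at h4
  simp only [Matrix.sub_apply] at h3
  simp only [Matrix.add_apply] at h4
  have h5 := mul_nonneg (sq_nonneg (tensorNorm G p (S + T))) hd.le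
  refine le_of_mul_le_mul_right ?_ hd
  linarith

theorem IsMetricOn.tensorNorm_smul_metric_sq (hG : IsMetricOn U G) (hp : p ∈ U) (c : ℝ) :
    tensorNorm G p (c • G p) ^ 2 = 2 * c ^ 2 := by
  have hd := hG.det_pos p hp
  have hs : (c • G p) 1 0 = (c • G p) 0 1 := by simp [hG.symm p hp 1 0]
  have h1 := hG.tensorNorm_sq hp hs
  have h2 := hG.traceAt_mul_det hp hs
  simp only [Matrix.smul_apply, smul_eq_mul] at h1 h2
  have h3 : traceAt G p (c • G p) = 2 * c := by
    refine mul_right_cancel₀ hd.ne' ?_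
    rw [h2]; ring
  rw [h3] at h1
  refine mul_right_cancel₀ hd.ne' ?_
  rw [h1]; ring

theorem IsLocalSolution.tensorNorm_hess_sq_le (h : IsLocalSolution U G Z f) (hp : p ∈ U) :
    tensorNorm G p (hess G f p) ^ 2 ≤ 2 * tensorNorm G p (Z p) ^ 2
      + 2 * nonlinearTerm G Z f p ^ 2 + 2 * (f p - nonlinearTerm G Z f p) ^ 2 := by
  have hxs : xi G Z f p 1 0 = xi G Z f p 0 1 := by
    simp [xi, h.tensor_symm p hp 1 0, h.metric.hess_symm h.smooth hp 1 0, h.metric.symm p hp 1 0]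
  have hcs : ((lap G f p / 2) • G p) 1 0 = ((lap G f p / 2) • G p) 0 1 := by
    simp [h.metric.symm p hp 1 0]
  have e : hess G f p = Z p - (xi G Z f p - (lap G f p / 2) • G p) := by
    ext a b
    simp only [xi, Matrix.sub_apply, Matrix.smul_apply, smul_eq_mul]
    ring
  have h1 := h.metric.tensorNorm_sub_sq_le hp (h.tensor_symm p hp 1 0)
    (T := xi G Z f p - (lap G f p / 2) • G p) (by rw [Matrix.sub_apply, Matrix.sub_apply, hxs, hcs])
  have h2 := h.metric.tensorNorm_sub_sq_le hp hxs hcs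
  rw [h.metric.tensorNorm_smul_metric_sq hp] at h2
  have h3 : nonlinearTerm G Z f p ^ 2 = 1 + 2 * tensorNorm G p (xi G Z f p) ^ 2 := by
    rw [nonlinearTerm, Real.sq_sqrt (by positivity)]
  have h4 : lap G f p = f p - nonlinearTerm G Z f p := by linarith [h.eqn p hp]
  rw [← e] at h1
  rw [h4] at h1 h2
  linarith

end HessianBound

section GlobalBound

variable {M : Type*} [TopologicalSpace M] [ChartedSpace Plane M] [IsManifold (𝓡 2) ∞ M]
  {ρ : SurfaceMetric M} {e : OpenPartialHomeomorph M Plane} {p : Plane}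
  {z : (x : M) → TangentSpace (𝓡 2) x →L[ℝ] TangentSpace (𝓡 2) x →L[ℝ] ℝ} {u : M → ℝ}

/-- The nonlinear term of a solution attains its maximum over the surface. -/
theorem exists_max_nonlinearTerm [CompactSpace M] [Nonempty M] (hρ : HasScalarCurvature ρ (-1))
    (hz : IsTT ρ z) (hu : IsSolution ρ z u) :
    ∃ (H : ℝ) (x₀ : M), (∀ e ∈ charts M, x₀ ∈ e.source →
        nonlinearTerm (comps ρ.inner e) (comps z e) (u ∘ e.symm) (e x₀) = H) ∧
      ∀ e ∈ charts M, ∀ p ∈ e.target,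
        nonlinearTerm (comps ρ.inner e) (comps z e) (u ∘ e.symm) p ≤ H := by
  set F : M → ℝ := fun x => nonlinearTerm (comps ρ.inner (chartAt Plane x))
    (comps z (chartAt Plane x)) (u ∘ (chartAt Plane x).symm) (chartAt Plane x x) with hF
  have hFe : ∀ e ∈ charts M, ∀ p ∈ e.target, F (e.symm p)
      = nonlinearTerm (comps ρ.inner e) (comps z e) (u ∘ e.symm) p := by
    intro e he p hp
    rw [nonlinearTerm_change_chart hz hu.smooth (chartAt_mem_charts (e.symm p)) he hp
      (mem_chart_source _ _)]
  obtain ⟨x₀, hx₀⟩ := exists_forall_le_of_charts (F := F) fun e he =>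
    (isLocalSolution hρ hz hu he).contDiffOn_nonlinearTerm.continuousOn.congr (hFe e he)
  refine ⟨F x₀, x₀, ?_, ?_⟩
  · intro e he hx
    rw [← hFe e he _ (e.map_source hx), e.left_inv hx]
  · intro e he p hp
    rw [← hFe e he p hp]
    exact hx₀ _

/-- The nonlinear term is at most exponential in the norm of the TT-tensor. -/
theorem exists_nonlinearTerm_le_exp [CompactSpace M] [Nonempty M]
    (hρ : HasScalarCurvature ρ (-1)) :
    ∃ C : ℝ, 0 < C ∧
      ∀ z : (x : M) → TangentSpace (𝓡 2) x →L[ℝ] TangentSpace (𝓡 2) x →L[ℝ] ℝ,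
        IsTT ρ z → ∀ u : M → ℝ, IsSolution ρ z u → ∀ e ∈ charts M, ∀ p ∈ e.target,
          nonlinearTerm (comps ρ.inner e) (comps z e) (u ∘ e.symm) p
            ≤ Real.exp (C * (1 + supNorm ρ z)) := by
  have hloc := fun x : M => (isMetricOn_comps (ρ := ρ) (chartAt_mem_charts x)).exists_local_bound
    (mem_chart_target Plane x)
  choose r hr C hC hbound using hloc
  obtain ⟨t, ht⟩ := CompactSpace.elim_nhds_subcover
    (fun x => (chartAt Plane x).source ∩ chartAt Plane x ⁻¹' Metric.closedBall (chartAt Plane x x) (r x))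
    fun x => Filter.inter_mem ((chartAt Plane x).open_source.mem_nhds (mem_chart_source Plane x))
      (((chartAt Plane x).continuousAt (mem_chart_source Plane x)).preimage_mem_nhds
        (Metric.closedBall_mem_nhds _ (hr x)))
  refine ⟨1 + ∑ x ∈ t, C x, ?_, ?_⟩
  · have := Finset.sum_nonneg fun x (_ : x ∈ t) => (hC x).le
    linarith
  intro z hz u hu e he p hp
  obtain ⟨H, x₀, hH, hmax⟩ := exists_max_nonlinearTerm hρ hz hu
  have hx₀ : x₀ ∈ ⋃ x ∈ t, (chartAt Plane x).source ∩
      chartAt Plane x ⁻¹' Metric.closedBall (chartAt Plane x x) (r x) := ht ▸ Set.mem_univ x₀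
  simp only [Set.mem_iUnion] at hx₀
  obtain ⟨x, hxt, hxs, hxb⟩ := hx₀
  have hs : 0 ≤ supNorm ρ z := supNorm_nonneg
  have he' := chartAt_mem_charts x
  have h1 := hbound x (comps z (chartAt Plane x)) (u ∘ (chartAt Plane x).symm) (supNorm ρ z) H hs
    (isLocalSolution hρ hz hu he')
    (fun P hP => ⟨tensorNorm_le_supNorm hz he' hP, gradSq_le hρ hz hu he' hP,
      solution_le hρ hz hu _⟩)
    (fun q hq => energy_le hρ hz hu hmax he' hq) _ hxb (hH _ he' hxs)
  refine (hmax e he p hp).trans (h1.trans (Real.exp_le_exp.2 ?_))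
  have h2 : C x ≤ ∑ x ∈ t, C x := Finset.single_le_sum (fun y _ => (hC y).le) hxt
  gcongr
  linarith

/-- The gradient and the Hessian of a solution are bounded in terms of the norm of the
TT-tensor. -/
theorem exists_gradNorm_hess_le [CompactSpace M] [Nonempty M]
    (hρ : HasScalarCurvature ρ (-1)) :
    ∃ K : ℝ → ℝ, Monotone K ∧
      ∀ z : (x : M) → TangentSpace (𝓡 2) x →L[ℝ] TangentSpace (𝓡 2) x →L[ℝ] ℝ,
        IsTT ρ z → ∀ u : M → ℝ, IsSolution ρ z u → ∀ e ∈ charts M, ∀ p ∈ e.target,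
          gradNorm (comps ρ.inner e) (u ∘ e.symm) p ≤ K (supNorm ρ z) ∧
            tensorNorm (comps ρ.inner e) p (hess (comps ρ.inner e) (u ∘ e.symm) p)
              ≤ K (supNorm ρ z) := by
  obtain ⟨C, hC, hB⟩ := exists_nonlinearTerm_le_exp hρ
  refine ⟨fun s => 3 * (1 + 2 * max s 0 + Real.exp (C * (1 + max s 0))), ?_, ?_⟩
  · intro s s' hss
    have : max s 0 ≤ max s' 0 := max_le_max_right 0 hss
    dsimp only
    gcongr
  intro z hz u hu e he p hp
  have hs : 0 ≤ supNorm ρ z := supNorm_nonneg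
  have hsol := isLocalSolution hρ hz hu he
  have h1 := hB z hz u hu e he p hp
  have h2 : 1 ≤ nonlinearTerm (comps ρ.inner e) (comps z e) (u ∘ e.symm) p := one_le_nonlinearTerm
  have h3 := gradSq_le hρ hz hu he hp
  have h4 := solution_le hρ hz hu (e.symm p)
  have h5 := one_le_solution hρ hz hu (e.symm p)
  have h6 := tensorNorm_le_supNorm (ρ := ρ) hz he hp
  have h7 := hsol.tensorNorm_hess_sq_le hp
  have h8 : 0 ≤ tensorNorm (comps ρ.inner e) p (comps z e p) := tensorNorm_nonneg
  dsimp only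
  rw [max_eq_left hs]
  set s := supNorm ρ z
  set X := Real.exp (C * (1 + s))
  set B := nonlinearTerm (comps ρ.inner e) (comps z e) (u ∘ e.symm) p
  constructor
  · refine (Real.sqrt_le_sqrt h3).trans ?_
    rw [Real.sqrt_sq (by positivity)]
    linarith
  · refine abs_le_of_sq_le_sq' ?_ (by positivity) |>.2
    refine h7.trans ?_
    have e1 : tensorNorm (comps ρ.inner e) p (comps z e p) ^ 2 ≤ (1 + 2 * s + X) ^ 2 :=
      pow_le_pow_left₀ h8 (by linarith) 2
    have e2 : B ^ 2 ≤ (1 + 2 * s + X) ^ 2 := pow_le_pow_left₀ (by linarith) (by linarith) 2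
    have e3 : ((u ∘ e.symm) p - B) ^ 2 ≤ (1 + 2 * s + X) ^ 2 := by
      refine sq_le_sq' ?_ ?_ <;> simp only [Function.comp_apply] <;> linarith
    have e4 := sq_nonneg (1 + 2 * s + X)
    linarith

end GlobalBound

end Moncrief

end

theorem proposition4p3 {M : Type*} [TopologicalSpace M] [T2Space M] [CompactSpace M]
    [ConnectedSpace M] [ChartedSpace Moncrief.Plane M] [IsManifold (𝓡 2) ∞ M]
    (hM : Moncrief.IsOrientable M)
    (ρ : Moncrief.SurfaceMetric M) (hρ : Moncrief.HasScalarCurvature ρ (-1)) :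
    (∃ C : ℝ, 0 < C ∧
      ∀ z : (x : M) → TangentSpace (𝓡 2) x →L[ℝ] TangentSpace (𝓡 2) x →L[ℝ] ℝ,
        Moncrief.IsTT ρ z → ∀ u : M → ℝ, Moncrief.IsSolution ρ z u →
          ∀ e ∈ Moncrief.charts M, ∀ p ∈ e.target,
            Moncrief.nonlinearTerm (Moncrief.comps ρ.inner e) (Moncrief.comps z e)
              (u ∘ e.symm) p ≤ Real.exp (C * (1 + Moncrief.supNorm ρ z))) ∧
    (∃ K : ℝ → ℝ, Monotone K ∧
      ∀ z : (x : M) → TangentSpace (𝓡 2) x →L[ℝ] TangentSpace (𝓡 2) x →L[ℝ] ℝ,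
        Moncrief.IsTT ρ z → ∀ u : M → ℝ, Moncrief.IsSolution ρ z u →
          ∀ e ∈ Moncrief.charts M, ∀ p ∈ e.target,
            Moncrief.gradNorm (Moncrief.comps ρ.inner e) (u ∘ e.symm) p
                ≤ K (Moncrief.supNorm ρ z) ∧
            Moncrief.tensorNorm (Moncrief.comps ρ.inner e) p
                (Moncrief.hess (Moncrief.comps ρ.inner e) (u ∘ e.symm) p)
                ≤ K (Moncrief.supNorm ρ z)) := by
  exact ⟨Moncrief.exists_nonlinearTerm_le_exp hρ, Moncrief.exists_gradNorm_hess_le hρ⟩
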